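/- Let $\hat{\mathcal L}_0$ be the class of equations $u_t+uu_x=A^2(t,x)u_{xx}+A^1(t,x)u_x$ with smooth $A^1,A^2$, $A^2\ne0$ and $A^1_{xx}=0$, so that $A^1=A^{11}(t)x+A^{10}(t)$. Its equivalence groupoid consists of the triples $(\theta,\varphi,\tilde\theta)$, where $\theta,\tilde\theta$ are the coefficient tuples of two equations of the class and $\varphi$ is a point transformation of $(t,x,u)$ connecting these equations. (Everything is local: domains of equations and of transformations $\varphi$ are nonempty open sets whose projections to the $t$-axis and whose sections by constant values of $t$ are connected.) Let $\bar{\mathcal L}_0$ be the class obtained by reparameterizing $\hat{\mathcal L}_0$ with the extended tuples $\bar\theta=(A^{10},A^{11},A^2,Y^0,Y^1,Y^2)$, where the virtual (nonlocal) arbitrary elements $Y^0,Y^1,Y^2$ are functions of $t$ with $$Y^0_t=A^{11},\qquad Y^1_t={\rm e}^{Y^0},\qquad Y^2_t=A^{10}{\rm e}^{Y^0}.$$ The generalized equivalence group of $\bar{\mathcal L}_0$ consists of the (local) point transformations in the space with coordinates $(t,x,u,A^{10},A^{11},A^2,Y^0,Y^1,Y^2)$ that, together with their inverses, induce for each $\bar\theta$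 (whose graph lies in their domain) an admissible transformation of $\bar{\mathcal L}_0$ with source $\bar\theta$. It is, by definition, the extended generalized equivalence group of $\hat{\mathcal L}_0$, and $\hat{\mathcal L}_0$ is called normalized in the extended generalized sense if every equation of $\hat{\mathcal L}_0$ is represented by such a $\bar\theta$ and this group generates the entire equivalence groupoid of $\hat{\mathcal L}_0$; here a family of transformations generates the groupoid if its elements belong to the above group and every admissible transformation of $\hat{\mathcal L}_0$, with any choice of the virtual arbitrary elements for its source and its target, is induced by an element of the family. Let $\breve G^\sim_0$ be the set of transformations \begin{gather*} \tilde t=T,\quad \tilde x=T_t(c_1Y^1+c_0)\left(x+{\rm e}^{-Y^0/2}\breve X^0\right),\quad \tilde u=(c_1Y^1+c_0)u-c_1{\rm e}^{Y^0}x+c_2-c_1Y^2,\\ \tilde A^{10}=(c_1Y^1+c_0)\left(A^{10}-\tfrac12{\rm e}^{-Y^0/2}\breve X^0A^{11}-{\rm e}^{-Y^0/2}\breve X^0_t\right)+c_1{\rm e}^{Y^0/2}\breve X^0+c_2-c_1Y^2,\\ \tilde A^{11}=\frac1{T_t}\left(A^{11}-\frac{T_{tt}}{T_t}-\frac{2c_1{\rm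 e}^{Y^0}}{c_1Y^1+c_0}\right),\quad \tilde A^2=T_t(c_1Y^1+c_0)^2A^2,\\ \tilde Y^0=Y^0+\ln\frac{\delta}{T_t(c_1Y^1+c_0)^2},\quad \tilde Y^1=\frac{c_1'Y^1+c_0'}{c_1Y^1+c_0},\\ \tilde Y^2=\frac{\delta Y^2}{c_1Y^1+c_0}-\frac{\delta\breve X^0{\rm e}^{Y^0/2}}{c_1Y^1+c_0}+c_2\frac{c_1'Y^1+c_0'}{c_1Y^1+c_0}+c_3, \end{gather*} where $\delta=c_1'c_0-c_0'c_1$, $T$ and $\breve X^0$ are smooth functions of $t$ on an open interval, and the $c$'s are constants with $\delta T_t>0$; the domain of each transformation is one (nonempty) of the two sets $c_1Y^1+c_0>0$ and $c_1Y^1+c_0<0$, with $t$ in this interval. Then the class $\hat{\mathcal L}_0$ is normalized in the extended generalized sense. Moreover, the above formulas define point transformations, which constitute a group $\breve G^\sim_0$ under composition (it contains the identity and all inverses, and each composition coincides on its natural domain with an element of $\breve G^\sim_0$), and the equivalence groupoid of $\hat{\mathcal L}_0$ is generated by $\breve G^\sim_0$. -/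

import Mathlib

open Set Filter Topology
open scoped ContDiff

namespace BurgersClass

/-- The space with coordinates `(t, x, u)`. -/
abbrev Space3 : Type := ℝ × ℝ × ℝ

/-- The space with coordinates `(A¹⁰, A¹¹, A², Y⁰, Y¹, Y²)`. -/
abbrev ElemSpace : Type := ℝ × ℝ × ℝ × ℝ × ℝ × ℝ

/-- The space with coordinates `((t, x, u), (A¹⁰, A¹¹, A², Y⁰, Y¹, Y²))`. -/
abbrev Space9 : Type := Space3 × ElemSpace

/-- The projection `(t, x, u) ↦ (t, x)`. -/
def tx (z : Space3) : ℝ × ℝ := (z.1, z.2.1)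

/-- Partial derivative with respect to `t`. -/
noncomputable def dt (f : ℝ × ℝ → ℝ) (p : ℝ × ℝ) : ℝ := fderiv ℝ f p (1, 0)

/-- Partial derivative with respect to `x`. -/
noncomputable def dx (f : ℝ × ℝ → ℝ) (p : ℝ × ℝ) : ℝ := fderiv ℝ f p (0, 1)

/-- The domains on which equations and point transformations live: nonempty open sets that are
connected in the fibred sense, i.e. their projections to the `t`-axis and
their sections by constant values of `t` are connected.
Every point of an open set has such neighbourhoods inside the set (open boxes). -/
structure IsFibredDomain {F : Type*} [TopologicalSpace F] (S : Set (ℝ × F)) : Prop where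
  isOpen : IsOpen S
  nonempty : S.Nonempty
  connected_base : IsPreconnected (Prod.fst '' S)
  connected_fibre : ∀ t : ℝ, IsPreconnected {y : F | (t, y) ∈ S}

/-- A (local) point transformation: a smooth diffeomorphism between open sets. -/
def IsPointTransformation {E : Type*} [NormedAddCommGroup E] [NormedSpace ℝ E]
    (φ : OpenPartialHomeomorph E E) : Prop :=
  ContDiffOn ℝ ∞ φ φ.source ∧ ContDiffOn ℝ ∞ φ.symm φ.target

/-- The coefficients, over the domain `dom`, of an equation
`u_t + u u_x = A²(t,x) u_xx + A¹(t,x) u_x`. -/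
structure Eqn where
  dom : Set (ℝ × ℝ)
  A1 : ℝ × ℝ → ℝ
  A2 : ℝ × ℝ → ℝ

/-- The function `v` satisfies the equation `E` at the point `p`. -/
def Eqn.HoldsAt (E : Eqn) (v : ℝ × ℝ → ℝ) (p : ℝ × ℝ) : Prop :=
  dt v p + v p * dx v p = E.A2 p * dx (dx v) p + E.A1 p * dx v p

/-- The class of all equations `u_t + u u_x = A² u_xx + A¹ u_x` with smooth `A¹`, `A²`, `A² ≠ 0`. -/
structure InHatL (E : Eqn) : Prop where
  domain : IsFibredDomain E.dom
  smooth_A1 : ContDiffOn ℝ ∞ E.A1 E.dom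
  smooth_A2 : ContDiffOn ℝ ∞ E.A2 E.dom
  A2_ne_zero : ∀ p ∈ E.dom, E.A2 p ≠ 0

/-- The singular subclass, singled out by the constraint `A¹_xx = 0`. -/
def hatL0 : Set Eqn := {E | InHatL E ∧ ∀ p ∈ E.dom, dx (dx E.A1) p = 0}

/-- The point transformation `φ` connects the equations `E` and `E'`: the domains of `φ` and of its
inverse lie over the domains of the equations, and the second prolongation of `φ` maps the
submanifold of the jet space defined by `E` to the one defined by `E'`, in both directions.
The action of the prolongation on 2-jets is expressed through functions representing them:
`v` and `v'` are functions of `(t,x)` such that `φ` maps the graph of `v` near `p`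
to the graph of `v'`, transversally to the fibres. -/
structure Connects (E : Eqn) (φ : OpenPartialHomeomorph Space3 Space3) (E' : Eqn) : Prop where
  source_domain : IsFibredDomain φ.source
  target_domain : IsFibredDomain φ.target
  source_over : tx '' φ.source = E.dom
  target_over : tx '' φ.target = E'.dom
  jets : ∀ (p : ℝ × ℝ) (v v' : ℝ × ℝ → ℝ),
    (p.1, p.2, v p) ∈ φ.source →
    ContDiffAt ℝ 2 v p →
    ContDiffAt ℝ 2 v' (tx (φ (p.1, p.2, v p))) →
    (∀ᶠ q in 𝓝 p, v' (tx (φ (q.1, q.2, v q))) = (φ (q.1, q.2, v q)).2.2) →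
    (fderiv ℝ (fun q : ℝ × ℝ => tx (φ (q.1, q.2, v q))) p).det ≠ 0 →
    (E.HoldsAt v p ↔ E'.HoldsAt v' (tx (φ (p.1, p.2, v p))))

/-- The equivalence groupoid of the singular subclass: the set of its admissible transformations. -/
def hatGroupoid : Set (Eqn × OpenPartialHomeomorph Space3 Space3 × Eqn) :=
  {a | a.1 ∈ hatL0 ∧ a.2.2 ∈ hatL0 ∧ IsPointTransformation a.2.1 ∧ Connects a.1 a.2.1 a.2.2}

/-- Extended tuples of arbitrary elements `(A¹⁰, A¹¹, A², Y⁰, Y¹, Y²)` over the domain `dom`;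
all elements except `A²` depend on `t` only. -/
structure ExtTuple where
  dom : Set (ℝ × ℝ)
  A10 : ℝ → ℝ
  A11 : ℝ → ℝ
  A2 : ℝ × ℝ → ℝ
  Y0 : ℝ → ℝ
  Y1 : ℝ → ℝ
  Y2 : ℝ → ℝ

/-- The equation `u_t + u u_x = A² u_xx + (A¹¹ x + A¹⁰) u_x` associated with an extended tuple. -/
def ExtTuple.eqn (θ : ExtTuple) : Eqn where
  dom := θ.dom
  A1 := fun p => θ.A11 p.1 * p.2 + θ.A10 p.1
  A2 := θ.A2

/-- The value of an extended tuple at the point `(t, x)`. -/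
def ExtTuple.val (θ : ExtTuple) (p : ℝ × ℝ) : ElemSpace :=
  (θ.A10 p.1, θ.A11 p.1, θ.A2 p, θ.Y0 p.1, θ.Y1 p.1, θ.Y2 p.1)

/-- The auxiliary system for extended tuples, including the equations
`Y⁰_t = A¹¹`, `Y¹_t = exp Y⁰`, `Y²_t = A¹⁰ exp Y⁰` for the virtual arbitrary elements. -/
structure InBarL0 (θ : ExtTuple) : Prop where
  domain : IsFibredDomain θ.dom
  smooth_A10 : ContDiffOn ℝ ∞ θ.A10 (Prod.fst '' θ.dom)
  smooth_A11 : ContDiffOn ℝ ∞ θ.A11 (Prod.fst '' θ.dom)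
  smooth_A2 : ContDiffOn ℝ ∞ θ.A2 θ.dom
  A2_ne_zero : ∀ p ∈ θ.dom, θ.A2 p ≠ 0
  deriv_Y0 : ∀ t ∈ Prod.fst '' θ.dom, HasDerivAt θ.Y0 (θ.A11 t) t
  deriv_Y1 : ∀ t ∈ Prod.fst '' θ.dom, HasDerivAt θ.Y1 (Real.exp (θ.Y0 t)) t
  deriv_Y2 : ∀ t ∈ Prod.fst '' θ.dom, HasDerivAt θ.Y2 (θ.A10 t * Real.exp (θ.Y0 t)) t

/-- The reparameterized class with the extended tuples as its arbitrary elements. -/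
def barL0 : Set ExtTuple := {θ | InBarL0 θ}

/-- The extended tuple `θ` is associated with the equation `E`. -/
def Represents (θ : ExtTuple) (E : Eqn) : Prop :=
  θ.dom = E.dom ∧ EqOn θ.eqn.A1 E.A1 E.dom ∧ EqOn θ.A2 E.A2 E.dom

/-- The equivalence groupoid of the reparameterized class. -/
def barGroupoid : Set (ExtTuple × OpenPartialHomeomorph Space3 Space3 × ExtTuple) :=
  {a | a.1 ∈ barL0 ∧ a.2.2 ∈ barL0 ∧ IsPointTransformation a.2.1 ∧
    Connects a.1.eqn a.2.1 a.2.2.eqn}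

/-- The transformation `Φ` of the extended space induces the triple `(θ, φ, θ')`: substituting the
values of `θ` for the arbitrary elements in the `(t,x,u)`-components of `Φ` gives `φ`, and
the remaining components of `Φ` give the values of `θ'` at the new variables. -/
def Induces (Φ : OpenPartialHomeomorph Space9 Space9) (θ : ExtTuple)
    (φ : OpenPartialHomeomorph Space3 Space3) (θ' : ExtTuple) : Prop :=
  ∀ z ∈ φ.source, (z, θ.val (tx z)) ∈ Φ.source ∧
    Φ (z, θ.val (tx z)) = (φ z, θ'.val (tx (φ z)))

/-- `Φ` maps the reparameterized class to itself: with every tuple `θ` of the class whose graph is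
in the domain of `Φ`, it induces an admissible transformation of the class with the source `θ`. -/
def Preserves (Φ : OpenPartialHomeomorph Space9 Space9) : Prop :=
  ∀ θ ∈ barL0, ∀ Ω : Set Space3, IsFibredDomain Ω → tx '' Ω = θ.dom →
    (∀ z ∈ Ω, (z, θ.val (tx z)) ∈ Φ.source) →
    ∃ (φ : OpenPartialHomeomorph Space3 Space3) (θ' : ExtTuple),
      φ.source = Ω ∧ (θ, φ, θ') ∈ barGroupoid ∧ Induces Φ θ φ θ'

/-- The generalized equivalence group of the reparameterized class,
i.e. the extended generalized equivalence group of the singular subclass. -/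
def barG : Set (OpenPartialHomeomorph Space9 Space9) :=
  {Φ | IsPointTransformation Φ ∧ Preserves Φ ∧ Preserves Φ.symm}

/-- The reparameterized class covers the singular subclass. -/
def IsCovering : Prop :=
  (∀ θ ∈ barL0, θ.eqn ∈ hatL0) ∧ ∀ E ∈ hatL0, ∃ θ ∈ barL0, Represents θ E

/-- The family `G` generates the equivalence groupoid of the singular subclass: its elements induce
admissible transformations, and every admissible transformation is induced by an element of `G`,
whatever values of the virtual arbitrary elements are chosen for its source and its target. -/
def GeneratesHatGroupoid (G : Set (OpenPartialHomeomorph Space9 Space9)) : Prop :=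
  G ⊆ barG ∧
  ∀ (E : Eqn) (φ : OpenPartialHomeomorph Space3 Space3) (E' : Eqn), (E, φ, E') ∈ hatGroupoid →
    ∀ θ ∈ barL0, Represents θ E → ∀ θ' ∈ barL0, Represents θ' E' →
      ∃ Φ ∈ G, Induces Φ θ φ θ'

/-- The singular subclass is normalized in the extended generalized sense: it is covered by the
class reparameterized with the virtual arbitrary elements, and the generalized equivalence group
of the latter class generates the entire equivalence groupoid. -/
def HatL0NormalizedInExtendedGeneralizedSense : Prop :=
  IsCovering ∧ GeneratesHatGroupoid barG

/-- The group parameters: functions `T`, `X` of `t` on an open interval `I`, constants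
`c₀, c₁, c₂, c₃, c₀', c₁'` and a sign `ε`, which selects the connected component
`ε (c₁ Y¹ + c₀) > 0` of the set `c₁ Y¹ + c₀ ≠ 0`. -/
structure Params where
  I : Set ℝ
  T : ℝ → ℝ
  X : ℝ → ℝ
  c0 : ℝ
  c1 : ℝ
  c2 : ℝ
  c3 : ℝ
  c0' : ℝ
  c1' : ℝ
  ε : ℝ

/-- `δ = c₁' c₀ - c₀' c₁`. -/
def Params.δ (P : Params) : ℝ := P.c1' * P.c0 - P.c0' * P.c1

/-- The domain of the transformation with the parameters `P`. -/
def Params.source (P : Params) : Set Space9 :=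
  {z | z.1.1 ∈ P.I ∧ 0 < P.ε * (P.c1 * z.2.2.2.2.2.1 + P.c0)}

/-- The constraints on the parameters. -/
structure Params.Valid (P : Params) : Prop where
  isOpen : IsOpen P.I
  connected : IsPreconnected P.I
  smooth_T : ContDiffOn ℝ ∞ P.T P.I
  smooth_X : ContDiffOn ℝ ∞ P.X P.I
  pos : ∀ t ∈ P.I, 0 < P.δ * deriv P.T t
  sign : P.ε = 1 ∨ P.ε = -1
  nonempty : P.source.Nonempty

/-- The components of the transformation with the parameters `P`. -/
noncomputable def Params.map (P : Params) : Space9 → Space9 :=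
  fun ⟨⟨t, x, u⟩, ⟨a10, a11, a2, y0, y1, y2⟩⟩ =>
    let w := P.c1 * y1 + P.c0
    let Tt := deriv P.T t
    let Ttt := deriv (deriv P.T) t
    ((P.T t,
      Tt * w * (x + Real.exp (-y0 / 2) * P.X t),
      w * u - P.c1 * Real.exp y0 * x + P.c2 - P.c1 * y2),
     (w * (a10 - 1 / 2 * Real.exp (-y0 / 2) * P.X t * a11 - Real.exp (-y0 / 2) * deriv P.X t)
        + P.c1 * Real.exp (y0 / 2) * P.X t + P.c2 - P.c1 * y2,
      1 / Tt * (a11 - Ttt / Tt - 2 * P.c1 * Real.exp y0 / w),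
      Tt * w ^ 2 * a2,
      y0 + Real.log (P.δ / (Tt * w ^ 2)),
      (P.c1' * y1 + P.c0') / w,
      P.δ * y2 / w - P.δ * P.X t * Real.exp (y0 / 2) / w
        + P.c2 * ((P.c1' * y1 + P.c0') / w) + P.c3))

/-- `Φ` is the point transformation with the parameters `P`. -/
def IsTransformationWith (Φ : OpenPartialHomeomorph Space9 Space9) (P : Params) : Prop :=
  IsPointTransformation Φ ∧ Φ.source = P.source ∧ EqOn Φ P.map P.source

/-- The group of the point transformations with all admitted values of the parameters. -/
def breveG : Set (OpenPartialHomeomorph Space9 Space9) :=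
  {Φ | ∃ P : Params, P.Valid ∧ IsTransformationWith Φ P}

/-- A family of locally defined transformations is a group under composition: it contains the
identity and the inverses, and every composition of its elements, on the natural domain of the
composition, coincides with an element of the family. -/
def IsLocalGroup (G : Set (OpenPartialHomeomorph Space9 Space9)) : Prop :=
  OpenPartialHomeomorph.refl Space9 ∈ G ∧
  (∀ Φ ∈ G, Φ.symm ∈ G) ∧
  ∀ Φ ∈ G, ∀ Ψ ∈ G, ∃ Χ ∈ G,
    (Φ.trans Ψ).source ⊆ Χ.source ∧ EqOn (Φ.trans Ψ) Χ (Φ.trans Ψ).source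

end BurgersClass

namespace BurgersClass

/-! ### Second derivatives along curves, and functions that are affine or constant along lines. -/

section Calculus

variable {E : Type*} [NormedAddCommGroup E] [NormedSpace ℝ E]

/-! Admissible transformations are found by the direct method, and the virtual elements turn out to
be exactly the integrals needed to write them in closed form.

At a point, the equation imposes a single relation on the 2-jet of a solution: once v_x, v_xx and
v_tt are chosen freely, v_t is determined. A jet on the source equation must go to a jet on the
target equation (`Connects.exists_jetRelation`). Writing (T, X, U) for the components of φ, varying
v_tt forces T = T(t), varying v_xx and v_x forces X_u = 0, and splitting the remaining condition in
powers of v_x and then of u gives T_t U_u = X_x, U_uu = U_ux = U_xx = X_xx = 0 and U_x = -U_tu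
(`Connects.determiningEquations`). Hence φ is affine on the fibres t = const: X = T_t w x + b and U
= w u + G x + h, with w, G, h, b functions of t. Since A¹ is affine in x on both sides, splitting in
x leaves w_t = -G, G_t = A¹¹ G, h_t = A¹⁰ G and two relations that express the new A¹¹ and A¹⁰
(`Connects.exists_canonicalForm`).

These ordinary differential equations integrate through the virtual elements: G = -c₁ exp Y⁰, w = c₁
Y¹ + c₀, h = c₂ - c₁ Y². The virtual elements of the target are then constrained too. The product
T_t w² exp(Ỹ⁰ - Y⁰) is a constant δ, so δ T_t > 0; consequently Ỹ¹ is a linear fractional function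
of Y¹ with determinant δ and denominator w, and Ỹ² is known up to a constant c₃. The function X̆ is
b divided by T_t w exp(-Y⁰/2). This recovers all the parameters (`CanonicalForm.exists_induces`).

Conversely, the formulas for the new A¹¹ and A¹⁰ are what the relations dY⁰ = A¹¹ dt, dY¹ = exp Y⁰
dt, dY² = A¹⁰ exp Y⁰ dt dictate once the new Y's are given (`Contact.map`). So extended tuples go to
extended tuples, and `holdsAt_iff` verifies that solutions correspond. The same principle gives the
A-components of compositions without computing them. The group law is a product of 2×2 matrices
acting by linear fractional maps on Y¹, with w as its cocycle, accompanied by explicit laws for T,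
X̆, c₂ and c₃ (`Params.map_map`). Normalization follows because the explicit family lies in the
extended generalized equivalence group and already generates everything. -/

theorem deriv_deriv_comp {f : E → ℝ} {m : ℝ → E} {s : ℝ} (hf : ContDiffAt ℝ 2 f (m s))
    (hm : ContDiffAt ℝ 2 m s) :
    deriv (deriv fun τ => f (m τ)) s =
      fderiv ℝ (fderiv ℝ f) (m s) (deriv m s) (deriv m s) +
        fderiv ℝ f (m s) (deriv (deriv m) s) := by
  have hf1 : ∀ᶠ y in 𝓝 (m s), DifferentiableAt ℝ f y := by
    filter_upwards [hf.eventually (by simp)] with y hy using hy.differentiableAt (by norm_num)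
  have hm1 : ∀ᶠ τ in 𝓝 s, DifferentiableAt ℝ m τ := by
    filter_upwards [hm.eventually (by simp)] with y hy using hy.differentiableAt (by norm_num)
  have h1 : (deriv fun τ => f (m τ)) =ᶠ[𝓝 s] fun τ => fderiv ℝ f (m τ) (deriv m τ) := by
    filter_upwards [hm.continuousAt.eventually hf1, hm1] with τ h1 h2
    exact fderiv_comp_deriv τ h1 h2
  rw [h1.deriv_eq]
  have hf2 : HasFDerivAt (fderiv ℝ f) (fderiv ℝ (fderiv ℝ f) (m s)) (m s) :=
    ((hf.fderiv_right (m := 1) (by norm_num)).differentiableAt (by norm_num)).hasFDerivAt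
  have hm2 : DifferentiableAt ℝ (deriv m) s := by
    have := (hm.fderiv_right (m := 1) (by norm_num)).differentiableAt (by norm_num)
    exact this.clm_apply (differentiableAt_const _)
  have h3 := hf2.comp_hasDerivAt s (hm.differentiableAt (by norm_num)).hasDerivAt
  exact (h3.clm_apply hm2.hasDerivAt).deriv

theorem hasDerivAt_quadratic_curve (z ξ η : E) (s : ℝ) :
    HasDerivAt (fun τ : ℝ => z + τ • ξ + (τ ^ 2 / 2) • η) (ξ + s • η) s := by
  have h1 : HasDerivAt (fun τ : ℝ => τ ^ 2 / 2) s s := by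
    simpa using (hasDerivAt_pow 2 s).div_const 2
  exact ((((hasDerivAt_id s).smul_const ξ).const_add z).add (h1.smul_const η)).congr_deriv
    (by simp)

theorem deriv_quadratic_curve (z ξ η : E) :
    deriv (fun τ : ℝ => z + τ • ξ + (τ ^ 2 / 2) • η) = fun s => ξ + s • η :=
  funext fun s => (hasDerivAt_quadratic_curve z ξ η s).deriv

theorem deriv_deriv_quadratic_curve (z ξ η : E) (s : ℝ) :
    deriv (deriv (fun τ : ℝ => z + τ • ξ + (τ ^ 2 / 2) • η)) s = η := by
  rw [deriv_quadratic_curve]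
  simpa using (((hasDerivAt_id s).smul_const η).const_add ξ).deriv

theorem contDiff_quadratic_curve (z ξ η : E) {n : WithTop ℕ∞} :
    ContDiff ℝ n (fun τ : ℝ => z + τ • ξ + (τ ^ 2 / 2) • η) := by
  fun_prop

theorem fderiv_fderiv_apply {f : E → ℝ} {z : E} (hf : ContDiffAt ℝ 2 f z) (a b : E) :
    fderiv ℝ (fun y => fderiv ℝ f y b) z a = fderiv ℝ (fderiv ℝ f) z a b := by
  have := (hf.fderiv_right (m := 1) (by norm_num)).differentiableAt (by norm_num)
  rw [fderiv_clm_apply this (differentiableAt_const _)]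
  simp

theorem fderiv_fderiv_comm {f : E → ℝ} {z : E} (hf : ContDiffAt ℝ 2 f z) (a b : E) :
    fderiv ℝ (fun y => fderiv ℝ f y b) z a = fderiv ℝ (fun y => fderiv ℝ f y a) z b := by
  rw [fderiv_fderiv_apply hf, fderiv_fderiv_apply hf]
  exact (hf.isSymmSndFDerivAt (by simp)) a b

theorem contDiffOn_fderiv_apply {f : E → ℝ} {S : Set E} (hS : IsOpen S)
    (hf : ContDiffOn ℝ ∞ f S) (b : E) : ContDiffOn ℝ ∞ (fun y => fderiv ℝ f y b) S :=
  (hf.fderiv_of_isOpen hS (by simp)).clm_apply contDiffOn_const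

theorem fderiv_apply_eq_zero_of_eqOn {f : E → ℝ} {S : Set E} (hS : IsOpen S) {c : ℝ}
    (hf : ∀ z ∈ S, f z = c) {z : E} (hz : z ∈ S) (b : E) : fderiv ℝ f z b = 0 := by
  have : f =ᶠ[𝓝 z] fun _ => c := by
    filter_upwards [hS.mem_nhds hz] with y hy using hf y hy
  rw [this.fderiv_eq]; simp

theorem fderiv_apply_congr {f g : E → ℝ} {S : Set E} (hS : IsOpen S)
    (hf : ∀ z ∈ S, f z = g z) {z : E} (hz : z ∈ S) : fderiv ℝ f z = fderiv ℝ g z := by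
  have : f =ᶠ[𝓝 z] g := by
    filter_upwards [hS.mem_nhds hz] with y hy using hf y hy
  rw [this.fderiv_eq]

theorem eventually_line_mem {S : Set E} (hS : IsOpen S) {z : E} (hz : z ∈ S) (b : E) :
    ∃ ε > 0, ∀ τ ∈ Ioo (-ε) ε, z + (τ : ℝ) • b ∈ S := by
  have hc : ContinuousAt (fun τ : ℝ => z + τ • b) 0 := by fun_prop
  have : ∀ᶠ τ : ℝ in 𝓝 0, z + τ • b ∈ S := hc.eventually (hS.mem_nhds (by simpa using hz))
  obtain ⟨ε, hε, h⟩ := Metric.eventually_nhds_iff.1 this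
  refine ⟨ε, hε, fun τ hτ => h ?_⟩
  simpa [abs_lt] using hτ

theorem hasDerivAt_line {f : E → ℝ} {z b : E} {τ : ℝ} (hf : DifferentiableAt ℝ f (z + τ • b)) :
    HasDerivAt (fun τ : ℝ => f (z + τ • b)) (fderiv ℝ f (z + τ • b) b) τ := by
  have h1 : HasDerivAt (fun τ : ℝ => z + τ • b) b τ := by
    simpa using ((hasDerivAt_id τ).smul_const b).const_add z
  exact hf.hasFDerivAt.comp_hasDerivAt τ h1

theorem eq_on_Ioo_of_hasDerivAt {ε : ℝ} {f g f' : ℝ → ℝ} (hε : 0 < ε)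
    (hf : ∀ τ ∈ Ioo (-ε) ε, HasDerivAt f (f' τ) τ) (hg : ∀ τ ∈ Ioo (-ε) ε, HasDerivAt g (f' τ) τ)
    (h0 : f 0 = g 0) : ∀ τ ∈ Ioo (-ε) ε, f τ = g τ := by
  intro τ hτ
  refine (isOpen_Ioo (a := -ε) (b := ε)).eqOn_of_deriv_eq isPreconnected_Ioo
    (fun τ hτ => (hf τ hτ).differentiableAt.differentiableWithinAt)
    (fun τ hτ => (hg τ hτ).differentiableAt.differentiableWithinAt)
    (fun τ hτ => by rw [(hf τ hτ).deriv, (hg τ hτ).deriv]) (x := 0) ⟨by linarith, hε⟩ h0 hτ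

/-- A function with vanishing second derivative in the direction `b` is affine on lines. -/
theorem affine_on_line {f : E → ℝ} {S : Set E} {b : E} (hS : IsOpen S)
    (hf : ContDiffOn ℝ ∞ f S) (h0 : ∀ z ∈ S, fderiv ℝ (fun y => fderiv ℝ f y b) z b = 0)
    {z : E} {ε : ℝ} (hε : 0 < ε) (hm : ∀ τ ∈ Ioo (-ε) ε, z + (τ : ℝ) • b ∈ S) :
    ∀ τ ∈ Ioo (-ε) ε, f (z + τ • b) = f z + τ * fderiv ℝ f z b := by
  have hd : ∀ {g : E → ℝ}, ContDiffOn ℝ ∞ g S → ∀ y ∈ S, DifferentiableAt ℝ g y := fun hg y hy =>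
    (hg.contDiffAt (hS.mem_nhds hy)).differentiableAt (by simp)
  have h1 : ∀ τ ∈ Ioo (-ε) ε, fderiv ℝ f (z + τ • b) b = fderiv ℝ f z b := by
    refine eq_on_Ioo_of_hasDerivAt (f' := fun _ => 0) hε (fun τ hτ => ?_)
      (fun τ _ => hasDerivAt_const τ _) (by simp)
    have := hasDerivAt_line (hd (contDiffOn_fderiv_apply hS hf b) _ (hm τ hτ))
    rwa [h0 _ (hm τ hτ)] at this
  refine eq_on_Ioo_of_hasDerivAt (f' := fun _ => fderiv ℝ f z b) hε (fun τ hτ => ?_)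
      (fun τ _ => ?_) (by simp)
  · have := hasDerivAt_line (hd hf _ (hm τ hτ))
    rwa [h1 _ hτ] at this
  · simpa using ((hasDerivAt_id τ).mul_const (fderiv ℝ f z b)).const_add (f z)

theorem const_on_line {f : E → ℝ} {S : Set E} {b : E} (hS : IsOpen S)
    (hf : ContDiffOn ℝ ∞ f S) (h0 : ∀ z ∈ S, fderiv ℝ f z b = 0)
    {z : E} {ε : ℝ} (hε : 0 < ε) (hm : ∀ τ ∈ Ioo (-ε) ε, z + (τ : ℝ) • b ∈ S) :
    ∀ τ ∈ Ioo (-ε) ε, f (z + τ • b) = f z := by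
  intro τ hτ
  have hz : z ∈ S := by simpa using hm 0 ⟨by linarith, hε⟩
  rw [affine_on_line hS hf (fun z hz => fderiv_apply_eq_zero_of_eqOn hS h0 hz b) hε hm τ hτ,
    h0 z hz, mul_zero, add_zero]

end Calculus

/-! ### Partial derivatives on the (t, x)-plane, integration on intervals, functions constant on
fibres. -/

theorem ContinuousLinearMap.det_prod (L : ℝ × ℝ →L[ℝ] ℝ × ℝ) :
    L.det = (L (1, 0)).1 * (L (0, 1)).2 - (L (0, 1)).1 * (L (1, 0)).2 := by
  rw [ContinuousLinearMap.det, ← LinearMap.det_toMatrix (Module.Basis.finTwoProd ℝ), Matrix.det_fin_two]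
  simp [LinearMap.toMatrix_apply]

theorem dt_eq_deriv {f : ℝ × ℝ → ℝ} {p : ℝ × ℝ} (hf : DifferentiableAt ℝ f p) :
    HasDerivAt (fun τ => f (τ, p.2)) (dt f p) p.1 :=
  hf.hasFDerivAt.comp_hasDerivAt (x := p.1) (f := fun τ => (τ, p.2))
    ((hasDerivAt_id p.1).prodMk (hasDerivAt_const p.1 p.2))

theorem dx_eq_deriv {f : ℝ × ℝ → ℝ} {p : ℝ × ℝ} (hf : DifferentiableAt ℝ f p) :
    HasDerivAt (fun τ => f (p.1, τ)) (dx f p) p.2 :=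
  hf.hasFDerivAt.comp_hasDerivAt (x := p.2) (f := fun τ => (p.1, τ))
    ((hasDerivAt_const p.2 p.1).prodMk (hasDerivAt_id p.2))

/-- Functions on an open preconnected set of reals with equal derivatives differ by a constant. -/
theorem exists_eq_add_const {I : Set ℝ} (hI : IsOpen I) (hc : IsPreconnected I) {f g f' : ℝ → ℝ}
    (hf : ∀ t ∈ I, HasDerivAt f (f' t) t) (hg : ∀ t ∈ I, HasDerivAt g (f' t) t) :
    ∃ k, ∀ t ∈ I, f t = g t + k := by
  obtain rfl | ⟨t₀, h₀⟩ := I.eq_empty_or_nonempty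
  · exact ⟨0, by simp⟩
  refine ⟨f t₀ - g t₀, fun t ht => ?_⟩
  refine hI.eqOn_of_deriv_eq (f := f) (g := fun t => g t + (f t₀ - g t₀)) hc
    (fun τ hτ => (hf τ hτ).differentiableAt.differentiableWithinAt)
    (fun τ hτ => ((hg τ hτ).add_const _).differentiableAt.differentiableWithinAt)
    (fun τ hτ => by rw [(hf τ hτ).deriv, ((hg τ hτ).add_const _).deriv]) h₀ (by ring) ht

theorem contDiffOn_of_hasDerivAt {I : Set ℝ} (hI : IsOpen I) {f f' : ℝ → ℝ}
    (hf : ∀ t ∈ I, HasDerivAt f (f' t) t) (h' : ContDiffOn ℝ ∞ f' I) : ContDiffOn ℝ ∞ f I := by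
  rw [contDiffOn_infty_iff_deriv_of_isOpen hI]
  exact ⟨fun t ht => (hf t ht).differentiableAt.differentiableWithinAt,
    h'.congr fun t ht => (hf t ht).deriv⟩

theorem IsFibredDomain.isOpen_base {F : Type*} [TopologicalSpace F] {S : Set (ℝ × F)}
    (hS : IsFibredDomain S) : IsOpen (Prod.fst '' S) := isOpenMap_fst _ hS.isOpen

/-- A function on a fibred domain with vanishing derivatives along the fibres is a function of `t`. -/
theorem exists_eq_comp_fst {F : Type*} [NormedAddCommGroup F] [NormedSpace ℝ F] {S : Set (ℝ × F)}
    (hS : IsFibredDomain S) {g : ℝ × F → ℝ} (hg : ContDiffOn ℝ ∞ g S)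
    (h0 : ∀ z ∈ S, ∀ y : F, fderiv ℝ g z (0, y) = 0) :
    ∃ γ : ℝ → ℝ, ContDiffOn ℝ ∞ γ (Prod.fst '' S) ∧ (∀ z ∈ S, g z = γ z.1) ∧
      ∀ z ∈ S, HasDerivAt γ (fderiv ℝ g z (1, 0)) z.1 := by
  classical
  have hd : ∀ z ∈ S, DifferentiableAt ℝ g z := fun y hy =>
    (hg.contDiffAt (hS.isOpen.mem_nhds hy)).differentiableAt (by simp)
  have hc : ∀ t y y', (t, y) ∈ S → (t, y') ∈ S → g (t, y) = g (t, y') := by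
    intro t y y' hy hy'
    have ho : IsOpen {y : F | (t, y) ∈ S} := hS.isOpen.preimage (by fun_prop)
    refine ho.is_const_of_fderiv_eq_zero (𝕜 := ℝ) (f := fun y => g (t, y)) (hS.connected_fibre t)
      ?_ ?_ hy hy'
    · intro y hy
      exact ((hd _ hy).comp y (by fun_prop)).differentiableWithinAt
    · intro y hy
      ext w
      have h1 : HasFDerivAt (fun y : F => (t, y)) (ContinuousLinearMap.inr ℝ ℝ F) y :=
        hasFDerivAt_prodMk_right t y
      have h2 := (hd _ hy).hasFDerivAt.comp y h1
      rw [show (fun y => g (t, y)) = g ∘ fun y => (t, y) from rfl, h2.fderiv]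
      simpa using h0 _ hy w
  -- The point of the fibre is picked by choice, with no regularity in t. Smoothness is recovered
  -- locally: near z.1 the function γ agrees with g along the line through z with fixed fibre
  -- coordinate.
  let γ : ℝ → ℝ := fun t => if h : ∃ y, (t, y) ∈ S then g (t, h.choose) else 0
  have hγ : ∀ z ∈ S, g z = γ z.1 := by
    intro z hz
    have h : ∃ y, (z.1, y) ∈ S := ⟨z.2, hz⟩
    simp only [γ, dif_pos h]
    exact hc z.1 z.2 _ hz h.choose_spec
  have hloc : ∀ z ∈ S, γ =ᶠ[𝓝 z.1] fun t => g (t, z.2) := by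
    intro z hz
    have : ContinuousAt (fun t : ℝ => (t, z.2)) z.1 := by fun_prop
    filter_upwards [this.eventually (hS.isOpen.mem_nhds hz)] with t ht
    exact (hγ _ ht).symm
  refine ⟨γ, ?_, hγ, ?_⟩
  · rintro _ ⟨z, hz, rfl⟩
    refine (ContDiffAt.congr_of_eventuallyEq ?_ (hloc z hz)).contDiffWithinAt
    exact (hg.contDiffAt (hS.isOpen.mem_nhds hz)).comp z.1 (by fun_prop)
  · intro z hz
    refine HasDerivAt.congr_of_eventuallyEq ?_ (hloc z hz)
    exact (hd z hz).hasFDerivAt.comp_hasDerivAt (x := z.1) (f := fun τ => (τ, z.2))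
      ((hasDerivAt_id z.1).prodMk (hasDerivAt_const z.1 z.2))

/-! ### Polynomials with a prescribed jet, image graphs, and the chain rule for 2-jets. -/

section Jets

theorem two_le_smooth : (2 : WithTop ℕ∞) ≤ ∞ := by
  exact WithTop.coe_le_coe.2 (le_top : (2 : ℕ∞) ≤ ⊤)

/-- The quadratic polynomial with prescribed `v`, `v_t`, `v_x`, `v_xx`, `v_tt` at `(t₀, x₀)`. -/
noncomputable def jetPoly (z : Space3) (a p r s : ℝ) (q : ℝ × ℝ) : ℝ :=
  z.2.2 + a * (q.1 - z.1) + p * (q.2 - z.2.1) + r / 2 * (q.2 - z.2.1) ^ 2 + s / 2 * (q.1 - z.1) ^ 2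

theorem contDiff_jetPoly (z : Space3) (a p r s : ℝ) {n : WithTop ℕ∞} :
    ContDiff ℝ n (jetPoly z a p r s) := by
  unfold jetPoly; fun_prop

theorem jetPoly_self (z : Space3) (a p r s : ℝ) : jetPoly z a p r s (z.1, z.2.1) = z.2.2 := by
  simp [jetPoly]

theorem dx_jetPoly (z : Space3) (a p r s : ℝ) (q : ℝ × ℝ) :
    dx (jetPoly z a p r s) q = p + r * (q.2 - z.2.1) := by
  refine (dx_eq_deriv ((contDiff_jetPoly z a p r s (n := 1)).differentiable (by simp) q)).unique ?_
  have h : HasDerivAt (fun τ : ℝ => τ - z.2.1) 1 q.2 := (hasDerivAt_id q.2).sub_const _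
  exact (((((h.const_mul p).const_add (z.2.2 + a * (q.1 - z.1)))).add
    ((h.pow 2).const_mul (r / 2))).add_const (s / 2 * (q.1 - z.1) ^ 2)).congr_deriv
      (by simp; ring)

theorem dt_jetPoly (z : Space3) (a p r s : ℝ) : dt (jetPoly z a p r s) (z.1, z.2.1) = a := by
  refine (dt_eq_deriv ((contDiff_jetPoly z a p r s (n := 1)).differentiable (by simp) _)).unique ?_
  have h : HasDerivAt (fun τ : ℝ => τ - z.1) 1 z.1 := (hasDerivAt_id z.1).sub_const _
  exact (((((h.const_mul a).const_add z.2.2).add_const (p * (z.2.1 - z.2.1))).add_const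
    (r / 2 * (z.2.1 - z.2.1) ^ 2)).add ((h.pow 2).const_mul (s / 2))).congr_deriv (by simp)

theorem dx_dx_jetPoly (z : Space3) (a p r s : ℝ) (q : ℝ × ℝ) :
    dx (dx (jetPoly z a p r s)) q = r := by
  have h1 : dx (jetPoly z a p r s) = fun q => p + r * (q.2 - z.2.1) :=
    funext (dx_jetPoly z a p r s)
  rw [h1]
  refine (dx_eq_deriv (f := fun q : ℝ × ℝ => p + r * (q.2 - z.2.1)) (by fun_prop)).unique ?_
  exact ((((hasDerivAt_id q.2).sub_const z.2.1).const_mul r).const_add p).congr_deriv (by simp)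

theorem jetPoly_line (z : Space3) (a p r s e₁ e₂ τ : ℝ) :
    jetPoly z a p r s ((z.1, z.2.1) + τ • (e₁, e₂)) =
      z.2.2 + τ * (a * e₁ + p * e₂) + τ ^ 2 / 2 * (r * e₂ ^ 2 + s * e₁ ^ 2) := by
  simp [jetPoly]; ring

theorem graph_jetPoly_line (z : Space3) (a p r s e₁ e₂ τ : ℝ) :
    ((z.1 + τ * e₁, z.2.1 + τ * e₂, jetPoly z a p r s (z.1 + τ * e₁, z.2.1 + τ * e₂)) : Space3) =
      z + τ • ((e₁, e₂, a * e₁ + p * e₂) : Space3) +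
        (τ ^ 2 / 2) • ((0, 0, r * e₂ ^ 2 + s * e₁ ^ 2) : Space3) := by
  have := jetPoly_line z a p r s e₁ e₂ τ
  ext
  · simp
  · simp
  · simpa using this

/-- Functions whose graphs are connected by a smooth map exist near points of transversality. -/
theorem exists_image_graph {φ : Space3 → Space3} {p : ℝ × ℝ} {v : ℝ × ℝ → ℝ}
    (hφ : ContDiffAt ℝ ∞ φ (p.1, p.2, v p)) (hv : ContDiffAt ℝ 2 v p)
    (hdet : (fderiv ℝ (fun q : ℝ × ℝ => tx (φ (q.1, q.2, v q))) p).det ≠ 0) :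
    ∃ v' : ℝ × ℝ → ℝ, ContDiffAt ℝ 2 v' (tx (φ (p.1, p.2, v p))) ∧
      ∀ᶠ q in 𝓝 p, v' (tx (φ (q.1, q.2, v q))) = (φ (q.1, q.2, v q)).2.2 := by
  set F : ℝ × ℝ → ℝ × ℝ := fun q => tx (φ (q.1, q.2, v q)) with hF
  have hgr : ContDiffAt ℝ 2 (fun q : ℝ × ℝ => φ (q.1, q.2, v q)) p :=
    ContDiffAt.comp p (g := φ) (f := fun q : ℝ × ℝ => (q.1, q.2, v q)) (hφ.of_le two_le_smooth)
      (contDiffAt_fst.prodMk (contDiffAt_snd.prodMk hv))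
  have hFs : ContDiffAt ℝ 2 F p := hgr.fst.prodMk hgr.snd.fst
  let L := (fderiv ℝ F p).toContinuousLinearEquivOfDetNeZero hdet
  have hL : HasFDerivAt F (L : ℝ × ℝ →L[ℝ] ℝ × ℝ) p := by
    simpa [L] using (hFs.differentiableAt (by norm_num)).hasFDerivAt
  let G := hFs.localInverse hL (by norm_num)
  have hG : ContDiffAt ℝ 2 G (F p) := hFs.to_localInverse hL (by norm_num)
  have hGF : ∀ᶠ q in 𝓝 p, G (F q) = q :=
    (hFs.hasStrictFDerivAt' hL (by norm_num)).eventually_left_inverse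
  refine ⟨fun y => (φ ((G y).1, (G y).2, v (G y))).2.2, ?_, ?_⟩
  · have hGp : G (F p) = p := hGF.self_of_nhds
    have h1 : ContDiffAt ℝ 2 (fun q : ℝ × ℝ => (φ (q.1, q.2, v q)).2.2) (G (F p)) := by
      rw [hGp]; exact hgr.snd.snd
    exact h1.comp (F p) hG
  · filter_upwards [hGF] with q hq
    change (φ ((G (F q)).1, (G (F q)).2, v (G (F q)))).2.2 = _
    rw [hq]

/-- The chain rule for jets: for a curve `m` on the graph of `v`, the equality
`v'(T, X) = U` is differentiated twice. -/
theorem jet_chain {v' : ℝ × ℝ → ℝ} {g : ℝ → ℝ × ℝ} {k : ℝ → ℝ}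
    (hv' : ContDiffAt ℝ 2 v' (g 0)) (hg : ContDiffAt ℝ 2 g 0)
    (h : ∀ᶠ τ in 𝓝 (0 : ℝ), v' (g τ) = k τ) :
    deriv k 0 = dt v' (g 0) * (deriv g 0).1 + dx v' (g 0) * (deriv g 0).2 ∧
    deriv (deriv k) 0 =
      dt v' (g 0) * (deriv (deriv g) 0).1 + dx v' (g 0) * (deriv (deriv g) 0).2 +
      (dt (dt v') (g 0) * (deriv g 0).1 ^ 2 + 2 * dt (dx v') (g 0) * (deriv g 0).1 * (deriv g 0).2 +
        dx (dx v') (g 0) * (deriv g 0).2 ^ 2) := by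
  have key : ∀ (L : ℝ × ℝ →L[ℝ] ℝ) (y : ℝ × ℝ), L y = L (1, 0) * y.1 + L (0, 1) * y.2 := by
    intro L y
    conv_lhs => rw [show y = y.1 • ((1, 0) : ℝ × ℝ) + y.2 • ((0, 1) : ℝ × ℝ) by ext <;> simp]
    rw [map_add, map_smul, map_smul, smul_eq_mul, smul_eq_mul]; ring
  have h' : k =ᶠ[𝓝 0] fun τ => v' (g τ) := by
    filter_upwards [h] with τ hτ using hτ.symm
  constructor
  · rw [h'.deriv_eq]
    have := fderiv_comp_deriv (0 : ℝ) (hv'.differentiableAt (by norm_num))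
      (hg.differentiableAt (by norm_num))
    change deriv (v' ∘ g) 0 = _
    rw [this, key]; rfl
  · rw [h'.deriv.deriv_eq, deriv_deriv_comp hv' hg, key _ (deriv (deriv g) 0)]
    set y := deriv g 0
    have hs := hv'.isSymmSndFDerivAt (by simp)
    have e2 : fderiv ℝ (fderiv ℝ v') (g 0) y y =
        fderiv ℝ (fderiv ℝ v') (g 0) (1, 0) (1, 0) * y.1 ^ 2 +
        2 * fderiv ℝ (fderiv ℝ v') (g 0) (1, 0) (0, 1) * y.1 * y.2 +
        fderiv ℝ (fderiv ℝ v') (g 0) (0, 1) (0, 1) * y.2 ^ 2 := by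
      rw [key (fderiv ℝ (fderiv ℝ v') (g 0) y) y, ← hs (1, 0) y, ← hs (0, 1) y,
        key (fderiv ℝ (fderiv ℝ v') (g 0) (1, 0)) y, key (fderiv ℝ (fderiv ℝ v') (g 0) (0, 1)) y,
        hs (0, 1) (1, 0)]
      ring
    rw [e2]
    have f1 : dt (dt v') (g 0) = fderiv ℝ (fderiv ℝ v') (g 0) (1, 0) (1, 0) :=
      fderiv_fderiv_apply hv' _ _
    have f2 : dt (dx v') (g 0) = fderiv ℝ (fderiv ℝ v') (g 0) (1, 0) (0, 1) :=
      fderiv_fderiv_apply hv' _ _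
    have f3 : dx (dx v') (g 0) = fderiv ℝ (fderiv ℝ v') (g 0) (0, 1) (0, 1) :=
      fderiv_fderiv_apply hv' _ _
    rw [f1, f2, f3]
    simp only [dt, dx]
    ring

end Jets

/-! ### How a point transformation relates 2-jets on the source and target equations. -/

/-- The `t`-component of a map of the space with coordinates `(t, x, u)`. -/
def compT (φ : Space3 → Space3) (z : Space3) : ℝ := (φ z).1

/-- The `x`-component of a map of the space with coordinates `(t, x, u)`. -/
def compX (φ : Space3 → Space3) (z : Space3) : ℝ := (φ z).2.1

/-- The `u`-component of a map of the space with coordinates `(t, x, u)`. -/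
def compU (φ : Space3 → Space3) (z : Space3) : ℝ := (φ z).2.2

/-- The relations between the jets `(a, p, r, s)` at `z` and `(a', p', r', q', s')` at `φ z`:
the first and second derivatives in the direction `(e₁, e₂)` of the equality `v'(T, X) = U`. -/
structure JetRelation (φ : Space3 → Space3) (z : Space3) (a p r s a' p' r' q' s' e₁ e₂ : ℝ) :
    Prop where
  first : fderiv ℝ (compU φ) z (e₁, e₂, a * e₁ + p * e₂) =
    a' * fderiv ℝ (compT φ) z (e₁, e₂, a * e₁ + p * e₂) +
    p' * fderiv ℝ (compX φ) z (e₁, e₂, a * e₁ + p * e₂)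
  second : fderiv ℝ (fderiv ℝ (compU φ)) z (e₁, e₂, a * e₁ + p * e₂) (e₁, e₂, a * e₁ + p * e₂) +
      fderiv ℝ (compU φ) z (0, 0, r * e₂ ^ 2 + s * e₁ ^ 2) =
    a' * (fderiv ℝ (fderiv ℝ (compT φ)) z (e₁, e₂, a * e₁ + p * e₂) (e₁, e₂, a * e₁ + p * e₂) +
      fderiv ℝ (compT φ) z (0, 0, r * e₂ ^ 2 + s * e₁ ^ 2)) +
    p' * (fderiv ℝ (fderiv ℝ (compX φ)) z (e₁, e₂, a * e₁ + p * e₂) (e₁, e₂, a * e₁ + p * e₂) +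
      fderiv ℝ (compX φ) z (0, 0, r * e₂ ^ 2 + s * e₁ ^ 2)) +
    (s' * (fderiv ℝ (compT φ) z (e₁, e₂, a * e₁ + p * e₂)) ^ 2 +
      2 * q' * fderiv ℝ (compT φ) z (e₁, e₂, a * e₁ + p * e₂) *
        fderiv ℝ (compX φ) z (e₁, e₂, a * e₁ + p * e₂) +
      r' * (fderiv ℝ (compX φ) z (e₁, e₂, a * e₁ + p * e₂)) ^ 2)

/-- This turns the functional condition `Connects.jets` into algebra at one point. The jet is
realized by a quadratic polynomial v with v_tx = 0; `hJ` says that the image of its graph is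
transversal to the fibres, so the inverse function theorem yields v'. Differentiating v'(T, X) = U
twice along curves in the graph of v gives the relations in every direction (e₁, e₂). The value s of
v_tt stays arbitrary because the equation does not see it. -/
theorem Connects.exists_jetRelation {E E' : Eqn} {φ : OpenPartialHomeomorph Space3 Space3}
    (hφ : ContDiffOn ℝ ∞ φ φ.source) (hc : Connects E φ E') {z : Space3} (hz : z ∈ φ.source)
    {a p r : ℝ} (s : ℝ) (hE : a + z.2.2 * p = E.A2 (tx z) * r + E.A1 (tx z) * p)
    (hJ : fderiv ℝ (compT φ) z (1, 0, a) * fderiv ℝ (compX φ) z (0, 1, p) -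
      fderiv ℝ (compT φ) z (0, 1, p) * fderiv ℝ (compX φ) z (1, 0, a) ≠ 0) :
    ∃ a' p' r' q' s' : ℝ,
      a' + compU φ z * p' = E'.A2 (tx (φ z)) * r' + E'.A1 (tx (φ z)) * p' ∧
      ∀ e₁ e₂, JetRelation φ z a p r s a' p' r' q' s' e₁ e₂ := by
  set v := jetPoly z a p r s with hv
  have hvz : ((z.1, z.2.1, v (z.1, z.2.1)) : Space3) = z := by
    rw [hv, jetPoly_self]
  have hφz : ContDiffAt ℝ ∞ φ z := hφ.contDiffAt (φ.open_source.mem_nhds hz)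
  have hT : ContDiffAt ℝ 2 (compT φ) z := hφz.fst.of_le two_le_smooth
  have hX : ContDiffAt ℝ 2 (compX φ) z := hφz.snd.fst.of_le two_le_smooth
  have hU : ContDiffAt ℝ 2 (compU φ) z := hφz.snd.snd.of_le two_le_smooth
  -- curves on the graph
  let c : ℝ → ℝ → ℝ → Space3 := fun e₁ e₂ τ => z + τ • ((e₁, e₂, a * e₁ + p * e₂) : Space3) +
    (τ ^ 2 / 2) • ((0, 0, r * e₂ ^ 2 + s * e₁ ^ 2) : Space3)
  have hc0 : ∀ e₁ e₂, c e₁ e₂ 0 = z := by intro e₁ e₂; ext <;> simp [c]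
  have hcs : ∀ e₁ e₂, ContDiffAt ℝ 2 (c e₁ e₂) 0 := fun e₁ e₂ =>
    (contDiff_quadratic_curve _ _ _).contDiffAt
  have hc1 : ∀ e₁ e₂, deriv (c e₁ e₂) 0 = (e₁, e₂, a * e₁ + p * e₂) := by
    intro e₁ e₂; simp only [c]; rw [deriv_quadratic_curve]; simp
  have hc2 : ∀ e₁ e₂, deriv (deriv (c e₁ e₂)) 0 = (0, 0, r * e₂ ^ 2 + s * e₁ ^ 2) :=
    fun e₁ e₂ => deriv_deriv_quadratic_curve _ _ _ _
  have hcg : ∀ e₁ e₂ τ, ((z.1 + τ * e₁, z.2.1 + τ * e₂, v (z.1 + τ * e₁, z.2.1 + τ * e₂)) : Space3)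
      = c e₁ e₂ τ := fun e₁ e₂ τ => graph_jetPoly_line z a p r s e₁ e₂ τ
  have d1 : ∀ {f : Space3 → ℝ}, ContDiffAt ℝ 2 f z → ∀ e₁ e₂,
      HasDerivAt (fun τ => f (c e₁ e₂ τ)) (fderiv ℝ f z (e₁, e₂, a * e₁ + p * e₂)) 0 := by
    intro f hf e₁ e₂
    have h1 : HasFDerivAt f (fderiv ℝ f z) (c e₁ e₂ 0) := by
      rw [hc0]; exact (hf.differentiableAt (by norm_num)).hasFDerivAt
    have := h1.comp_hasDerivAt 0 ((hcs e₁ e₂).differentiableAt (by norm_num)).hasDerivAt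
    rwa [hc1] at this
  have d2 : ∀ {f : Space3 → ℝ}, ContDiffAt ℝ 2 f z → ∀ e₁ e₂,
      deriv (deriv fun τ => f (c e₁ e₂ τ)) 0 =
        fderiv ℝ (fderiv ℝ f) z (e₁, e₂, a * e₁ + p * e₂) (e₁, e₂, a * e₁ + p * e₂) +
        fderiv ℝ f z (0, 0, r * e₂ ^ 2 + s * e₁ ^ 2) := by
    intro f hf e₁ e₂
    rw [deriv_deriv_comp (by rwa [hc0]) (hcs e₁ e₂), hc0, hc1, hc2]
  -- the base map
  have hφz' : ContDiffAt ℝ ∞ φ (z.1, z.2.1, v (z.1, z.2.1)) := by rwa [hvz]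
  have hvs : ContDiffAt ℝ 2 v (z.1, z.2.1) := (contDiff_jetPoly z a p r s).contDiffAt
  have hgr : DifferentiableAt ℝ (fun q : ℝ × ℝ => φ (q.1, q.2, v q)) (z.1, z.2.1) :=
    DifferentiableAt.comp (g := φ) (f := fun q : ℝ × ℝ => (q.1, q.2, v q)) (z.1, z.2.1)
      (hφz'.differentiableAt (by simp))
      (differentiableAt_fst.prodMk (differentiableAt_snd.prodMk (hvs.differentiableAt (by norm_num))))
  have hF : DifferentiableAt ℝ (fun q : ℝ × ℝ => tx (φ (q.1, q.2, v q))) (z.1, z.2.1) :=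
    hgr.fst.prodMk hgr.snd.fst
  have hFd : ∀ e₁ e₂, fderiv ℝ (fun q : ℝ × ℝ => tx (φ (q.1, q.2, v q))) (z.1, z.2.1) (e₁, e₂) =
      (fderiv ℝ (compT φ) z (e₁, e₂, a * e₁ + p * e₂),
        fderiv ℝ (compX φ) z (e₁, e₂, a * e₁ + p * e₂)) := by
    intro e₁ e₂
    have hl : HasDerivAt (fun τ : ℝ => ((z.1 + τ * e₁, z.2.1 + τ * e₂) : ℝ × ℝ)) (e₁, e₂) 0 :=
      (((hasDerivAt_id (0 : ℝ)).mul_const e₁).const_add z.1 |>.prodMk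
        (((hasDerivAt_id (0 : ℝ)).mul_const e₂).const_add z.2.1)).congr_deriv (by simp)
    have hF0 : HasFDerivAt (fun q : ℝ × ℝ => tx (φ (q.1, q.2, v q))) (fderiv ℝ
        (fun q : ℝ × ℝ => tx (φ (q.1, q.2, v q))) (z.1, z.2.1)) (z.1 + 0 * e₁, z.2.1 + 0 * e₂) := by
      simpa using hF.hasFDerivAt
    refine (hF0.comp_hasDerivAt 0 hl).unique ?_
    refine ((d1 hT e₁ e₂).prodMk (d1 hX e₁ e₂)).congr_of_eventuallyEq (Eventually.of_forall ?_)
    intro τ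
    simp only [Function.comp, ← hcg]
    rfl
  have hdet : (fderiv ℝ (fun q : ℝ × ℝ => tx (φ (q.1, q.2, v q))) (z.1, z.2.1)).det ≠ 0 := by
    rw [ContinuousLinearMap.det_prod, hFd, hFd]
    simpa using hJ
  obtain ⟨v', hv's, hv'⟩ := exists_image_graph hφz' hvs hdet
  have hholds : E.HoldsAt v (z.1, z.2.1) := by
    simp only [Eqn.HoldsAt, hv, dt_jetPoly, dx_jetPoly, dx_dx_jetPoly, jetPoly_self]
    simpa [tx] using hE
  have hj := (hc.jets (z.1, z.2.1) v v' (by rwa [hvz]) hvs hv's hv' hdet).1 hholds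
  have hvv : v' (tx (φ z)) = compU φ z := by
    have := hv'.self_of_nhds
    rw [hvz] at this; exact this
  rw [hvz] at hj hv's
  refine ⟨dt v' (tx (φ z)), dx v' (tx (φ z)), dx (dx v') (tx (φ z)), dt (dx v') (tx (φ z)),
    dt (dt v') (tx (φ z)), ?_, fun e₁ e₂ => ?_⟩
  · rw [← hvv]; exact hj
  · let g : ℝ → ℝ × ℝ := fun τ => (compT φ (c e₁ e₂ τ), compX φ (c e₁ e₂ τ))
    have hg0 : g 0 = tx (φ z) := by simp only [g, hc0]; rfl
    have hgT : ContDiffAt ℝ 2 (fun τ => compT φ (c e₁ e₂ τ)) 0 :=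
      ContDiffAt.comp 0 (g := compT φ) (by rwa [hc0]) (hcs e₁ e₂)
    have hgX : ContDiffAt ℝ 2 (fun τ => compX φ (c e₁ e₂ τ)) 0 :=
      ContDiffAt.comp 0 (g := compX φ) (by rwa [hc0]) (hcs e₁ e₂)
    have hev : ∀ᶠ τ in 𝓝 (0 : ℝ), v' (g τ) = compU φ (c e₁ e₂ τ) := by
      have hcont : ContinuousAt (fun τ : ℝ => ((z.1 + τ * e₁, z.2.1 + τ * e₂) : ℝ × ℝ)) 0 := by
        fun_prop
      have := hcont.eventually (by simpa using hv')
      filter_upwards [this] with τ hτ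
      simp only [hcg] at hτ
      exact hτ
    obtain ⟨k1, k2⟩ := jet_chain (g := g) (by rwa [hg0]) (hgT.prodMk hgX) hev
    have gd : deriv g =ᶠ[𝓝 0] fun τ => (deriv (fun τ => compT φ (c e₁ e₂ τ)) τ,
        deriv (fun τ => compX φ (c e₁ e₂ τ)) τ) := by
      filter_upwards [hgT.eventually (by simp), hgX.eventually (by simp)] with τ h1 h2
      exact ((h1.differentiableAt (by norm_num)).hasDerivAt.prodMk
        (h2.differentiableAt (by norm_num)).hasDerivAt).deriv
    have dd : ∀ {f : ℝ → ℝ}, ContDiffAt ℝ 2 f 0 → DifferentiableAt ℝ (deriv f) 0 := by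
      intro f hf
      exact ((hf.fderiv_right (m := 1) (by norm_num)).differentiableAt
        (by norm_num)).clm_apply (differentiableAt_const _)
    have gdd : deriv (deriv g) 0 = (deriv (deriv fun τ => compT φ (c e₁ e₂ τ)) 0,
        deriv (deriv fun τ => compX φ (c e₁ e₂ τ)) 0) := by
      rw [gd.deriv_eq]
      exact ((dd hgT).hasDerivAt.prodMk (dd hgX).hasDerivAt).deriv
    have gd0 := ((d1 hT e₁ e₂).prodMk (d1 hX e₁ e₂)).deriv
    change deriv g 0 = _ at gd0
    rw [gd0, (d1 hU e₁ e₂).deriv, hg0] at k1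
    rw [gdd, gd0, d2 hU, d2 hT, d2 hX, hg0] at k2
    exact ⟨k1, k2⟩

/-! ### Partial derivatives on the (t, x, u)-space. -/

section Partials

/-- The derivative of a function of `(t, x, u)` in the direction `e`. -/
noncomputable def pd (e : Space3) (g : Space3 → ℝ) (z : Space3) : ℝ := fderiv ℝ g z e

/-- The partial derivative with respect to `t`. -/
noncomputable abbrev pt : (Space3 → ℝ) → Space3 → ℝ := pd (1, 0, 0)

/-- The partial derivative with respect to `x`. -/
noncomputable abbrev px : (Space3 → ℝ) → Space3 → ℝ := pd (0, 1, 0)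

/-- The partial derivative with respect to `u`. -/
noncomputable abbrev pu : (Space3 → ℝ) → Space3 → ℝ := pd (0, 0, 1)

theorem clm_space3_apply (L : Space3 →L[ℝ] ℝ) (y : Space3) :
    L y = y.1 * L (1, 0, 0) + y.2.1 * L (0, 1, 0) + y.2.2 * L (0, 0, 1) := by
  conv_lhs => rw [show y = y.1 • ((1, 0, 0) : Space3) + y.2.1 • ((0, 1, 0) : Space3) +
    y.2.2 • ((0, 0, 1) : Space3) by ext <;> simp]
  simp only [map_add, map_smul, smul_eq_mul]

theorem fderiv_eq_pd (g : Space3 → ℝ) (z : Space3) (a b c : ℝ) :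
    fderiv ℝ g z (a, b, c) = a * pt g z + b * px g z + c * pu g z :=
  clm_space3_apply _ _

theorem contDiffOn_pd {S : Set Space3} (hS : IsOpen S) {g : Space3 → ℝ}
    (hg : ContDiffOn ℝ ∞ g S) (e : Space3) : ContDiffOn ℝ ∞ (pd e g) S :=
  contDiffOn_fderiv_apply hS hg e

theorem pd_comm {S : Set Space3} (hS : IsOpen S) {g : Space3 → ℝ} (hg : ContDiffOn ℝ ∞ g S)
    {z : Space3} (hz : z ∈ S) (e f : Space3) : pd e (pd f g) z = pd f (pd e g) z :=
  fderiv_fderiv_comm ((hg.contDiffAt (hS.mem_nhds hz)).of_le two_le_smooth) e f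

theorem pd_congr {S : Set Space3} (hS : IsOpen S) {f g : Space3 → ℝ} (h : ∀ z ∈ S, f z = g z)
    {z : Space3} (hz : z ∈ S) (e : Space3) : pd e f z = pd e g z := by
  rw [pd, fderiv_apply_congr hS h hz, pd]

theorem pd_zero {S : Set Space3} (hS : IsOpen S) {f : Space3 → ℝ} (h : ∀ z ∈ S, f z = 0)
    {z : Space3} (hz : z ∈ S) (e : Space3) : pd e f z = 0 :=
  fderiv_apply_eq_zero_of_eqOn hS h hz e

theorem pd_pd_zero {S : Set Space3} (hS : IsOpen S) {g : Space3 → ℝ} (hg : ContDiffOn ℝ ∞ g S)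
    {f : Space3} (h : ∀ z ∈ S, pd f g z = 0) {z : Space3} (hz : z ∈ S) (e : Space3) :
    pd f (pd e g) z = 0 := by
  rw [pd_comm hS hg hz, pd_zero hS h hz]

theorem fderiv_fderiv_eq_pd {S : Set Space3} (hS : IsOpen S) {g : Space3 → ℝ}
    (hg : ContDiffOn ℝ ∞ g S) {z : Space3} (hz : z ∈ S) (p : ℝ) :
    fderiv ℝ (fderiv ℝ g) z (0, 1, p) (0, 1, p) =
      px (px g) z + 2 * p * pu (px g) z + p ^ 2 * pu (pu g) z := by
  have hg2 := (hg.contDiffAt (hS.mem_nhds hz)).of_le two_le_smooth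
  rw [← fderiv_fderiv_apply hg2]
  have h1 : (fun y => fderiv ℝ g y (0, 1, p)) = fun y => px g y + p * pu g y := by
    funext y; rw [fderiv_eq_pd]; ring
  have hd : ∀ e, DifferentiableAt ℝ (pd e g) z := fun e =>
    ((contDiffOn_pd hS hg e).contDiffAt (hS.mem_nhds hz)).differentiableAt (by simp)
  have h2 := (hd (0, 1, 0)).hasFDerivAt.add ((hd (0, 0, 1)).hasFDerivAt.const_mul p)
  rw [h1]
  erw [h2.fderiv]
  rw [add_apply, smul_apply, fderiv_eq_pd, fderiv_eq_pd,
    smul_eq_mul]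
  have h3 : px (pu g) z = pu (px g) z := pd_comm hS hg hz _ _
  rw [h3]; ring

end Partials

/-! ### Admissible transformations preserve the fibration over the t-axis. -/

section Classification

variable {E E' : Eqn} {φ : OpenPartialHomeomorph Space3 Space3}

theorem IsPointTransformation.comp_contDiffOn (hφ : IsPointTransformation φ) :
    ContDiffOn ℝ ∞ (compT φ) φ.source ∧ ContDiffOn ℝ ∞ (compX φ) φ.source ∧
      ContDiffOn ℝ ∞ (compU φ) φ.source :=
  ⟨hφ.1.fst, hφ.1.snd.fst, hφ.1.snd.snd⟩

theorem IsPointTransformation.fderiv_bijective (hφ : IsPointTransformation φ) {z : Space3}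
    (hz : z ∈ φ.source) : Function.Bijective (fderiv ℝ φ z) := by
  have h1 : DifferentiableAt ℝ φ z :=
    (hφ.1.contDiffAt (φ.open_source.mem_nhds hz)).differentiableAt (by simp)
  have h2 : DifferentiableAt ℝ φ.symm (φ z) :=
    (hφ.2.contDiffAt (φ.open_target.mem_nhds (φ.map_source hz))).differentiableAt (by simp)
  have e1 : (fderiv ℝ φ.symm (φ z)).comp (fderiv ℝ φ z) = ContinuousLinearMap.id ℝ Space3 := by
    rw [← fderiv_comp z h2 h1, ← fderiv_id (𝕜 := ℝ) (x := z)]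
    exact Filter.EventuallyEq.fderiv_eq (φ.eventually_left_inverse hz)
  have e2 : (fderiv ℝ φ z).comp (fderiv ℝ φ.symm (φ z)) = ContinuousLinearMap.id ℝ Space3 := by
    have h1' : DifferentiableAt ℝ φ (φ.symm (φ z)) := by rwa [φ.left_inv hz]
    have := fderiv_comp (φ z) h1' h2
    rw [φ.left_inv hz] at this
    rw [← this, ← fderiv_id (𝕜 := ℝ) (x := φ z)]
    exact Filter.EventuallyEq.fderiv_eq (φ.eventually_right_inverse (φ.map_source hz))
  exact Function.bijective_iff_has_inverse.2 ⟨fderiv ℝ φ.symm (φ z),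
    fun y => by simpa using congrArg (fun L => L y) e1,
    fun y => by simpa using congrArg (fun L => L y) e2⟩

theorem fderiv_components (hφ : IsPointTransformation φ) {z : Space3} (hz : z ∈ φ.source)
    (y : Space3) : fderiv ℝ φ z y =
      (fderiv ℝ (compT φ) z y, fderiv ℝ (compX φ) z y, fderiv ℝ (compU φ) z y) := by
  have hd : ∀ {g : Space3 → ℝ}, ContDiffOn ℝ ∞ g φ.source → HasFDerivAt g (fderiv ℝ g z) z :=
    fun hg => ((hg.contDiffAt (φ.open_source.mem_nhds hz)).differentiableAt (by simp)).hasFDerivAt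
  obtain ⟨hT, hX, hU⟩ := hφ.comp_contDiffOn
  have h := (hd hT).prodMk ((hd hX).prodMk (hd hU))
  have : (fun z => (compT φ z, compX φ z, compU φ z)) = φ := rfl
  rw [this] at h
  rw [h.fderiv]; rfl

theorem eq_zero_of_components (hφ : IsPointTransformation φ) {z : Space3} (hz : z ∈ φ.source)
    {y : Space3} (hT : fderiv ℝ (compT φ) z y = 0) (hX : fderiv ℝ (compX φ) z y = 0)
    (hU : fderiv ℝ (compU φ) z y = 0) : y = 0 := by
  apply (hφ.fderiv_bijective hz).1
  rw [fderiv_components hφ hz, hT, hX, hU, map_zero]; rfl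

theorem exists_components (hφ : IsPointTransformation φ) {z : Space3} (hz : z ∈ φ.source)
    (a b c : ℝ) : ∃ y, fderiv ℝ (compT φ) z y = a ∧ fderiv ℝ (compX φ) z y = b ∧
      fderiv ℝ (compU φ) z y = c := by
  obtain ⟨y, hy⟩ := (hφ.fderiv_bijective hz).2 (a, b, c)
  rw [fderiv_components hφ hz, Prod.mk.injEq, Prod.mk.injEq] at hy
  exact ⟨y, hy⟩

theorem Connects.A2_ne_zero (hc : Connects E φ E') (hE : E ∈ hatL0) {z : Space3}
    (hz : z ∈ φ.source) : E.A2 (tx z) ≠ 0 :=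
  hE.1.A2_ne_zero _ (hc.source_over ▸ mem_image_of_mem _ hz)

theorem Connects.A2_ne_zero' (hc : Connects E φ E') (hE' : E' ∈ hatL0) {z : Space3}
    (hz : z ∈ φ.source) : E'.A2 (tx (φ z)) ≠ 0 :=
  hE'.1.A2_ne_zero _ (hc.target_over ▸ mem_image_of_mem _ (φ.map_source hz))

/-- The jets with v_tt = 0 and v_tt = 1 lie on the source equation together. Their images share the
first derivatives, hence also the second x-derivative, because the target equation can be solved for
it. In the direction that annihilates the total differential of T no other second derivative of v'
enters, so the change in v_tt must be invisible there; its coefficient contains (D_x T)², where D_x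
is the total x-derivative. -/
theorem Connects.total_x_compT_eq_zero (hφ : IsPointTransformation φ) (hc : Connects E φ E')
    (hE : E ∈ hatL0) (hE' : E' ∈ hatL0) {z : Space3} (hz : z ∈ φ.source) {a p : ℝ}
    (hJ : fderiv ℝ (compT φ) z (1, 0, a) * fderiv ℝ (compX φ) z (0, 1, p) -
      fderiv ℝ (compT φ) z (0, 1, p) * fderiv ℝ (compX φ) z (1, 0, a) ≠ 0) :
    fderiv ℝ (compT φ) z (0, 1, p) = 0 := by
  have hA := hc.A2_ne_zero hE hz
  have hA' := hc.A2_ne_zero' hE' hz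
  set r := (a + z.2.2 * p - E.A1 (tx z) * p) / E.A2 (tx z) with hr
  have hjet : a + z.2.2 * p = E.A2 (tx z) * r + E.A1 (tx z) * p := by
    rw [hr]; field_simp; ring
  obtain ⟨a₀, p₀, r₀, q₀, s₀, h₀, H₀⟩ := hc.exists_jetRelation hφ.1 hz 0 hjet hJ
  obtain ⟨a₁, p₁, r₁, q₁, s₁, h₁, H₁⟩ := hc.exists_jetRelation hφ.1 hz 1 hjet hJ
  have lin : ∀ (L : Space3 →L[ℝ] ℝ) (e₁ e₂ : ℝ),
      L (e₁, e₂, a * e₁ + p * e₂) = e₁ * L (1, 0, a) + e₂ * L (0, 1, p) := by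
    intro L e₁ e₂
    rw [clm_space3_apply, clm_space3_apply L (1, 0, a), clm_space3_apply L (0, 1, p)]
    simp only; ring
  have lin0 : ∀ (L : Space3 →L[ℝ] ℝ) (c : ℝ), L (0, 0, c) = c * L (0, 0, 1) := by
    intro L c
    rw [clm_space3_apply]; simp
  have i0 := (H₀ 1 0).first
  have i1 := (H₁ 1 0).first
  have j0 := (H₀ 0 1).first
  have j1 := (H₁ 0 1).first
  -- The direction (D_x T, -D_t T) is chosen so that T is stationary along it to first order; this
  -- removes s' and q' from the second-order relation.
  have k0 := (H₀ (fderiv ℝ (compT φ) z (0, 1, p)) (-fderiv ℝ (compT φ) z (1, 0, a))).second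
  have k1 := (H₁ (fderiv ℝ (compT φ) z (0, 1, p)) (-fderiv ℝ (compT φ) z (1, 0, a))).second
  have hz1 := lin (fderiv ℝ (compT φ) z) (fderiv ℝ (compT φ) z (0, 1, p))
    (-fderiv ℝ (compT φ) z (1, 0, a))
  have hz2 : fderiv ℝ (compT φ) z (fderiv ℝ (compT φ) z (0, 1, p),
      -fderiv ℝ (compT φ) z (1, 0, a), a * fderiv ℝ (compT φ) z (0, 1, p) +
        p * -fderiv ℝ (compT φ) z (1, 0, a)) = 0 := by
    rw [hz1]; ring
  rw [hz2] at k0 k1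
  rw [lin0, lin0 (fderiv ℝ (compT φ) z), lin0 (fderiv ℝ (compX φ) z)] at k0 k1
  rw [lin, lin, lin] at i0 i1 j0 j1
  have hinj := fun e₁ e₂ : ℝ => eq_zero_of_components hφ hz
    (y := (0, 0, 1) - (e₁, e₂, a * e₁ + p * e₂))
  simp only [map_sub, lin] at hinj
  set Tt := fderiv ℝ (compT φ) z (1, 0, a)
  set Tx := fderiv ℝ (compT φ) z (0, 1, p)
  set Xt := fderiv ℝ (compX φ) z (1, 0, a)
  set Xx := fderiv ℝ (compX φ) z (0, 1, p)
  set Ut := fderiv ℝ (compU φ) z (1, 0, a)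
  set Ux := fderiv ℝ (compU φ) z (0, 1, p)
  set Tu := fderiv ℝ (compT φ) z (0, 0, 1)
  set Xu := fderiv ℝ (compX φ) z (0, 0, 1)
  set Uu := fderiv ℝ (compU φ) z (0, 0, 1)
  -- Cramer's rule with the nonzero determinant of `hJ`: the first-order relations do not involve
  -- v_tt.
  have ea : a₀ = a₁ := mul_right_cancel₀ hJ (by linear_combination (i1 - i0) * Xx - (j1 - j0) * Xt)
  have ep : p₀ = p₁ := mul_right_cancel₀ hJ (by linear_combination (j1 - j0) * Tt - (i1 - i0) * Tx)
  subst ea ep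
  have er : r₀ = r₁ := mul_left_cancel₀ hA' (by linear_combination h₁ - h₀)
  subst er
  have hκ : Tx ^ 2 * (Uu - a₀ * Tu - p₀ * Xu) = 0 := by linear_combination k1 - k0
  rcases mul_eq_zero.1 hκ with h | h
  · exact pow_eq_zero_iff (two_ne_zero) |>.1 h
  -- If the other factor vanished, ∂_u minus a suitable vector tangent to the graph would be killed
  -- by the differential of φ, contradicting its injectivity.
  · exfalso
    set J := Tt * Xx - Tx * Xt
    have hy := hinj ((Tu * Xx - Tx * Xu) / J) ((Tt * Xu - Tu * Xt) / J)
      (by field_simp; simp only [J]; ring) (by field_simp; simp only [J]; ring)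
      (by
        have : Uu = a₀ * Tu + p₀ * Xu := by linear_combination h
        rw [this]; field_simp
        simp only [J]
        linear_combination (-(Tu * Xx - Tx * Xu)) * i0 - (Tt * Xu - Tu * Xt) * j0)
    have y1 := congrArg Prod.fst hy
    have y2 := congrArg (fun y : Space3 => y.2.1) hy
    have y3 := congrArg (fun y : Space3 => y.2.2) hy
    simp only [Prod.fst_sub, Prod.snd_sub, Prod.fst_zero, Prod.snd_zero, zero_sub, neg_eq_zero]
      at y1 y2 y3
    rw [y1, y2] at y3
    norm_num at y3

/-- The terms with a·p cancel, so the determinant is affine in (a, p), with the three 2×2 minors of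
(dT, dX) as coefficients. If Tx + p Tu is not identically zero it is nonzero at two values of p.
There the determinant vanishes for every a, which forces all three minors to be zero. -/
theorem eq_zero_of_affine_jacobian {Tt Tx Tu Xt Xx Xu : ℝ}
    (h : ∀ a p : ℝ, (Tt + a * Tu) * (Xx + p * Xu) - (Tx + p * Tu) * (Xt + a * Xu) ≠ 0 →
      Tx + p * Tu = 0)
    (hm : ¬ (Tt * Xx - Tx * Xt = 0 ∧ Tu * Xx - Tx * Xu = 0 ∧ Tt * Xu - Tu * Xt = 0)) :
    Tx = 0 ∧ Tu = 0 := by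
  by_contra hne
  apply hm
  have h' : ∀ p, Tx + p * Tu ≠ 0 → ∀ a, (Tt + a * Tu) * (Xx + p * Xu) -
      (Tx + p * Tu) * (Xt + a * Xu) = 0 := fun p hp a => by
    by_contra hJ; exact hp (h a p hJ)
  obtain ⟨p₁, p₂, hp, h1, h2⟩ : ∃ p₁ p₂, p₁ - p₂ ≠ 0 ∧ Tx + p₁ * Tu ≠ 0 ∧ Tx + p₂ * Tu ≠ 0 := by
    by_cases hu : Tu = 0
    · refine ⟨0, 1, by norm_num, ?_, ?_⟩ <;> simpa [hu] using hne
    · refine ⟨-Tx / Tu + 1, -Tx / Tu + 2, by ring_nf; norm_num, ?_, ?_⟩ <;> field_simp <;> ring_nf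
      · simpa using hu
      · simpa using hu
  have a1 := h' p₁ h1 0
  have a2 := h' p₂ h2 0
  have b1 := h' p₁ h1 1
  have m3 : Tt * Xu - Tu * Xt = 0 := mul_left_cancel₀ hp (by linear_combination a1 - a2)
  have m1 : Tt * Xx - Tx * Xt = 0 := by linear_combination a1 - p₁ * m3
  exact ⟨m1, by linear_combination b1 - a1, m3⟩

/-- The alternative, that all 2×2 minors of (dT, dX) vanish, is impossible: the differential of φ is
onto, so dT and dX are linearly independent. -/
theorem Connects.compT_fibre (hφ : IsPointTransformation φ) (hc : Connects E φ E')
    (hE : E ∈ hatL0) (hE' : E' ∈ hatL0) {z : Space3} (hz : z ∈ φ.source) :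
    px (compT φ) z = 0 ∧ pu (compT φ) z = 0 := by
  refine eq_zero_of_affine_jacobian (Tt := pt (compT φ) z) (Xt := pt (compX φ) z)
    (Xx := px (compX φ) z) (Xu := pu (compX φ) z) (fun a p h => ?_) ?_
  · have := hc.total_x_compT_eq_zero hφ hE hE' hz (a := a) (p := p) (by
      simp only [fderiv_eq_pd]; convert h using 1; ring)
    rw [fderiv_eq_pd] at this
    linear_combination this
  · rintro ⟨m1, m2, m3⟩
    obtain ⟨y, hy1, hy2, -⟩ := exists_components hφ hz 1 0 0
    obtain ⟨w, hw1, hw2, -⟩ := exists_components hφ hz 0 1 0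
    obtain ⟨y1, y2, y3⟩ := y
    obtain ⟨w1, w2, w3⟩ := w
    rw [fderiv_eq_pd] at hy1 hy2 hw1 hw2
    have : (1 : ℝ) = 0 := by
      set Tt := pt (compT φ) z
      set Tx := px (compT φ) z
      set Tu := pu (compT φ) z
      set Xt := pt (compX φ) z
      set Xx := px (compX φ) z
      set Xu := pu (compX φ) z
      have e1 : (y1 * Tt + y2 * Tx + y3 * Tu) * (w1 * Xt + w2 * Xx + w3 * Xu) -
        (w1 * Tt + w2 * Tx + w3 * Tu) * (y1 * Xt + y2 * Xx + y3 * Xu) = 0 := by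
        linear_combination (y1 * w2 - y2 * w1) * m1 + (y3 * w2 - y2 * w3) * m2 +
          (y1 * w3 - y3 * w1) * m3
      rw [hy1, hy2, hw1, hw2] at e1
      linarith
    norm_num at this

theorem Connects.pt_compT_ne_zero (hφ : IsPointTransformation φ) (hc : Connects E φ E')
    (hE : E ∈ hatL0) (hE' : E' ∈ hatL0) {z : Space3} (hz : z ∈ φ.source) :
    pt (compT φ) z ≠ 0 := by
  obtain ⟨⟨y1, y2, y3⟩, hy, -⟩ := exists_components hφ hz 1 0 0
  obtain ⟨h1, h2⟩ := hc.compT_fibre hφ hE hE' hz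
  rw [fderiv_eq_pd, h1, h2] at hy
  intro h
  rw [h] at hy
  norm_num at hy

/-- Since dT involves dt alone, preimages of ∂_x and ∂_u under the differential have no t-component,
so the (x, u)-block is itself onto. -/
theorem Connects.minor_ne_zero (hφ : IsPointTransformation φ) (hc : Connects E φ E')
    (hE : E ∈ hatL0) (hE' : E' ∈ hatL0) {z : Space3} (hz : z ∈ φ.source) :
    pu (compU φ) z * px (compX φ) z - px (compU φ) z * pu (compX φ) z ≠ 0 := by
  obtain ⟨⟨y1, y2, y3⟩, hy, hy', hy''⟩ := exists_components hφ hz 0 1 0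
  obtain ⟨⟨w1, w2, w3⟩, hw, hw', hw''⟩ := exists_components hφ hz 0 0 1
  obtain ⟨h1, h2⟩ := hc.compT_fibre hφ hE hE' hz
  have h3 := hc.pt_compT_ne_zero hφ hE hE' hz
  rw [fderiv_eq_pd] at hy hy' hy'' hw hw' hw''
  rw [h1, h2] at hy hw
  simp only [mul_zero, add_zero, mul_eq_zero, h3, or_false] at hy hw
  subst hy hw
  intro h
  have : (1 : ℝ) = 0 := by
    linear_combination (y2 * w3 - y3 * w2) * h -
      (w2 * px (compU φ) z + w3 * pu (compU φ) z) * hy' - hw'' +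
      (y2 * px (compU φ) z + y3 * pu (compU φ) z) * hw'
  norm_num at this

end Classification

/-! ### Splitting with respect to v_xx, v_x and u; the determining equations. -/

section Classification

variable {E E' : Eqn} {φ : OpenPartialHomeomorph Space3 Space3}

/-- The relations between jets for transformations with `T = T(t)`. -/
theorem Connects.reduced_relation (hφ : IsPointTransformation φ) (hc : Connects E φ E')
    (hE : E ∈ hatL0) (hE' : E' ∈ hatL0) {z : Space3} (hz : z ∈ φ.source) {a p r : ℝ}
    (ha : a + z.2.2 * p = E.A2 (tx z) * r + E.A1 (tx z) * p)
    (hX : px (compX φ) z + p * pu (compX φ) z ≠ 0) :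
    ∃ a' p' r' : ℝ,
      a' + compU φ z * p' = E'.A2 (tx (φ z)) * r' + E'.A1 (tx (φ z)) * p' ∧
      pt (compU φ) z + a * pu (compU φ) z =
        a' * pt (compT φ) z + p' * (pt (compX φ) z + a * pu (compX φ) z) ∧
      px (compU φ) z + p * pu (compU φ) z = p' * (px (compX φ) z + p * pu (compX φ) z) ∧
      px (px (compU φ)) z + 2 * p * pu (px (compU φ)) z + p ^ 2 * pu (pu (compU φ)) z +
        r * pu (compU φ) z =
      p' * (px (px (compX φ)) z + 2 * p * pu (px (compX φ)) z + p ^ 2 * pu (pu (compX φ)) z +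
        r * pu (compX φ) z) + r' * (px (compX φ) z + p * pu (compX φ) z) ^ 2 := by
  have hS := φ.open_source
  have hTx : ∀ z ∈ φ.source, px (compT φ) z = 0 := fun z hz => (hc.compT_fibre hφ hE hE' hz).1
  have hTu : ∀ z ∈ φ.source, pu (compT φ) z = 0 := fun z hz => (hc.compT_fibre hφ hE hE' hz).2
  have hTt := hc.pt_compT_ne_zero hφ hE hE' hz
  have s1 : px (px (compT φ)) z = 0 := pd_zero hS hTx hz _
  have s2 : pu (px (compT φ)) z = 0 := pd_zero hS hTx hz _
  have s3 : pu (pu (compT φ)) z = 0 := pd_zero hS hTu hz _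
  obtain ⟨a', p', r', q', s', h, H⟩ := hc.exists_jetRelation hφ.1 hz 0 ha (by
    simp only [fderiv_eq_pd, hTx z hz, hTu z hz]
    convert mul_ne_zero hTt hX using 1; ring)
  obtain ⟨hT, hXs, hU⟩ := hφ.comp_contDiffOn
  have f1 := (H 1 0).first
  have f2 := (H 0 1).first
  have g := (H 0 1).second
  simp only [mul_zero, mul_one, zero_add, add_zero, one_pow, ne_eq, OfNat.ofNat_ne_zero,
    not_false_eq_true, zero_pow] at f1 f2 g
  rw [fderiv_fderiv_eq_pd hS hT hz, fderiv_fderiv_eq_pd hS hXs hz, fderiv_fderiv_eq_pd hS hU hz]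
    at g
  simp only [fderiv_eq_pd, hTx z hz, hTu z hz, s1, s2, s3] at f1 f2 g
  refine ⟨a', p', r', h, by linear_combination f1, by linear_combination f2,
    by linear_combination g⟩

/-- Changing v_xx from 0 to 1 at fixed v_x = p, with v_t adjusted to the equation, leaves p' fixed
and yields A² (X_x + p X_u)² = T_t Ã². The right-hand side does not depend on p, so neither may the
left. -/
theorem Connects.pu_compX (hφ : IsPointTransformation φ) (hc : Connects E φ E')
    (hE : E ∈ hatL0) (hE' : E' ∈ hatL0) {z : Space3} (hz : z ∈ φ.source) :
    pu (compX φ) z = 0 := by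
  have hA := hc.A2_ne_zero hE hz
  have hm := hc.minor_ne_zero hφ hE hE' hz
  have key : ∀ p, px (compX φ) z + p * pu (compX φ) z ≠ 0 →
      E.A2 (tx z) * (px (compX φ) z + p * pu (compX φ) z) ^ 2 =
        pt (compT φ) z * E'.A2 (tx (φ z)) := by
    intro p hp
    obtain ⟨a₀, p₀, r₀, h₀, b₀, c₀, d₀⟩ := hc.reduced_relation hφ hE hE' hz
      (a := E.A1 (tx z) * p - z.2.2 * p) (r := 0) (by ring) hp
    obtain ⟨a₁, p₁, r₁, h₁, b₁, c₁, d₁⟩ := hc.reduced_relation hφ hE hE' hz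
      (a := E.A2 (tx z) * 1 + E.A1 (tx z) * p - z.2.2 * p) (r := 1) (by ring) hp
    have ep : p₀ = p₁ := mul_right_cancel₀ hp (by linear_combination c₁ - c₀)
    subst ep
    have hκ : pu (compU φ) z - p₀ * pu (compX φ) z ≠ 0 := by
      intro h
      apply hm
      linear_combination (px (compX φ) z + p * pu (compX φ) z) * h - pu (compX φ) z * c₀
    apply mul_left_cancel₀ hκ
    linear_combination (px (compX φ) z + p * pu (compX φ) z) ^ 2 * (b₁ - b₀) +
      (px (compX φ) z + p * pu (compX φ) z) ^ 2 * pt (compT φ) z * (h₁ - h₀) -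
      pt (compT φ) z * E'.A2 (tx (φ z)) * (d₁ - d₀)
  by_contra hXu
  -- These values of p make X_x + p X_u equal to 1 and 2, whence A² = 4 A².
  have k1 := key ((1 - px (compX φ) z) / pu (compX φ) z) (by field_simp; ring_nf; norm_num)
  have k2 := key ((2 - px (compX φ) z) / pu (compX φ) z) (by field_simp; ring_nf; norm_num)
  apply hA
  have e1 : px (compX φ) z + (1 - px (compX φ) z) / pu (compX φ) z * pu (compX φ) z = 1 := by
    field_simp; ring
  have e2 : px (compX φ) z + (2 - px (compX φ) z) / pu (compX φ) z * pu (compX φ) z = 2 := by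
    field_simp; ring
  rw [e1] at k1
  rw [e2] at k2
  linarith

theorem Connects.px_compX_ne_zero (hφ : IsPointTransformation φ) (hc : Connects E φ E')
    (hE : E ∈ hatL0) (hE' : E' ∈ hatL0) {z : Space3} (hz : z ∈ φ.source) :
    px (compX φ) z ≠ 0 := by
  have hm := hc.minor_ne_zero hφ hE hE' hz
  rw [hc.pu_compX hφ hE hE' hz, mul_zero, sub_zero] at hm
  exact right_ne_zero_of_mul hm

theorem Connects.pu_compU_ne_zero (hφ : IsPointTransformation φ) (hc : Connects E φ E')
    (hE : E ∈ hatL0) (hE' : E' ∈ hatL0) {z : Space3} (hz : z ∈ φ.source) :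
    pu (compU φ) z ≠ 0 := by
  have hm := hc.minor_ne_zero hφ hE hE' hz
  rw [hc.pu_compX hφ hE hE' hz, mul_zero, sub_zero] at hm
  exact left_ne_zero_of_mul hm

/-- The determining equations obtained by splitting with respect to `u_xx` and `u_x`. -/
theorem Connects.split_equations (hφ : IsPointTransformation φ) (hc : Connects E φ E')
    (hE : E ∈ hatL0) (hE' : E' ∈ hatL0) {z : Space3} (hz : z ∈ φ.source) :
    E'.A2 (tx (φ z)) * pt (compT φ) z = E.A2 (tx z) * px (compX φ) z ^ 2 ∧
    pu (pu (compU φ)) z = 0 ∧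
    (E.A1 (tx z) - z.2.2) * pu (compU φ) z * px (compX φ) z - pu (compU φ) z * pt (compX φ) z +
      pt (compT φ) z * (compU φ z - E'.A1 (tx (φ z))) * pu (compU φ) z =
      E.A2 (tx z) * (2 * pu (px (compU φ)) z * px (compX φ) z -
        pu (compU φ) z * px (px (compX φ)) z) ∧
    pt (compU φ) z * px (compX φ) z - px (compU φ) z * pt (compX φ) z +
      pt (compT φ) z * (compU φ z - E'.A1 (tx (φ z))) * px (compU φ) z =
      E.A2 (tx z) * (px (px (compU φ)) z * px (compX φ) z -
        px (compU φ) z * px (px (compX φ)) z) := by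
  have hS := φ.open_source
  have hA := hc.A2_ne_zero hE hz
  have hXu : ∀ z ∈ φ.source, pu (compX φ) z = 0 := fun z hz => hc.pu_compX hφ hE hE' hz
  have hXx := hc.px_compX_ne_zero hφ hE hE' hz
  have hUu := hc.pu_compU_ne_zero hφ hE hE' hz
  have s1 : pu (px (compX φ)) z = 0 := pd_pd_zero hS hφ.comp_contDiffOn.2.1 hXu hz _
  have s2 : pu (pu (compX φ)) z = 0 := pd_zero hS hXu hz _
  have hX : ∀ p, px (compX φ) z + p * pu (compX φ) z ≠ 0 := by
    intro p; rwa [hXu z hz, mul_zero, add_zero]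
  have hA2 : E'.A2 (tx (φ z)) * pt (compT φ) z = E.A2 (tx z) * px (compX φ) z ^ 2 := by
    obtain ⟨a₀, p₀, r₀, h₀, b₀, c₀, d₀⟩ := hc.reduced_relation hφ hE hE' hz
      (a := 0) (p := 0) (r := 0) (by ring) (hX 0)
    obtain ⟨a₁, p₁, r₁, h₁, b₁, c₁, d₁⟩ := hc.reduced_relation hφ hE hE' hz
      (a := E.A2 (tx z)) (p := 0) (r := 1) (by ring) (hX 0)
    rw [hXu z hz] at b₀ b₁ c₀ c₁ d₀ d₁
    have ep : p₀ = p₁ := mul_right_cancel₀ hXx (by linear_combination c₁ - c₀)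
    subst ep
    apply mul_left_cancel₀ hUu
    linear_combination -px (compX φ) z ^ 2 * (b₁ - b₀) -
      px (compX φ) z ^ 2 * pt (compT φ) z * (h₁ - h₀) +
      pt (compT φ) z * E'.A2 (tx (φ z)) * (d₁ - d₀)
  have quad : ∀ p, (pt (compU φ) z + (E.A1 (tx z) - z.2.2) * p * pu (compU φ) z) * px (compX φ) z -
      (px (compU φ) z + p * pu (compU φ) z) * pt (compX φ) z +
      pt (compT φ) z * (compU φ z - E'.A1 (tx (φ z))) * (px (compU φ) z + p * pu (compU φ) z) =
      E.A2 (tx z) * ((px (px (compU φ)) z + 2 * p * pu (px (compU φ)) z +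
        p ^ 2 * pu (pu (compU φ)) z) * px (compX φ) z -
        (px (compU φ) z + p * pu (compU φ) z) * px (px (compX φ)) z) := by
    intro p
    obtain ⟨a₀, p₀, r₀, h₀, b₀, c₀, d₀⟩ := hc.reduced_relation hφ hE hE' hz
      (a := (E.A1 (tx z) - z.2.2) * p) (p := p) (r := 0) (by ring) (hX p)
    rw [hXu z hz] at b₀ c₀ d₀
    rw [s1, s2] at d₀
    have hp : p₀ * px (compX φ) z = px (compU φ) z + p * pu (compU φ) z := by
      linear_combination -c₀
    rw [← hp]
    apply mul_left_cancel₀ hXx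
    linear_combination px (compX φ) z ^ 2 * b₀ + px (compX φ) z ^ 2 * pt (compT φ) z * h₀ +
      r₀ * px (compX φ) z ^ 2 * hA2 - E.A2 (tx z) * px (compX φ) z ^ 2 * d₀
  -- The identity is quadratic in p, so its values at 0, 1 and -1 isolate the three coefficients.
  have q0 := quad 0
  have q1 := quad 1
  have q2 := quad (-1)
  refine ⟨hA2, ?_, ?_, ?_⟩
  · have : E.A2 (tx z) * px (compX φ) z * pu (pu (compU φ)) z = 0 := by
      linear_combination q0 - (q1 + q2) / 2
    simpa [hA, hXx] using this
  · linear_combination (q1 - q2) / 2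
  · linear_combination q0

/-- The final form of the determining equations. -/
structure DeterminingEquations (E : Eqn) (φ : Space3 → Space3) (E' : Eqn) (z : Space3) : Prop where
  Tx : px (compT φ) z = 0
  Tu : pu (compT φ) z = 0
  Tt : pt (compT φ) z ≠ 0
  Xu : pu (compX φ) z = 0
  Xxx : px (px (compX φ)) z = 0
  Uu : pt (compT φ) z * pu (compU φ) z = px (compX φ) z
  Uu_ne : pu (compU φ) z ≠ 0
  Uuu : pu (pu (compU φ)) z = 0
  Uux : px (pu (compU φ)) z = 0
  Ux : px (compU φ) z = -pt (pu (compU φ)) z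
  Uxx : px (px (compU φ)) z = 0
  Ut : pt (compU φ) z = (E.A1 (tx z) - z.2.2) * px (compU φ) z
  A1 : (E.A1 (tx z) - z.2.2) * px (compX φ) z - pt (compX φ) z +
    pt (compT φ) z * (compU φ z - E'.A1 (tx (φ z))) = 0
  A2 : E'.A2 (tx (φ z)) * pt (compT φ) z = E.A2 (tx z) * px (compX φ) z ^ 2

theorem quadratic_coeffs_eq_zero {ε a b : ℝ} (hε : 0 < ε)
    (h : ∀ τ ∈ Ioo (-ε) ε, a * τ ^ 2 + b * τ = 0) : a = 0 ∧ b = 0 := by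
  have h1 := h (ε / 2) ⟨by linarith, by linarith⟩
  have h2 := h (-(ε / 2)) ⟨by linarith, by linarith⟩
  have hb : ε * b = 0 := by linear_combination h1 - h2
  have ha : ε ^ 2 * a = 0 := by linear_combination 2 * h1 + 2 * h2
  simpa [hε.ne'] using And.intro ha hb

/-- Along a short segment in the u-direction, T, X and the equation coefficients are constant and
the needed derivatives of U are constant or affine, since U_uu = 0. The split equations thus become
polynomials in the displacement τ whose coefficients vanish; no derivative of A¹ or A² has to be
taken. -/
theorem Connects.u_lines (hφ : IsPointTransformation φ) (hc : Connects E φ E')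
    (hE : E ∈ hatL0) (hE' : E' ∈ hatL0) {z : Space3} (hz : z ∈ φ.source) :
    pt (compT φ) z * pu (compU φ) z = px (compX φ) z ∧ pu (px (compU φ)) z = 0 ∧
    pu (pt (compU φ)) z * px (compX φ) z + pt (compT φ) z * pu (compU φ) z * px (compU φ) z =
      E.A2 (tx z) * (pu (px (px (compU φ))) z * px (compX φ) z) := by
  have hS := φ.open_source
  obtain ⟨hT, hX, hU⟩ := hφ.comp_contDiffOn
  have hTu : ∀ z ∈ φ.source, pu (compT φ) z = 0 := fun z hz => (hc.compT_fibre hφ hE hE' hz).2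
  have hXu : ∀ z ∈ φ.source, pu (compX φ) z = 0 := fun z hz => hc.pu_compX hφ hE hE' hz
  have hUuu : ∀ z ∈ φ.source, pu (pu (compU φ)) z = 0 := fun z hz =>
    (hc.split_equations hφ hE hE' hz).2.1
  have hTt := hc.pt_compT_ne_zero hφ hE hE' hz
  have hUu := hc.pu_compU_ne_zero hφ hE hE' hz
  obtain ⟨ε, hε, hm⟩ := eventually_line_mem hS hz (0, 0, 1)
  -- functions constant or affine along the line
  have aff : ∀ {g : Space3 → ℝ}, ContDiffOn ℝ ∞ g φ.source →
      (∀ z ∈ φ.source, pu (pu g) z = 0) → ∀ τ ∈ Ioo (-ε) ε,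
      g (z + τ • ((0, 0, 1) : Space3)) = g z + τ * pu g z := fun hg h =>
    affine_on_line hS hg h hε hm
  have con : ∀ {g : Space3 → ℝ}, ContDiffOn ℝ ∞ g φ.source →
      (∀ z ∈ φ.source, pu g z = 0) → ∀ τ ∈ Ioo (-ε) ε,
      g (z + τ • ((0, 0, 1) : Space3)) = g z := fun hg h =>
    const_on_line hS hg h hε hm
  have comm2 : ∀ e, ∀ {g : Space3 → ℝ}, ContDiffOn ℝ ∞ g φ.source →
      (∀ z ∈ φ.source, pu (pu g) z = 0) → ∀ z ∈ φ.source, pu (pu (pd e g)) z = 0 := by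
    intro e g hg h z hz
    have h1 : pu (pu (pd e g)) z = pu (pd e (pu g)) z :=
      pd_congr hS (fun z hz => pd_comm hS hg hz (0, 0, 1) e) hz _
    rw [h1]
    exact pd_pd_zero hS (contDiffOn_pd hS hg _) h hz e
  have comm1 : ∀ e, ∀ {g : Space3 → ℝ}, ContDiffOn ℝ ∞ g φ.source →
      (∀ z ∈ φ.source, pu g z = 0) → ∀ z ∈ φ.source, pu (pd e g) z = 0 :=
    fun e g hg h z hz => pd_pd_zero hS hg h hz e
  have sm := fun {g : Space3 → ℝ} (hg : ContDiffOn ℝ ∞ g φ.source) e => contDiffOn_pd hS hg e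
  have lT := con hT hTu
  have lX := con hX hXu
  have lTt := con (sm hT (1, 0, 0)) (comm1 _ hT hTu)
  have lXx := con (sm hX (0, 1, 0)) (comm1 _ hX hXu)
  have lXt := con (sm hX (1, 0, 0)) (comm1 _ hX hXu)
  have lXxx := con (sm (sm hX (0, 1, 0)) (0, 1, 0)) (comm1 _ (sm hX _) (comm1 _ hX hXu))
  have lU := aff hU hUuu
  have lUu := con (sm hU (0, 0, 1)) hUuu
  have lUt := aff (sm hU (1, 0, 0)) (comm2 _ hU hUuu)
  have lUx := aff (sm hU (0, 1, 0)) (comm2 _ hU hUuu)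
  have lUxu := con (sm (sm hU (0, 1, 0)) (0, 0, 1)) (comm2 _ hU hUuu)
  have lUxx := aff (sm (sm hU (0, 1, 0)) (0, 1, 0)) (comm2 _ (sm hU _) (comm2 _ hU hUuu))
  have ltx : ∀ τ : ℝ, tx (z + τ • ((0, 0, 1) : Space3)) = tx z := by
    intro τ; simp [tx]
  have ltx' : ∀ τ ∈ Ioo (-ε) ε, tx (φ (z + τ • ((0, 0, 1) : Space3))) = tx (φ z) := by
    intro τ hτ
    exact Prod.ext (lT τ hτ) (lX τ hτ)
  have lu : ∀ τ : ℝ, (z + τ • ((0, 0, 1) : Space3)).2.2 = z.2.2 + τ := by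
    intro τ; simp
  obtain ⟨-, -, p1, p0⟩ := hc.split_equations hφ hE hE' hz
  have w1 : -pu (compU φ) z * px (compX φ) z + pt (compT φ) z * pu (compU φ) z ^ 2 = 0 := by
    -- The v_x-coefficient is only affine in u, hence the zero quadratic coefficient.
    refine (quadratic_coeffs_eq_zero (a := 0) hε fun τ hτ => ?_).2
    obtain ⟨-, -, q1, -⟩ := hc.split_equations hφ hE hE' (hm τ hτ)
    simp only [pt, px, pu] at q1
    rw [ltx, ltx' τ hτ, lu, lUu τ hτ, lXx τ hτ, lXt τ hτ, lTt τ hτ, lU τ hτ, lUxu τ hτ,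
      lXxx τ hτ] at q1
    linear_combination q1 - p1
  have w2 : pt (compT φ) z * pu (compU φ) z = px (compX φ) z :=
    mul_left_cancel₀ hUu (by linear_combination w1)
  have w3 : pt (compT φ) z * pu (compU φ) z * pu (px (compU φ)) z = 0 ∧
      pu (pt (compU φ)) z * px (compX φ) z - pu (px (compU φ)) z * pt (compX φ) z +
      pt (compT φ) z * (pu (compU φ) z * px (compU φ) z +
        (compU φ z - E'.A1 (tx (φ z))) * pu (px (compU φ)) z) -
      E.A2 (tx z) * (pu (px (px (compU φ))) z * px (compX φ) z -
        pu (px (compU φ)) z * px (px (compX φ)) z) = 0 := by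
    refine quadratic_coeffs_eq_zero hε fun τ hτ => ?_
    obtain ⟨-, -, -, q0⟩ := hc.split_equations hφ hE hE' (hm τ hτ)
    simp only [pt, px] at q0
    rw [ltx, ltx' τ hτ, lUx τ hτ, lXx τ hτ, lXt τ hτ, lTt τ hτ, lU τ hτ, lUt τ hτ,
      lXxx τ hτ, lUxx τ hτ] at q0
    linear_combination q0 - p0
  obtain ⟨w3, w4⟩ := w3
  have w5 : pu (px (compU φ)) z = 0 := by
    simpa [hTt, hUu] using w3
  rw [w5] at w4
  exact ⟨w2, w5, by linear_combination w4⟩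

/-- What remains is to differentiate the relations of `Connects.u_lines`. From U_xu = 0 also U_xxu =
0, so U_x = -U_tu; its x-derivative gives U_xx = 0, and the x-derivative of T_t U_u = X_x gives X_xx
= 0. The v_x-coefficient then reduces to the relation for A¹, and subtracting U_x times that
relation from the free term leaves U_t. -/
theorem Connects.determiningEquations (hφ : IsPointTransformation φ) (hc : Connects E φ E')
    (hE : E ∈ hatL0) (hE' : E' ∈ hatL0) {z : Space3} (hz : z ∈ φ.source) :
    DeterminingEquations E φ E' z := by
  have hS := φ.open_source
  obtain ⟨hT, hX, hU⟩ := hφ.comp_contDiffOn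
  have sm := fun {g : Space3 → ℝ} (hg : ContDiffOn ℝ ∞ g φ.source) e => contDiffOn_pd hS hg e
  have hTx : ∀ z ∈ φ.source, px (compT φ) z = 0 := fun z hz => (hc.compT_fibre hφ hE hE' hz).1
  have hXx := hc.px_compX_ne_zero hφ hE hE' hz
  have hUu := hc.pu_compU_ne_zero hφ hE hE' hz
  obtain ⟨a2, uuu, p1, p0⟩ := hc.split_equations hφ hE hE' hz
  have hUxu : ∀ z ∈ φ.source, pu (px (compU φ)) z = 0 := fun z hz =>
    (hc.u_lines hφ hE hE' hz).2.1
  have hUux : ∀ z ∈ φ.source, px (pu (compU φ)) z = 0 := fun z hz => by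
    rw [← hUxu z hz]; exact pd_comm hS hU hz _ _
  have hUx : ∀ z ∈ φ.source, px (compU φ) z = -pt (pu (compU φ)) z := by
    intro z hz
    obtain ⟨h1, -, h2⟩ := hc.u_lines hφ hE hE' hz
    have h3 : pu (px (px (compU φ))) z = 0 := pd_pd_zero hS (sm hU _) hUxu hz _
    rw [h3, h1] at h2
    have h4 : pt (pu (compU φ)) z = pu (pt (compU φ)) z := pd_comm hS hU hz _ _
    rw [h4]
    exact mul_left_cancel₀ (hc.px_compX_ne_zero hφ hE hE' hz) (by linear_combination h2)
  have hUxx : px (px (compU φ)) z = 0 := by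
    have h1 : px (px (compU φ)) z = px (fun z => -pt (pu (compU φ)) z) z := pd_congr hS hUx hz _
    have h2 : px (fun z => -pt (pu (compU φ)) z) z = -px (pt (pu (compU φ))) z := by
      exact congrArg (fun L : Space3 →L[ℝ] ℝ => L (0, 1, 0))
        (fderiv_fun_neg (𝕜 := ℝ) (f := pt (pu (compU φ))) (x := z))
    rw [h1, h2, neg_eq_zero]
    exact pd_pd_zero hS (sm hU _) hUux hz _
  have hXxx : px (px (compX φ)) z = 0 := by
    have h1 : px (px (compX φ)) z = px (fun z => pt (compT φ) z * pu (compU φ) z) z :=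
      pd_congr hS (fun z hz => (hc.u_lines hφ hE hE' hz).1.symm) hz _
    have hd : ∀ {g : Space3 → ℝ}, ContDiffOn ℝ ∞ g φ.source → DifferentiableAt ℝ g z :=
      fun hg => (hg.contDiffAt (hS.mem_nhds hz)).differentiableAt (by simp)
    have h2 : px (fun z => pt (compT φ) z * pu (compU φ) z) z =
        pt (compT φ) z * px (pu (compU φ)) z + pu (compU φ) z * px (pt (compT φ)) z := by
      have := ((hd (sm hT (1, 0, 0))).hasFDerivAt.mul (hd (sm hU (0, 0, 1))).hasFDerivAt).fderiv
      exact congrArg (fun L => L (0, 1, 0)) this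
    have h3 : px (pt (compT φ)) z = 0 := pd_pd_zero hS hT hTx hz _
    rw [h1, h2, h3, hUux z hz]; ring
  have hA1 : (E.A1 (tx z) - z.2.2) * px (compX φ) z - pt (compX φ) z +
      pt (compT φ) z * (compU φ z - E'.A1 (tx (φ z))) = 0 := by
    rw [hUxu z hz, hXxx] at p1
    exact mul_left_cancel₀ hUu (by linear_combination p1)
  refine ⟨hTx z hz, (hc.compT_fibre hφ hE hE' hz).2, hc.pt_compT_ne_zero hφ hE hE' hz,
    hc.pu_compX hφ hE hE' hz, hXxx, (hc.u_lines hφ hE hE' hz).1, hUu, uuu, hUux z hz, hUx z hz,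
    hUxx, ?_, hA1, a2⟩
  rw [hUxx, hXxx] at p0
  exact mul_left_cancel₀ hXx (by linear_combination p0 - px (compU φ) z * hA1)

end Classification

/-! ### The component formulas, and why they respect the relations between the A's and the Y's. -/

section Parameters

/-- The factor `c₁ Y¹ + c₀`. -/
def Params.w (P : Params) (y1 : ℝ) : ℝ := P.c1 * y1 + P.c0

/-- The component for `Y⁰`. -/
noncomputable def Params.y0 (P : Params) (t y0 y1 : ℝ) : ℝ :=
  y0 + Real.log (P.δ / (deriv P.T t * P.w y1 ^ 2))

/-- The component for `Y¹`. -/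
noncomputable def Params.y1 (P : Params) (y1 : ℝ) : ℝ := (P.c1' * y1 + P.c0') / P.w y1

/-- The component for `Y²`. -/
noncomputable def Params.y2 (P : Params) (t y0 y1 y2 : ℝ) : ℝ :=
  P.δ * y2 / P.w y1 - P.δ * P.X t * Real.exp (y0 / 2) / P.w y1 +
    P.c2 * P.y1 y1 + P.c3

/-- The component for `A¹¹`. -/
noncomputable def Params.a11 (P : Params) (t a11 y0 y1 : ℝ) : ℝ :=
  1 / deriv P.T t * (a11 - deriv (deriv P.T) t / deriv P.T t -
    2 * P.c1 * Real.exp y0 / P.w y1)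

/-- The component for `A¹⁰`. -/
noncomputable def Params.a10 (P : Params) (t a10 a11 y0 y1 y2 : ℝ) : ℝ :=
  P.w y1 * (a10 - 1 / 2 * Real.exp (-y0 / 2) * P.X t * a11 - Real.exp (-y0 / 2) * deriv P.X t) +
    P.c1 * Real.exp (y0 / 2) * P.X t + P.c2 - P.c1 * y2

/-- The component for `x`. -/
noncomputable def Params.x (P : Params) (t x y0 y1 : ℝ) : ℝ :=
  deriv P.T t * P.w y1 * (x + Real.exp (-y0 / 2) * P.X t)

/-- The component for `u`. -/
noncomputable def Params.u (P : Params) (x u y0 y1 y2 : ℝ) : ℝ :=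
  P.w y1 * u - P.c1 * Real.exp y0 * x + P.c2 - P.c1 * y2

theorem Params.map_apply (P : Params) (t x u a10 a11 a2 y0 y1 y2 : ℝ) :
    P.map ((t, x, u), (a10, a11, a2, y0, y1, y2)) =
      ((P.T t, P.x t x y0 y1, P.u x u y0 y1 y2),
        (P.a10 t a10 a11 y0 y1 y2, P.a11 t a11 y0 y1, deriv P.T t * P.w y1 ^ 2 * a2,
          P.y0 t y0 y1, P.y1 y1, P.y2 t y0 y1 y2)) := rfl

theorem Params.mem_source {P : Params} {t x u a10 a11 a2 y0 y1 y2 : ℝ} :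
    (((t, x, u), (a10, a11, a2, y0, y1, y2)) : Space9) ∈ P.source ↔ t ∈ P.I ∧ 0 < P.ε * P.w y1 :=
  Iff.rfl

/-- The factor `√(δ / T_t)`. -/
noncomputable def Params.κ (P : Params) (t : ℝ) : ℝ := √(P.δ / deriv P.T t)

variable {P : Params}

namespace Params.Valid

theorem δ_ne_zero (h : P.Valid) : P.δ ≠ 0 := by
  obtain ⟨z, hz⟩ := h.nonempty
  exact left_ne_zero_of_mul (h.pos _ hz.1).ne'

theorem Tt_ne_zero (h : P.Valid) {t : ℝ} (ht : t ∈ P.I) : deriv P.T t ≠ 0 :=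
  right_ne_zero_of_mul (h.pos _ ht).ne'

theorem div_pos (h : P.Valid) {t : ℝ} (ht : t ∈ P.I) : 0 < P.δ / deriv P.T t := by
  have h2 := h.Tt_ne_zero ht
  have : P.δ / deriv P.T t = P.δ * deriv P.T t / deriv P.T t ^ 2 := by field_simp
  rw [this]
  exact _root_.div_pos (h.pos t ht) (by positivity)

theorem κ_pos (h : P.Valid) {t : ℝ} (ht : t ∈ P.I) : 0 < P.κ t := Real.sqrt_pos.2 (h.div_pos ht)

theorem κ_sq (h : P.Valid) {t : ℝ} (ht : t ∈ P.I) : P.κ t ^ 2 * deriv P.T t = P.δ := by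
  rw [Params.κ, Real.sq_sqrt (h.div_pos ht).le, div_mul_cancel₀ _ (h.Tt_ne_zero ht)]

theorem ε_sq (h : P.Valid) : P.ε ^ 2 = 1 := by
  rcases h.sign with h | h <;> rw [h] <;> norm_num

theorem hasDerivAt_T (h : P.Valid) {t : ℝ} (ht : t ∈ P.I) : HasDerivAt P.T (deriv P.T t) t :=
  ((h.smooth_T.contDiffAt (h.isOpen.mem_nhds ht)).differentiableAt (by simp)).hasDerivAt

theorem smooth_deriv_T (h : P.Valid) : ContDiffOn ℝ ∞ (deriv P.T) P.I :=
  ((contDiffOn_infty_iff_deriv_of_isOpen h.isOpen).1 h.smooth_T).2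

theorem smooth_deriv_deriv_T (h : P.Valid) : ContDiffOn ℝ ∞ (deriv (deriv P.T)) P.I :=
  ((contDiffOn_infty_iff_deriv_of_isOpen h.isOpen).1 h.smooth_deriv_T).2

theorem smooth_deriv_X (h : P.Valid) : ContDiffOn ℝ ∞ (deriv P.X) P.I :=
  ((contDiffOn_infty_iff_deriv_of_isOpen h.isOpen).1 h.smooth_X).2

theorem hasDerivAt_deriv_T (h : P.Valid) {t : ℝ} (ht : t ∈ P.I) :
    HasDerivAt (deriv P.T) (deriv (deriv P.T) t) t :=
  ((h.smooth_deriv_T.contDiffAt (h.isOpen.mem_nhds ht)).differentiableAt (by simp)).hasDerivAt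

theorem hasDerivAt_X (h : P.Valid) {t : ℝ} (ht : t ∈ P.I) : HasDerivAt P.X (deriv P.X t) t :=
  ((h.smooth_X.contDiffAt (h.isOpen.mem_nhds ht)).differentiableAt (by simp)).hasDerivAt

theorem smooth_κ (h : P.Valid) : ContDiffOn ℝ ∞ P.κ P.I :=
  (contDiffOn_const.div h.smooth_deriv_T fun _ ht => h.Tt_ne_zero ht).sqrt
    fun _ ht => (h.div_pos ht).ne'

theorem exp_y0 (h : P.Valid) {t y0 y1 : ℝ} (ht : t ∈ P.I) (hw : P.w y1 ≠ 0) :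
    Real.exp (P.y0 t y0 y1) = Real.exp y0 * (P.δ / (deriv P.T t * P.w y1 ^ 2)) := by
  rw [Params.y0, Real.exp_add, Real.exp_log]
  rw [← div_div]
  exact _root_.div_pos (h.div_pos ht) (by positivity)

/-- Taking the square root of the formula for exp Ỹ⁰ produces |w|, which equals ε w on the chosen
component. This is how ε enters the law for X̆ under composition and inversion. -/
theorem exp_half_y0 (h : P.Valid) {t y0 y1 : ℝ} (ht : t ∈ P.I) (hw : 0 < P.ε * P.w y1) :
    Real.exp (P.y0 t y0 y1 / 2) = Real.exp (y0 / 2) * (P.κ t * P.ε / P.w y1) := by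
  have hw0 : P.w y1 ≠ 0 := right_ne_zero_of_mul hw.ne'
  have hT := h.Tt_ne_zero ht
  have h1 : 0 < P.κ t * P.ε / P.w y1 := by
    have : P.κ t * P.ε / P.w y1 = P.κ t * (P.ε * P.w y1) / P.w y1 ^ 2 := by field_simp
    rw [this]
    have := h.κ_pos ht
    positivity
  refine (pow_left_inj₀ (Real.exp_pos _).le (by positivity) two_ne_zero).1 ?_
  rw [← Real.exp_nat_mul, mul_pow, ← Real.exp_nat_mul]
  have e1 : ((2 : ℕ) : ℝ) * (P.y0 t y0 y1 / 2) = P.y0 t y0 y1 := by push_cast; ring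
  have e2 : ((2 : ℕ) : ℝ) * (y0 / 2) = y0 := by push_cast; ring
  rw [e1, e2, h.exp_y0 ht hw0, ← h.κ_sq ht, div_pow, mul_pow, h.ε_sq]
  field_simp

end Params.Valid

/-- The relations `dY⁰ = A¹¹ dt`, `dY¹ = exp Y⁰ dt`, `dY² = A¹⁰ exp Y⁰ dt` along a curve. -/
structure Contact (τ Y0 Y1 Y2 : ℝ → ℝ) (τ' a10 a11 s : ℝ) : Prop where
  time : HasDerivAt τ τ' s
  deriv_Y0 : HasDerivAt Y0 (τ' * a11) s
  deriv_Y1 : HasDerivAt Y1 (τ' * Real.exp (Y0 s)) s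
  deriv_Y2 : HasDerivAt Y2 (τ' * (a10 * Real.exp (Y0 s))) s

/-- The formulas for Ã¹¹ and Ã¹⁰ are the ones obtained by differentiating Ỹ⁰ and Ỹ² along a curve
and dividing by the derivative of T, and by that times exp Ỹ⁰. This serves for compositions, for the
image of an extended tuple, and for fixing the constant in Ỹ². -/
theorem Contact.map {τ Y0 Y1 Y2 : ℝ → ℝ} {τ' a10 a11 s : ℝ} (hC : Contact τ Y0 Y1 Y2 τ' a10 a11 s)
    (h : P.Valid) (ht : τ s ∈ P.I) (hw : P.w (Y1 s) ≠ 0) :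
    Contact (fun s => P.T (τ s)) (fun s => P.y0 (τ s) (Y0 s) (Y1 s)) (fun s => P.y1 (Y1 s))
      (fun s => P.y2 (τ s) (Y0 s) (Y1 s) (Y2 s)) (τ' * deriv P.T (τ s))
      (P.a10 (τ s) a10 a11 (Y0 s) (Y1 s) (Y2 s)) (P.a11 (τ s) a11 (Y0 s) (Y1 s)) s := by
  obtain ⟨h0, hY0, hY1, hY2⟩ := hC
  have hT := h.Tt_ne_zero ht
  have hδ := h.δ_ne_zero
  have dT := (h.hasDerivAt_T ht).comp s h0
  have dTt := (h.hasDerivAt_deriv_T ht).comp s h0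
  have dX := (h.hasDerivAt_X ht).comp s h0
  have dw : HasDerivAt (fun s => P.w (Y1 s)) (P.c1 * (τ' * Real.exp (Y0 s))) s :=
    (hY1.const_mul P.c1).add_const P.c0
  have dE : HasDerivAt (fun s => Real.exp (Y0 s / 2)) (Real.exp (Y0 s / 2) * (τ' * a11 / 2)) s :=
    (hY0.div_const 2).exp
  have d1 : HasDerivAt (fun s => P.y1 (Y1 s))
      (τ' * deriv P.T (τ s) * Real.exp (P.y0 (τ s) (Y0 s) (Y1 s))) s := by
    refine (((hY1.const_mul P.c1').add_const P.c0').div dw hw).congr_deriv ?_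
    rw [h.exp_y0 ht hw]
    simp only [Params.δ]
    field_simp
    simp only [Params.w]; ring
  refine ⟨?_, ?_, d1, ?_⟩
  · exact dT.congr_deriv (by ring)
  · have hne : P.δ / (deriv P.T (τ s) * P.w (Y1 s) ^ 2) ≠ 0 := by positivity
    have dd := ((hasDerivAt_const s P.δ).div (dTt.mul (dw.pow 2)) (by simp; tauto)).log hne
    refine (hY0.add dd).congr_deriv ?_
    simp only [Params.a11, Function.comp, Pi.mul_apply, Pi.pow_apply, Pi.div_apply]
    field_simp
    ring
  · have hE : Real.exp (Y0 s) = Real.exp (Y0 s / 2) ^ 2 := by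
      rw [← Real.exp_nat_mul]; congr 1; push_cast; ring
    have hE' : Real.exp (-Y0 s / 2) = (Real.exp (Y0 s / 2))⁻¹ := by
      rw [← Real.exp_neg]; congr 1; ring
    have d2 := ((((hY2.const_mul P.δ).div dw hw).sub
      (((dX.const_mul P.δ).mul dE).div dw hw)).add (d1.const_mul P.c2)).add_const P.c3
    refine d2.congr_deriv ?_
    rw [h.exp_y0 ht hw, hE]
    simp only [Params.a10, Function.comp, Pi.mul_apply]
    rw [hE']
    field_simp
    ring

end Parameters

/-! ### Composition of transformations through composition of parameters. -/

section Composition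

/-- The parameters of the composition of the transformation with the parameters `Q` after
the transformation with the parameters `P`. -/
noncomputable def Params.comp (Q P : Params) : Params where
  I := P.I ∩ P.T ⁻¹' Q.I
  T := fun t => Q.T (P.T t)
  -- The image shift exp(-Ỹ⁰/2) X_Q equals exp(-Y⁰/2) w ε X_Q / κ. Pulling out T_t w and using κ²
  -- T_t = δ turns ε/(κ T_t) into ε κ/δ.
  X := fun t => P.X t + P.ε * P.κ t * Q.X (P.T t) / P.δ
  -- c₀, c₁, c₀', c₁' multiply as the matrices of the linear fractional maps of Y¹. In c₂ and c₃ the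
  -- terms with Ỹ¹ cancel, because Ỹ² contains c₂ Ỹ¹ + c₃.
  c0 := Q.c1 * P.c0' + Q.c0 * P.c0
  c1 := Q.c1 * P.c1' + Q.c0 * P.c1
  c2 := Q.c0 * P.c2 + Q.c2 - Q.c1 * P.c3
  c3 := Q.c3 + Q.c1' * P.c3 - Q.c0' * P.c2
  c0' := Q.c1' * P.c0' + Q.c0' * P.c0
  c1' := Q.c1' * P.c1' + Q.c0' * P.c1
  ε := Q.ε * P.ε

variable {P Q : Params}

theorem Params.comp_δ (Q P : Params) : (Q.comp P).δ = Q.δ * P.δ := by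
  simp only [Params.δ, Params.comp]; ring

/-- The cocycle property of the denominators of linear fractional maps. -/
theorem Params.comp_w {y1 : ℝ} (hw : P.w y1 ≠ 0) :
    (Q.comp P).w y1 = Q.w (P.y1 y1) * P.w y1 := by
  have h : (Q.comp P).w y1 = Q.c1 * (P.c1' * y1 + P.c0') + Q.c0 * P.w y1 := by
    simp only [Params.w, Params.comp]; ring
  have h' : Q.w (P.y1 y1) = Q.c1 * ((P.c1' * y1 + P.c0') / P.w y1) + Q.c0 := rfl
  rw [h, h']
  field_simp

theorem Params.comp_y1 {y1 : ℝ} (hw : P.w y1 ≠ 0) (hw' : Q.w (P.y1 y1) ≠ 0) :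
    (Q.comp P).y1 y1 = Q.y1 (P.y1 y1) := by
  rw [Params.y1, Params.comp_w hw, Params.y1.eq_1 Q]
  field_simp
  simp only [Params.comp, Params.y1]
  field_simp
  simp only [Params.w]
  ring

theorem Params.comp_deriv_T (hP : P.Valid) (hQ : Q.Valid) {t : ℝ} (ht : t ∈ P.I)
    (ht' : P.T t ∈ Q.I) : deriv (Q.comp P).T t = deriv Q.T (P.T t) * deriv P.T t :=
  ((hQ.hasDerivAt_T ht').comp t (hP.hasDerivAt_T ht)).deriv

theorem Params.comp_y0 (hP : P.Valid) (hQ : Q.Valid) {t y0 y1 : ℝ} (ht : t ∈ P.I)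
    (ht' : P.T t ∈ Q.I) (hw : P.w y1 ≠ 0) (hw' : Q.w (P.y1 y1) ≠ 0) :
    (Q.comp P).y0 t y0 y1 = Q.y0 (P.T t) (P.y0 t y0 y1) (P.y1 y1) := by
  have h1 : P.δ / (deriv P.T t * P.w y1 ^ 2) ≠ 0 :=
    div_ne_zero hP.δ_ne_zero (mul_ne_zero (hP.Tt_ne_zero ht) (by positivity))
  have h2 : Q.δ / (deriv Q.T (P.T t) * Q.w (P.y1 y1) ^ 2) ≠ 0 :=
    div_ne_zero hQ.δ_ne_zero (mul_ne_zero (hQ.Tt_ne_zero ht') (by positivity))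
  simp only [Params.y0]
  rw [Params.comp_δ, Params.comp_w hw, Params.comp_deriv_T hP hQ ht ht', add_assoc,
    ← Real.log_mul h1 h2]
  congr 2
  have := hP.Tt_ne_zero ht
  have := hQ.Tt_ne_zero ht'
  simp only [Params.y1] at *
  field_simp

theorem Params.exp_neg_half_y0 (hP : P.Valid) {t y0 y1 : ℝ} (ht : t ∈ P.I)
    (hw : 0 < P.ε * P.w y1) :
    Real.exp (-P.y0 t y0 y1 / 2) = Real.exp (-y0 / 2) * (P.w y1 * P.ε / P.κ t) := by
  have h1 : -P.y0 t y0 y1 / 2 = -(P.y0 t y0 y1 / 2) := by ring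
  have h2 : -y0 / 2 = -(y0 / 2) := by ring
  have hw0 : P.w y1 ≠ 0 := right_ne_zero_of_mul hw.ne'
  have hκ := (hP.κ_pos ht).ne'
  have hε : P.ε ≠ 0 := left_ne_zero_of_mul hw.ne'
  rw [h1, h2, Real.exp_neg, Real.exp_neg, hP.exp_half_y0 ht hw, mul_inv]
  congr 1
  field_simp
  exact hP.ε_sq.symm

theorem Params.comp_y2 (hP : P.Valid) {t y0 y1 y2 : ℝ} (ht : t ∈ P.I)
    (hw : 0 < P.ε * P.w y1) (hw' : Q.w (P.y1 y1) ≠ 0) :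
    (Q.comp P).y2 t y0 y1 y2 = Q.y2 (P.T t) (P.y0 t y0 y1) (P.y1 y1) (P.y2 t y0 y1 y2) := by
  have hw0 : P.w y1 ≠ 0 := right_ne_zero_of_mul hw.ne'
  have hδ := hP.δ_ne_zero
  rw [Params.y2, Params.y2.eq_1 Q, Params.comp_w hw0, Params.comp_δ, Params.comp_y1 hw0 hw',
    hP.exp_half_y0 ht hw]
  have h1 : Q.y1 (P.y1 y1) = (Q.c1' * P.y1 y1 + Q.c0') / Q.w (P.y1 y1) := rfl
  have h2 : Q.w (P.y1 y1) = Q.c1 * P.y1 y1 + Q.c0 := rfl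
  rw [h1]
  simp only [Params.comp, Params.y2]
  field_simp
  rw [h2]
  simp only [Params.δ]
  ring

theorem Params.comp_x (hP : P.Valid) (hQ : Q.Valid) {t x y0 y1 : ℝ} (ht : t ∈ P.I)
    (ht' : P.T t ∈ Q.I) (hw : 0 < P.ε * P.w y1) :
    (Q.comp P).x t x y0 y1 = Q.x (P.T t) (P.x t x y0 y1) (P.y0 t y0 y1) (P.y1 y1) := by
  have hw0 : P.w y1 ≠ 0 := right_ne_zero_of_mul hw.ne'
  have hδ := hP.δ_ne_zero
  rw [Params.x, Params.x.eq_1 Q, Params.comp_w hw0, Params.comp_deriv_T hP hQ ht ht',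
    Params.exp_neg_half_y0 hP ht hw]
  simp only [Params.comp, Params.x]
  rw [← hP.κ_sq ht] at hδ ⊢
  have := hP.Tt_ne_zero ht
  field_simp
  ring

theorem Params.comp_u (hP : P.Valid) {t x u y0 y1 y2 : ℝ} (ht : t ∈ P.I)
    (hw : 0 < P.ε * P.w y1) :
    (Q.comp P).u x u y0 y1 y2 =
      Q.u (P.x t x y0 y1) (P.u x u y0 y1 y2) (P.y0 t y0 y1) (P.y1 y1) (P.y2 t y0 y1 y2) := by
  have hw0 : P.w y1 ≠ 0 := right_ne_zero_of_mul hw.ne'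
  have hT := hP.Tt_ne_zero ht
  have hE : Real.exp y0 = Real.exp (y0 / 2) ^ 2 := by
    rw [← Real.exp_nat_mul]; congr 1; push_cast; ring
  have hE' : Real.exp (-y0 / 2) = (Real.exp (y0 / 2))⁻¹ := by
    rw [← Real.exp_neg]; congr 1; ring
  rw [Params.u, Params.u.eq_1 Q, Params.comp_w hw0, hP.exp_y0 ht hw0, hE]
  have h1 : P.y1 y1 * P.w y1 = P.c1' * y1 + P.c0' := by
    rw [Params.y1, div_mul_cancel₀ _ hw0]
  have h2 : Q.w (P.y1 y1) = Q.c1 * P.y1 y1 + Q.c0 := rfl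
  have h3 : P.δ = P.c1' * P.w y1 - P.c1 * (P.y1 y1 * P.w y1) := by
    rw [h1, Params.δ, Params.w]; ring
  rw [h2]
  simp only [Params.comp, Params.y2, Params.x, Params.u]
  rw [hE', hE]
  field_simp
  rw [h3]
  ring

/-- T_t has the sign of δ throughout the interval, so T is strictly monotone. The betweenness
statement makes the time domain of a composition an interval again. -/
theorem Params.Valid.injOn (h : P.Valid) : InjOn P.T P.I ∧
    ∀ a ∈ P.I, ∀ b ∈ P.I, ∀ t ∈ Icc a b, P.T t ∈ uIcc (P.T a) (P.T b) := by
  have hconv : Convex ℝ P.I := h.connected.ordConnected.convex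
  rcases lt_or_gt_of_ne h.δ_ne_zero with hδ | hδ
  · have hm : StrictAntiOn P.T P.I := strictAntiOn_of_deriv_neg hconv h.smooth_T.continuousOn
      fun t ht => by
        rw [h.isOpen.interior_eq] at ht
        have := h.pos t ht
        by_contra hn
        nlinarith
    refine ⟨hm.injOn, fun a ha b hb t ht => ?_⟩
    have hI := h.connected.ordConnected.out ha hb ht
    exact mem_uIcc.2 (Or.inr ⟨hm.antitoneOn hI hb ht.2, hm.antitoneOn ha hI ht.1⟩)
  · have hm : StrictMonoOn P.T P.I := strictMonoOn_of_deriv_pos hconv h.smooth_T.continuousOn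
      fun t ht => by
        rw [h.isOpen.interior_eq] at ht
        exact pos_of_mul_pos_right (h.pos t ht) hδ.le
    refine ⟨hm.injOn, fun a ha b hb t ht => ?_⟩
    have hI := h.connected.ordConnected.out ha hb ht
    exact mem_uIcc.2 (Or.inl ⟨hm.monotoneOn ha hI ht.1, hm.monotoneOn hI hb ht.2⟩)

theorem Params.Valid.comp (hP : P.Valid) (hQ : Q.Valid) (hne : (Q.comp P).source.Nonempty) :
    (Q.comp P).Valid where
  isOpen := hP.smooth_T.continuousOn.isOpen_inter_preimage hP.isOpen hQ.isOpen
  connected := by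
    refine OrdConnected.isPreconnected (ordConnected_iff.2 fun a ha b hb _ t ht => ?_)
    refine ⟨hP.connected.ordConnected.out ha.1 hb.1 ht, ?_⟩
    exact hQ.connected.ordConnected.uIcc_subset ha.2 hb.2 (hP.injOn.2 a ha.1 b hb.1 t ht)
  smooth_T := hQ.smooth_T.comp (hP.smooth_T.mono inter_subset_left) fun _ ht => ht.2
  smooth_X := (hP.smooth_X.mono inter_subset_left).add
    (((contDiffOn_const.mul (hP.smooth_κ.mono inter_subset_left)).mul
      (hQ.smooth_X.comp (hP.smooth_T.mono inter_subset_left) fun _ ht => ht.2)).div_const _)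
  pos := fun t ht => by
    rw [Params.comp_δ, Params.comp_deriv_T hP hQ ht.1 ht.2]
    have := mul_pos (hP.pos t ht.1) (hQ.pos _ ht.2)
    linarith
  sign := by
    rcases hP.sign with h | h <;> rcases hQ.sign with h' | h' <;> simp [Params.comp, h, h']
  nonempty := hne

theorem Params.comp_sign {y1 : ℝ} (hw : 0 < P.ε * P.w y1) (hw' : 0 < Q.ε * Q.w (P.y1 y1)) :
    0 < (Q.comp P).ε * (Q.comp P).w y1 := by
  rw [Params.comp_w (right_ne_zero_of_mul hw.ne')]
  have := mul_pos hw hw'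
  simp only [Params.comp]
  linarith

/-- The composition of transformations corresponds to the composition of parameters. -/
theorem Params.map_map (hP : P.Valid) (hQ : Q.Valid) {z : Space9} (hz : z ∈ P.source)
    (hz' : P.map z ∈ Q.source) : z ∈ (Q.comp P).source ∧ (Q.comp P).map z = Q.map (P.map z) := by
  obtain ⟨⟨t, x, u⟩, ⟨a10, a11, a2, y0, y1, y2⟩⟩ := z
  rw [Params.map_apply] at hz' ⊢
  obtain ⟨ht, hw⟩ := Params.mem_source.1 hz
  obtain ⟨ht', hw'⟩ := Params.mem_source.1 hz'
  have hw0 : P.w y1 ≠ 0 := right_ne_zero_of_mul hw.ne'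
  have hw0' : Q.w (P.y1 y1) ≠ 0 := right_ne_zero_of_mul hw'.ne'
  have hmem : (((t, x, u), (a10, a11, a2, y0, y1, y2)) : Space9) ∈ (Q.comp P).source :=
    Params.mem_source.2 ⟨⟨ht, ht'⟩, Params.comp_sign hw hw'⟩
  refine ⟨hmem, ?_⟩
  have hv := hP.comp hQ ⟨_, hmem⟩
  have hT := hv.Tt_ne_zero (t := t) ⟨ht, ht'⟩
  -- a curve with the given values of the arbitrary elements
  let Y0 : ℝ → ℝ := fun s => y0 + (s - t) * a11
  let Y1 : ℝ → ℝ := fun s => y1 + (s - t) * Real.exp y0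
  let Y2 : ℝ → ℝ := fun s => y2 + (s - t) * (a10 * Real.exp y0)
  have e0 : Y0 t = y0 := by simp [Y0]
  have e1 : Y1 t = y1 := by simp [Y1]
  have e2 : Y2 t = y2 := by simp [Y2]
  have lin : ∀ c k : ℝ, HasDerivAt (fun s => c + (s - t) * k) (1 * k) t := fun c k =>
    (((hasDerivAt_id t).sub_const t).mul_const k).const_add c
  have hC : Contact (fun s => s) Y0 Y1 Y2 1 a10 a11 t := by
    refine ⟨hasDerivAt_id t, lin _ _, ?_, ?_⟩ <;> rw [e0] <;> exact lin _ _
  have hC1 := hC.map hP ht (by rw [e1]; exact hw0)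
  have hC2 := hC1.map hQ ht' (by rw [e1]; exact hw0')
  have hC3 := hC.map hv ⟨ht, ht'⟩ (by rw [e1, Params.comp_w hw0]; exact mul_ne_zero hw0' hw0)
  rw [e0, e1, e2] at hC1 hC2 hC3
  simp only [one_mul] at hC2 hC3
  have ev1 : ∀ᶠ s in 𝓝 t, s ∈ P.I := hP.isOpen.mem_nhds ht
  have ev2 : ∀ᶠ s in 𝓝 t, P.T s ∈ Q.I :=
    (hP.hasDerivAt_T ht).continuousAt.eventually (hQ.isOpen.mem_nhds ht')
  have ev3 : ∀ᶠ s in 𝓝 t, 0 < P.ε * P.w (Y1 s) := by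
    have : ContinuousAt (fun s => P.ε * P.w (Y1 s)) t := by unfold Params.w; fun_prop
    exact this.eventually (lt_mem_nhds (show 0 < P.ε * P.w (Y1 t) by rwa [e1]))
  have ev4 : ∀ᶠ s in 𝓝 t, 0 < Q.ε * Q.w (P.y1 (Y1 s)) := by
    have h1 := hC1.deriv_Y1.continuousAt
    have : ContinuousAt (fun s => Q.ε * Q.w (P.y1 (Y1 s))) t := by unfold Params.w; fun_prop
    exact this.eventually (lt_mem_nhds (show 0 < Q.ε * Q.w (P.y1 (Y1 t)) by rwa [e1]))
  have hy0 := Params.comp_y0 hP hQ (y0 := y0) ht ht' hw0 hw0'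
  have hderiv : deriv (Q.comp P).T t = deriv P.T t * deriv Q.T (P.T t) := by
    rw [Params.comp_deriv_T hP hQ ht ht', mul_comm]
  -- Along the auxiliary curve the Y⁰-component of the composition is differentiated in two ways:
  -- through the composed parameters and through two applications of `Contact.map`. Uniqueness of
  -- derivatives identifies the A¹¹-components; the Y²-component then does the same for A¹⁰.
  have ha11 : (Q.comp P).a11 t a11 y0 y1 = Q.a11 (P.T t) (P.a11 t a11 y0 y1) (P.y0 t y0 y1)
      (P.y1 y1) := by
    have h := hC3.deriv_Y0.congr_of_eventuallyEq (f₁ := fun s => Q.y0 (P.T s)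
      (P.y0 s (Y0 s) (Y1 s)) (P.y1 (Y1 s))) (by
        filter_upwards [ev1, ev2, ev3, ev4] with s h1 h2 h3 h4
        exact (Params.comp_y0 hP hQ h1 h2 (right_ne_zero_of_mul h3.ne')
          (right_ne_zero_of_mul h4.ne')).symm)
    have := h.unique hC2.deriv_Y0
    rw [← hderiv] at this
    exact mul_left_cancel₀ hT this
  have ha10 : (Q.comp P).a10 t a10 a11 y0 y1 y2 = Q.a10 (P.T t) (P.a10 t a10 a11 y0 y1 y2)
      (P.a11 t a11 y0 y1) (P.y0 t y0 y1) (P.y1 y1) (P.y2 t y0 y1 y2) := by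
    have h := hC3.deriv_Y2.congr_of_eventuallyEq (f₁ := fun s => Q.y2 (P.T s)
      (P.y0 s (Y0 s) (Y1 s)) (P.y1 (Y1 s)) (P.y2 s (Y0 s) (Y1 s) (Y2 s))) (by
        filter_upwards [ev1, ev2, ev3, ev4] with s h1 h2 h3 h4
        exact (Params.comp_y2 hP h1 h3 (right_ne_zero_of_mul h4.ne')).symm)
    have := h.unique hC2.deriv_Y2
    rw [← hderiv] at this
    simp only [e0, e1] at this
    rw [hy0] at this
    exact mul_right_cancel₀ (Real.exp_pos _).ne' (mul_left_cancel₀ hT this)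
  rw [Params.map_apply, Params.map_apply, ha10, ha11, hy0, Params.comp_y1 hw0 hw0',
    Params.comp_y2 hP ht hw hw0', Params.comp_x hP hQ ht ht' hw, Params.comp_u hP ht hw,
    Params.comp_w hw0, Params.comp_deriv_T hP hQ ht ht']
  have : deriv Q.T (P.T t) * deriv P.T t * (Q.w (P.y1 y1) * P.w y1) ^ 2 * a2 =
    deriv Q.T (P.T t) * Q.w (P.y1 y1) ^ 2 * (deriv P.T t * P.w y1 ^ 2 * a2) := by ring
  rw [this]
  rfl

end Composition

/-! ### Inverses, existence of the transformations, and the group property. -/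

section Group

variable {P Q : Params}

theorem Params.Valid.isOpenMap_T (h : P.Valid) : IsOpenMap (P.I.domRestrict P.T) := by
  rw [isOpenMap_iff_nhds_le]
  intro t
  have h1 : Filter.map P.T (𝓝 (t : ℝ)) = 𝓝 (P.T t) :=
    ((h.smooth_T.contDiffAt (h.isOpen.mem_nhds t.2)).hasStrictDerivAt (by simp)).map_nhds_eq
      (h.Tt_ne_zero t.2)
  have h2 : Filter.map (Subtype.val : P.I → ℝ) (𝓝 t) = 𝓝 (t : ℝ) :=
    h.isOpen.isOpenEmbedding_subtypeVal.map_nhds_eq t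
  have h3 : P.I.domRestrict P.T = P.T ∘ Subtype.val := rfl
  rw [h3, ← Filter.map_map, h2, h1]
  rfl

/-- The change of time as a local homeomorphism. -/
noncomputable def Params.Valid.timeHomeo (h : P.Valid) : OpenPartialHomeomorph ℝ ℝ :=
  OpenPartialHomeomorph.ofContinuousOpenRestrict (h.injOn.1.toPartialEquiv P.T P.I)
    h.smooth_T.continuousOn h.isOpenMap_T h.isOpen

/-- The inverse of the change of time. -/
noncomputable def Params.S (P : Params) : ℝ → ℝ := Function.invFunOn P.T P.I

namespace Params.Valid

theorem S_T (h : P.Valid) {t : ℝ} (ht : t ∈ P.I) : P.S (P.T t) = t :=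
  h.injOn.1.leftInvOn_invFunOn ht

theorem isOpen_image (h : P.Valid) : IsOpen (P.T '' P.I) := h.timeHomeo.open_target

theorem hasDerivAt_S (h : P.Valid) {t : ℝ} (ht : t ∈ P.I) :
    HasDerivAt P.S (deriv P.T t)⁻¹ (P.T t) := by
  refine h.timeHomeo.hasDerivAt_symm (mem_image_of_mem _ ht) (h.Tt_ne_zero ht) ?_
  have : h.timeHomeo.symm (P.T t) = t := h.S_T ht
  rw [this]
  exact h.hasDerivAt_T ht

theorem smooth_S (h : P.Valid) : ContDiffOn ℝ ∞ P.S (P.T '' P.I) := by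
  rintro _ ⟨t, ht, rfl⟩
  have hs : h.timeHomeo.symm (P.T t) = t := h.S_T ht
  refine (h.timeHomeo.contDiffAt_symm_deriv (h.Tt_ne_zero ht) (mem_image_of_mem _ ht) ?_
    ?_).contDiffWithinAt <;> rw [hs]
  · exact h.hasDerivAt_T ht
  · exact h.smooth_T.contDiffAt (h.isOpen.mem_nhds ht)

theorem smooth_comp_S (h : P.Valid) {f : ℝ → ℝ} (hf : ContDiffOn ℝ ∞ f P.I) :
    ContDiffOn ℝ ∞ (fun s => f (P.S s)) (P.T '' P.I) :=
  hf.comp h.smooth_S (by rintro _ ⟨t, ht, rfl⟩; rwa [h.S_T ht])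

end Params.Valid

/-- The parameters of the inverse transformation. -/
noncomputable def Params.inv (P : Params) : Params where
  I := P.T '' P.I
  T := P.S
  -- Solves X_P + ε κ X_Q / δ = 0, using ε² = 1.
  X := fun s => -P.ε * P.δ * P.X (P.S s) / P.κ (P.S s)
  -- The entries of the inverse matrix of the linear fractional map; c₂ and c₃ solve the linear
  -- equations that make those of the composition vanish.
  c0 := P.c1' / P.δ
  c1 := -P.c1 / P.δ
  c2 := -(P.c2 * P.c1' + P.c1 * P.c3) / P.δ
  c3 := -(P.c0 * P.c3 + P.c0' * P.c2) / P.δ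
  c0' := -P.c0' / P.δ
  c1' := P.c0 / P.δ
  ε := P.ε

theorem Params.Valid.inv_δ (h : P.Valid) : P.inv.δ = 1 / P.δ := by
  have := h.δ_ne_zero
  have h1 : P.inv.δ = P.c0 / P.δ * (P.c1' / P.δ) - -P.c0' / P.δ * (-P.c1 / P.δ) := rfl
  have h3 : P.inv.δ = (P.c0 * P.c1' - P.c0' * P.c1) / P.δ ^ 2 := by rw [h1]; ring
  have h2 : P.c0 * P.c1' - P.c0' * P.c1 = P.δ := by rw [Params.δ]; ring
  rw [h3, h2]; field_simp

theorem Params.Valid.inv_w (h : P.Valid) {y1 : ℝ} (hw : P.w y1 ≠ 0) :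
    P.inv.w (P.y1 y1) = 1 / P.w y1 := by
  have hδ := h.δ_ne_zero
  have h1 : P.inv.w (P.y1 y1) = -P.c1 / P.δ * ((P.c1' * y1 + P.c0') / P.w y1) + P.c1' / P.δ := rfl
  have h2 : P.δ = P.c1' * P.w y1 - P.c1 * (P.c1' * y1 + P.c0') := by
    rw [Params.δ, Params.w]; ring
  rw [h1]
  field_simp
  rw [h2]; ring

theorem Params.Valid.map_mem_inv_source (h : P.Valid) {z : Space9} (hz : z ∈ P.source) :
    P.map z ∈ P.inv.source := by
  obtain ⟨⟨t, x, u⟩, ⟨a10, a11, a2, y0, y1, y2⟩⟩ := z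
  obtain ⟨ht, hw⟩ := Params.mem_source.1 hz
  rw [Params.map_apply]
  refine Params.mem_source.2 ⟨mem_image_of_mem _ ht, ?_⟩
  have hw0 : P.w y1 ≠ 0 := right_ne_zero_of_mul hw.ne'
  rw [h.inv_w hw0]
  have : P.inv.ε * (1 / P.w y1) = P.ε * P.w y1 / P.w y1 ^ 2 := by
    simp only [Params.inv]; field_simp
  rw [this]; positivity

theorem Params.Valid.inv (h : P.Valid) : P.inv.Valid where
  isOpen := h.isOpen_image
  connected := h.connected.image _ h.smooth_T.continuousOn
  smooth_T := h.smooth_S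
  smooth_X := by
    refine (contDiffOn_const.mul (h.smooth_comp_S h.smooth_X)).div (h.smooth_comp_S h.smooth_κ) ?_
    rintro _ ⟨t, ht, rfl⟩
    rw [h.S_T ht]
    exact (h.κ_pos ht).ne'
  pos := by
    rintro _ ⟨t, ht, rfl⟩
    have h1 : deriv P.inv.T (P.T t) = (deriv P.T t)⁻¹ := (h.hasDerivAt_S ht).deriv
    rw [h.inv_δ, h1, one_div, ← mul_inv]
    exact inv_pos.2 (h.pos t ht)
  sign := h.sign
  nonempty := h.nonempty.elim fun _ hz => ⟨_, h.map_mem_inv_source hz⟩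

/-- The identities for T and X are required only on an open set of times: that is all that holds for
a transformation followed by its inverse, and it suffices to compute T_t, T_tt and X_t there. -/
theorem Params.map_eq_self {R : Params} {J : Set ℝ} (hJ : IsOpen J) (hT : ∀ t ∈ J, R.T t = t)
    (hX : ∀ t ∈ J, R.X t = 0) (h0 : R.c0 = 1) (h1 : R.c1 = 0) (h2 : R.c2 = 0) (h3 : R.c3 = 0)
    (h0' : R.c0' = 0) (h1' : R.c1' = 1) {z : Space9} (hz : z.1.1 ∈ J) : R.map z = z := by
  obtain ⟨⟨t, x, u⟩, ⟨a10, a11, a2, y0, y1, y2⟩⟩ := z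
  have d1 : ∀ t ∈ J, deriv R.T t = 1 := by
    intro t ht
    have : R.T =ᶠ[𝓝 t] fun t => t := by
      filter_upwards [hJ.mem_nhds ht] with s hs using hT s hs
    rw [this.deriv_eq, deriv_id'']
  have d2 : deriv (deriv R.T) t = 0 := by
    have : deriv R.T =ᶠ[𝓝 t] fun _ => 1 := by
      filter_upwards [hJ.mem_nhds hz] with s hs using d1 s hs
    rw [this.deriv_eq, deriv_const]
  have d3 : deriv R.X t = 0 := by
    have : R.X =ᶠ[𝓝 t] fun _ => 0 := by
      filter_upwards [hJ.mem_nhds hz] with s hs using hX s hs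
    rw [this.deriv_eq, deriv_const]
  have hw : R.w y1 = 1 := by rw [Params.w, h0, h1]; ring
  have hδ : R.δ = 1 := by rw [Params.δ, h0, h1, h0', h1']; ring
  rw [Params.map_apply]
  simp only [Params.x, Params.u, Params.a10, Params.a11, Params.y0, Params.y1, Params.y2, hw, hδ,
    d1 t hz, d2, d3, hT t hz, hX t hz, h0', h1', h1, h2, h3]
  simp

/-- By the composition law it is enough that the composed parameters are those of the identity for
times in the interval. -/
theorem Params.Valid.inv_map_map (h : P.Valid) {z : Space9} (hz : z ∈ P.source) :
    P.inv.map (P.map z) = z := by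
  have hδ := h.δ_ne_zero
  rw [← (Params.map_map h h.inv hz (h.map_mem_inv_source hz)).2]
  refine Params.map_eq_self h.isOpen (fun t ht => h.S_T ht) (fun t ht => ?_) ?_ ?_ ?_ ?_ ?_ ?_ hz.1
  · have h1 := (h.κ_pos ht).ne'
    simp only [Params.comp, Params.inv]
    rw [h.S_T ht]
    field_simp
    rw [h.ε_sq]; ring
  all_goals
    simp only [Params.comp, Params.inv]
    field_simp
    try simp only [Params.δ]
    ring

theorem Params.Valid.inv_κ (h : P.Valid) {t : ℝ} (ht : t ∈ P.I) :
    P.inv.κ (P.T t) = (P.κ t)⁻¹ := by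
  have h1 : deriv P.inv.T (P.T t) = (deriv P.T t)⁻¹ := (h.hasDerivAt_S ht).deriv
  rw [Params.κ, Params.κ, h.inv_δ, h1, ← Real.sqrt_inv]
  congr 1
  have := h.δ_ne_zero
  have := h.Tt_ne_zero ht
  field_simp

theorem Params.Valid.inv_map_mem_source (h : P.Valid) {z : Space9} (hz : z ∈ P.inv.source) :
    P.inv.map z ∈ P.source := by
  obtain ⟨⟨s, x, u⟩, ⟨a10, a11, a2, y0, y1, y2⟩⟩ := z
  obtain ⟨⟨t, ht, rfl⟩, hw⟩ := Params.mem_source.1 hz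
  have hδ := h.δ_ne_zero
  have hw0 : P.inv.w y1 ≠ 0 := right_ne_zero_of_mul hw.ne'
  rw [Params.map_apply]
  refine Params.mem_source.2 ⟨?_, ?_⟩
  · change P.S (P.T t) ∈ P.I
    rwa [h.S_T ht]
  · have h1 : P.w (P.inv.y1 y1) = 1 / P.inv.w y1 := by
      have e1 : P.w (P.inv.y1 y1) =
        P.c1 * ((P.c0 / P.δ * y1 + -P.c0' / P.δ) / P.inv.w y1) + P.c0 := rfl
      have e2 : P.inv.w y1 = -P.c1 / P.δ * y1 + P.c1' / P.δ := rfl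
      rw [e1]
      field_simp
      rw [e2]
      field_simp
      rw [Params.δ]; ring
    have h2 : P.ε * (1 / P.inv.w y1) = P.inv.ε * P.inv.w y1 / P.inv.w y1 ^ 2 := by
      change P.ε * _ = P.ε * _ / _
      field_simp
    rw [h1, h2]; positivity

theorem Params.Valid.map_inv_map (h : P.Valid) {z : Space9} (hz : z ∈ P.inv.source) :
    P.map (P.inv.map z) = z := by
  have hδ := h.δ_ne_zero
  rw [← (Params.map_map h.inv h hz (h.inv_map_mem_source hz)).2]
  refine Params.map_eq_self h.isOpen_image ?_ ?_ ?_ ?_ ?_ ?_ ?_ ?_ hz.1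
  · rintro _ ⟨t, ht, rfl⟩
    change P.T (P.S (P.T t)) = P.T t
    rw [h.S_T ht]
  · rintro _ ⟨t, ht, rfl⟩
    change P.inv.X (P.T t) + P.ε * P.inv.κ (P.T t) * P.X (P.S (P.T t)) / P.inv.δ = 0
    rw [h.S_T ht, h.inv_κ ht, h.inv_δ]
    simp only [Params.inv]
    rw [h.S_T ht]
    field_simp
    ring
  all_goals
    simp only [Params.comp, Params.inv]
    field_simp
    try simp only [Params.δ]
    ring

theorem Params.Valid.isOpen_source (h : P.Valid) : IsOpen P.source := by
  have h1 : IsOpen {z : Space9 | z.1.1 ∈ P.I} := h.isOpen.preimage (by fun_prop)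
  have h2 : IsOpen {z : Space9 | 0 < P.ε * (P.c1 * z.2.2.2.2.2.1 + P.c0)} :=
    isOpen_lt (by fun_prop) (by fun_prop)
  exact h1.inter h2

theorem Params.Valid.contDiffOn_map (h : P.Valid) : ContDiffOn ℝ ∞ P.map P.source := by
  have hm : ∀ {f : ℝ → ℝ}, ContDiffOn ℝ ∞ f P.I →
      ContDiffOn ℝ ∞ (fun z : Space9 => f z.1.1) P.source := fun hf =>
    hf.comp (g := _) (f := fun z : Space9 => z.1.1) (by fun_prop) fun z hz => hz.1
  have hT := hm h.smooth_T
  have hTt := hm h.smooth_deriv_T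
  have hTtt := hm h.smooth_deriv_deriv_T
  have hX := hm h.smooth_X
  have hXt := hm h.smooth_deriv_X
  have hw : ContDiffOn ℝ ∞ (fun z : Space9 => P.w z.2.2.2.2.2.1) P.source := by
    unfold Params.w; fun_prop
  have hw0 : ∀ z ∈ P.source, P.w z.2.2.2.2.2.1 ≠ 0 := fun z hz => right_ne_zero_of_mul hz.2.ne'
  have hT0 : ∀ z ∈ P.source, deriv P.T z.1.1 ≠ 0 := fun z hz => h.Tt_ne_zero hz.1
  have hx : ContDiffOn ℝ ∞ (fun z : Space9 => z.1.2.1) P.source := by fun_prop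
  have hu : ContDiffOn ℝ ∞ (fun z : Space9 => z.1.2.2) P.source := by fun_prop
  have ha10 : ContDiffOn ℝ ∞ (fun z : Space9 => z.2.1) P.source := by fun_prop
  have ha11 : ContDiffOn ℝ ∞ (fun z : Space9 => z.2.2.1) P.source := by fun_prop
  have ha2 : ContDiffOn ℝ ∞ (fun z : Space9 => z.2.2.2.1) P.source := by fun_prop
  have hy0 : ContDiffOn ℝ ∞ (fun z : Space9 => z.2.2.2.2.1) P.source := by fun_prop
  have hy1 : ContDiffOn ℝ ∞ (fun z : Space9 => z.2.2.2.2.2.1) P.source := by fun_prop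
  have hy2 : ContDiffOn ℝ ∞ (fun z : Space9 => z.2.2.2.2.2.2) P.source := by fun_prop
  have hc : ∀ c : ℝ, ContDiffOn ℝ ∞ (fun _ : Space9 => c) P.source := fun c => contDiffOn_const
  have hE := hy0.exp
  have hE2 := (hy0.div_const 2).exp
  have hEn := (hy0.neg.div_const 2).exp
  have hY1 : ContDiffOn ℝ ∞ (fun z : Space9 => P.y1 z.2.2.2.2.2.1) P.source :=
    (((hc P.c1').mul hy1).add (hc P.c0')).div hw hw0
  refine ContDiffOn.prodMk (ContDiffOn.prodMk hT (ContDiffOn.prodMk ?_ ?_))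
    (ContDiffOn.prodMk ?_ (ContDiffOn.prodMk ?_ (ContDiffOn.prodMk ?_ (ContDiffOn.prodMk ?_
      (ContDiffOn.prodMk hY1 ?_)))))
  · exact (hTt.mul hw).mul (hx.add (hEn.mul hX))
  · exact (((hw.mul hu).sub (((hc P.c1).mul hE).mul hx)).add (hc P.c2)).sub ((hc P.c1).mul hy2)
  · exact (((hw.mul ((ha10.sub ((((hc (1 / 2)).mul hEn).mul hX).mul ha11)).sub
      (hEn.mul hXt))).add (((hc P.c1).mul hE2).mul hX)).add (hc P.c2)).sub ((hc P.c1).mul hy2)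
  · exact ((hc 1).div hTt hT0).mul ((ha11.sub (hTtt.div hTt hT0)).sub
      (((hc (2 * P.c1)).mul hE).div hw hw0))
  · exact (hTt.mul (hw.pow 2)).mul ha2
  · exact hy0.add (((hc P.δ).div (hTt.mul (hw.pow 2)) fun z hz =>
      mul_ne_zero (hT0 z hz) (pow_ne_zero 2 (hw0 z hz))).log fun z hz =>
      div_ne_zero h.δ_ne_zero (mul_ne_zero (hT0 z hz) (pow_ne_zero 2 (hw0 z hz))))
  · exact (((((hc P.δ).mul hy2).div hw hw0).sub
      ((((hc P.δ).mul hX).mul hE2).div hw hw0)).add ((hc P.c2).mul hY1)).add (hc P.c3)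

theorem Params.Valid.exists_transformation (h : P.Valid) :
    ∃ Φ : OpenPartialHomeomorph Space9 Space9, IsTransformationWith Φ P := by
  let Φ : OpenPartialHomeomorph Space9 Space9 :=
    { toFun := P.map
      invFun := P.inv.map
      source := P.source
      target := P.inv.source
      map_source' := fun _ hz => h.map_mem_inv_source hz
      map_target' := fun _ hz => h.inv_map_mem_source hz
      left_inv' := fun _ hz => h.inv_map_map hz
      right_inv' := fun _ hz => h.map_inv_map hz
      open_source := h.isOpen_source
      open_target := h.inv.isOpen_source
      continuousOn_toFun := h.contDiffOn_map.continuousOn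
      continuousOn_invFun := h.inv.contDiffOn_map.continuousOn }
  exact ⟨Φ, ⟨h.contDiffOn_map, h.inv.contDiffOn_map⟩, rfl, fun _ _ => rfl⟩

/-- Φ is prescribed only on its source, so its target has to be recovered: both it and the source of
the inverse parameters are the image of `P.source` under `P.map`. -/
theorem IsTransformationWith.symm {Φ : OpenPartialHomeomorph Space9 Space9} (h : P.Valid)
    (hΦ : IsTransformationWith Φ P) : IsTransformationWith Φ.symm P.inv := by
  obtain ⟨hs, hsrc, heq⟩ := hΦ
  have hmem : ∀ z, z ∈ Φ.symm.source ↔ z ∈ P.inv.source := by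
    intro z
    constructor
    · intro hz
      have h1 : Φ.symm z ∈ P.source := hsrc ▸ Φ.map_target hz
      have h2 := h.map_mem_inv_source h1
      rwa [← heq h1, Φ.right_inv hz] at h2
    · intro hz
      have h1 := h.inv_map_mem_source hz
      have h2 := Φ.map_source (hsrc.symm ▸ h1)
      rwa [heq h1, h.map_inv_map hz] at h2
  refine ⟨⟨hs.2, by simpa using hs.1⟩, Set.ext hmem, fun z hz => ?_⟩
  have h1 := h.inv_map_mem_source hz
  have h2 := Φ.left_inv (hsrc.symm ▸ h1)
  rwa [heq h1, h.map_inv_map hz] at h2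

theorem refl_mem_breveG : OpenPartialHomeomorph.refl Space9 ∈ breveG := by
  let P : Params := ⟨univ, fun t => t, fun _ => 0, 1, 0, 0, 0, 0, 1, 1⟩
  have hsrc : P.source = univ := eq_univ_of_forall fun z => ⟨mem_univ _, by simp [P]⟩
  refine ⟨P, ⟨isOpen_univ, isPreconnected_univ, contDiffOn_id, contDiffOn_const, ?_, Or.inl rfl,
    hsrc ▸ univ_nonempty⟩, ⟨contDiffOn_id, contDiffOn_id⟩, hsrc.symm, fun z _ => ?_⟩
  · intro t _
    simp [P, Params.δ]
  · exact (Params.map_eq_self (R := P) isOpen_univ (fun _ _ => rfl) (fun _ _ => rfl) rfl rfl rfl rfl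
      rfl rfl (mem_univ _)).symm

theorem breveG_symm {Φ : OpenPartialHomeomorph Space9 Space9} (hΦ : Φ ∈ breveG) :
    Φ.symm ∈ breveG := by
  obtain ⟨P, hP, h⟩ := hΦ
  exact ⟨P.inv, hP.inv, h.symm hP⟩

theorem isLocalGroup_breveG : IsLocalGroup breveG := by
  refine ⟨refl_mem_breveG, fun _ => breveG_symm, ?_⟩
  rintro Φ ⟨P, hP, -, hΦs, hΦ⟩ Ψ ⟨Q, hQ, -, hΨs, hΨ⟩
  have key : ∀ z ∈ (Φ.trans Ψ).source, z ∈ (Q.comp P).source ∧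
      (Φ.trans Ψ) z = (Q.comp P).map z := by
    intro z hz
    rw [OpenPartialHomeomorph.trans_source] at hz
    obtain ⟨h1, h2⟩ := hz
    have h1' : z ∈ P.source := hΦs ▸ h1
    have h2' : P.map z ∈ Q.source := by
      rw [← hΦ h1', ← hΨs]; exact h2
    obtain ⟨h3, h4⟩ := Params.map_map hP hQ h1' h2'
    refine ⟨h3, ?_⟩
    rw [h4, OpenPartialHomeomorph.trans_apply, hΦ h1', hΨ h2']
  rcases (Φ.trans Ψ).source.eq_empty_or_nonempty with he | ⟨z, hz⟩
  -- A composition with empty natural domain agrees there with any element, in particular with the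
  -- identity.
  · exact ⟨_, refl_mem_breveG, he ▸ empty_subset _, he ▸ fun _ h => h.elim⟩
  · have hv := hP.comp hQ ⟨z, (key z hz).1⟩
    obtain ⟨Χ, hΧ⟩ := hv.exists_transformation
    refine ⟨Χ, ⟨_, hv, hΧ⟩, fun z hz => hΧ.2.1 ▸ (key z hz).1, fun z hz => ?_⟩
    rw [(key z hz).2, hΧ.2.2 (key z hz).1]

end Group

/-! ### Every equation of the subclass is represented by an extended tuple. -/

section Covering

theorem exists_primitive {I : Set ℝ} (hI : IsOpen I) (hc : IsPreconnected I) {f : ℝ → ℝ}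
    (hf : ContinuousOn f I) : ∃ F : ℝ → ℝ, ∀ t ∈ I, HasDerivAt F (f t) t := by
  obtain rfl | ⟨t₀, h₀⟩ := I.eq_empty_or_nonempty
  · exact ⟨fun _ => 0, by simp⟩
  refine ⟨fun t => ∫ s in t₀..t, f s, fun t ht => ?_⟩
  exact intervalIntegral.integral_hasDerivAt_right
    (hf.mono (hc.ordConnected.uIcc_subset h₀ ht)).intervalIntegrable
    (hf.stronglyMeasurableAtFilter hI t ht) (hf.continuousAt (hI.mem_nhds ht))

theorem contDiffOn_comp_fst {F : Type*} [NormedAddCommGroup F] [NormedSpace ℝ F] {S : Set (ℝ × F)}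
    {γ : ℝ → ℝ} (hγ : ContDiffOn ℝ ∞ γ (Prod.fst '' S)) :
    ContDiffOn ℝ ∞ (fun p : ℝ × F => γ p.1) S :=
  hγ.comp contDiffOn_fst fun _ hp => mem_image_of_mem _ hp

theorem dx_affine {S : Set (ℝ × ℝ)} (hS : IsOpen S) {α β : ℝ → ℝ}
    (hα : ContDiffOn ℝ ∞ α (Prod.fst '' S)) (hβ : ContDiffOn ℝ ∞ β (Prod.fst '' S)) {p : ℝ × ℝ}
    (hp : p ∈ S) : dx (fun p => α p.1 * p.2 + β p.1) p = α p.1 := by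
  have hd : ContDiffOn ℝ ∞ (fun p : ℝ × ℝ => α p.1 * p.2 + β p.1) S :=
    ((contDiffOn_comp_fst hα).mul contDiffOn_snd).add (contDiffOn_comp_fst hβ)
  refine (dx_eq_deriv ((hd.contDiffAt (hS.mem_nhds hp)).differentiableAt (by simp))).unique ?_
  simpa using ((hasDerivAt_id p.2).const_mul (α p.1)).add_const (β p.1)

theorem dx_dx_affine {S : Set (ℝ × ℝ)} (hS : IsOpen S) {α β : ℝ → ℝ}
    (hα : ContDiffOn ℝ ∞ α (Prod.fst '' S)) (hβ : ContDiffOn ℝ ∞ β (Prod.fst '' S)) {p : ℝ × ℝ}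
    (hp : p ∈ S) : dx (dx fun p => α p.1 * p.2 + β p.1) p = 0 := by
  have h1 : dx (dx fun p => α p.1 * p.2 + β p.1) p = dx (fun p => α p.1) p := by
    rw [dx, fderiv_apply_congr hS (fun z hz => dx_affine hS hα hβ hz) hp, dx]
  have h2 : DifferentiableAt ℝ (fun p : ℝ × ℝ => α p.1) p :=
    ((contDiffOn_comp_fst hα).contDiffAt (hS.mem_nhds hp)).differentiableAt (by simp)
  rw [h1]
  exact (dx_eq_deriv h2).unique (hasDerivAt_const p.2 (α p.1))

theorem eqn_mem_hatL0 {θ : ExtTuple} (h : θ ∈ barL0) : θ.eqn ∈ hatL0 := by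
  have hS := h.domain.isOpen
  exact ⟨⟨h.domain, ((contDiffOn_comp_fst h.smooth_A11).mul contDiffOn_snd).add
    (contDiffOn_comp_fst h.smooth_A10), h.smooth_A2, h.A2_ne_zero⟩,
    fun p hp => dx_dx_affine hS h.smooth_A11 h.smooth_A10 hp⟩

/-- Since A¹_xx = 0 and the fibres of the domain are connected, A¹_x depends on t alone, and then so
does A¹ - x A¹_x. The virtual elements are successive primitives, which exist globally because the
projection of the domain is an interval. -/
theorem exists_represents {E : Eqn} (hE : E ∈ hatL0) : ∃ θ ∈ barL0, Represents θ E := by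
  obtain ⟨⟨hdom, hA1, hA2, hA2'⟩, hxx⟩ := hE
  have hS := hdom.isOpen
  have hfib : ∀ (g : ℝ × ℝ → ℝ) (p : ℝ × ℝ), dx g p = 0 → ∀ y, fderiv ℝ g p (0, y) = 0 := by
    intro g p h y
    have : ((0, y) : ℝ × ℝ) = y • ((0, 1) : ℝ × ℝ) := by ext <;> simp
    rw [this, map_smul]
    change y • dx g p = 0
    rw [h, smul_zero]
  obtain ⟨α, hα, hαe, -⟩ := exists_eq_comp_fst hdom
    (contDiffOn_fderiv_apply hS hA1 (0, 1)) (fun z hz => hfib _ z (hxx z hz))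
  have hβs : ContDiffOn ℝ ∞ (fun p : ℝ × ℝ => E.A1 p - α p.1 * p.2) E.dom :=
    hA1.sub ((contDiffOn_comp_fst hα).mul contDiffOn_snd)
  obtain ⟨β, hβ, hβe, -⟩ := exists_eq_comp_fst hdom hβs (fun z hz => hfib _ z (by
    have hd : DifferentiableAt ℝ E.A1 z :=
      (hA1.contDiffAt (hS.mem_nhds hz)).differentiableAt (by simp)
    have h1 := (dx_eq_deriv hd).sub ((hasDerivAt_id z.2).const_mul (α z.1))
    refine (dx_eq_deriv ((hβs.contDiffAt (hS.mem_nhds hz)).differentiableAt (by simp))).unique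
      (h1.congr_deriv ?_)
    have := hαe z hz
    simp only [dx]
    rw [this]; ring))
  obtain ⟨Y0, hY0⟩ := exists_primitive hdom.isOpen_base hdom.connected_base hα.continuousOn
  have hY0s := contDiffOn_of_hasDerivAt hdom.isOpen_base hY0 hα
  obtain ⟨Y1, hY1⟩ := exists_primitive hdom.isOpen_base hdom.connected_base hY0s.exp.continuousOn
  obtain ⟨Y2, hY2⟩ := exists_primitive hdom.isOpen_base hdom.connected_base
    (hβ.mul hY0s.exp).continuousOn
  refine ⟨⟨E.dom, β, α, E.A2, Y0, Y1, Y2⟩, ⟨hdom, hβ, hα, hA2, hA2', hY0, hY1, hY2⟩, rfl, ?_,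
    fun _ _ => rfl⟩
  intro p hp
  have := hβe p hp
  change α p.1 * p.2 + β p.1 = E.A1 p
  linear_combination -this

theorem isCovering : IsCovering := ⟨fun _ => eqn_mem_hatL0, fun _ => exists_represents⟩

end Covering

/-! ### Fibrewise affine transformations and their action on solutions. -/

section FibreAffine

theorem IsFibredDomain.image_tx {S : Set Space3} (hS : IsFibredDomain S) :
    IsFibredDomain (tx '' S) where
  isOpen := by
    have : IsOpenMap (Prod.map id Prod.fst : ℝ × (ℝ × ℝ) → ℝ × ℝ) :=
      IsOpenMap.id.prodMap isOpenMap_fst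
    exact this _ hS.isOpen
  nonempty := hS.nonempty.image _
  connected_base := by
    have : Prod.fst '' (tx '' S) = Prod.fst '' S := by rw [image_image]; rfl
    rw [this]; exact hS.connected_base
  connected_fibre := fun t => by
    have : {y : ℝ | (t, y) ∈ tx '' S} = Prod.fst '' {y : ℝ × ℝ | (t, y) ∈ S} := by
      ext y
      constructor
      · rintro ⟨⟨t', x, u⟩, hz, h⟩
        obtain ⟨rfl, rfl⟩ := Prod.mk.injEq _ _ _ _ ▸ h
        exact ⟨(x, u), hz, rfl⟩
      · rintro ⟨⟨x, u⟩, hz, rfl⟩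
        exact ⟨(t, x, u), hz, rfl⟩
    rw [this]
    exact (hS.connected_fibre t).image _ continuous_fst.continuousOn

theorem fst_image_tx (S : Set Space3) : Prod.fst '' (tx '' S) = Prod.fst '' S := by
  rw [image_image]; rfl

/-- Point transformations that are affine along the fibres over the `t`-axis. -/
theorem exists_fibre_affine {Ω : Set Space3} (hΩ : IsFibredDomain Ω)
    (e : OpenPartialHomeomorph ℝ ℝ) (he : ContDiffOn ℝ ∞ e e.source)
    (he' : ContDiffOn ℝ ∞ e.symm e.target) (hsub : Prod.fst '' Ω ⊆ e.source)
    {a b w g h : ℝ → ℝ} (ha : ContDiffOn ℝ ∞ a (Prod.fst '' Ω))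
    (hb : ContDiffOn ℝ ∞ b (Prod.fst '' Ω)) (hw : ContDiffOn ℝ ∞ w (Prod.fst '' Ω))
    (hg : ContDiffOn ℝ ∞ g (Prod.fst '' Ω)) (hh : ContDiffOn ℝ ∞ h (Prod.fst '' Ω))
    (ha0 : ∀ t ∈ Prod.fst '' Ω, a t ≠ 0) (hw0 : ∀ t ∈ Prod.fst '' Ω, w t ≠ 0) :
    ∃ φ : OpenPartialHomeomorph Space3 Space3, φ.source = Ω ∧ IsPointTransformation φ ∧
      (∀ z, φ z = (e z.1, a z.1 * z.2.1 + b z.1, w z.1 * z.2.2 - g z.1 * z.2.1 + h z.1)) ∧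
      IsFibredDomain φ.target := by
  set I := Prod.fst '' Ω with hI
  let f : Space3 → Space3 := fun z =>
    (e z.1, a z.1 * z.2.1 + b z.1, w z.1 * z.2.2 - g z.1 * z.2.1 + h z.1)
  let k : Space3 → Space3 := fun y =>
    (e.symm y.1, (y.2.1 - b (e.symm y.1)) / a (e.symm y.1),
      (y.2.2 + g (e.symm y.1) * ((y.2.1 - b (e.symm y.1)) / a (e.symm y.1)) - h (e.symm y.1)) /
        w (e.symm y.1))
  let J : Set Space3 := {y | y.1 ∈ e '' I}
  have hJo : IsOpen J :=
    (e.isOpen_image_of_subset_source hΩ.isOpen_base hsub).preimage continuous_fst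
  have hmI : ∀ z ∈ Ω, z.1 ∈ I := fun z hz => mem_image_of_mem _ hz
  have hsymm : ∀ t ∈ I, e.symm (e t) = t := fun t ht => e.left_inv (hsub ht)
  have hf : ContDiffOn ℝ ∞ f Ω := by
    have c : ∀ {f : ℝ → ℝ}, ContDiffOn ℝ ∞ f I → ContDiffOn ℝ ∞ (fun z : Space3 => f z.1) Ω :=
      fun hf => contDiffOn_comp_fst hf
    have hx : ContDiffOn ℝ ∞ (fun z : Space3 => z.2.1) Ω := by fun_prop
    have hu : ContDiffOn ℝ ∞ (fun z : Space3 => z.2.2) Ω := by fun_prop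
    exact (c (he.mono hsub)).prodMk ((((c ha).mul hx).add (c hb)).prodMk
      ((((c hw).mul hu).sub ((c hg).mul hx)).add (c hh)))
  have hmJ : ∀ y ∈ J, e.symm y.1 ∈ I := by
    rintro ⟨_, y⟩ ⟨t, ht, rfl⟩
    change e.symm (e t) ∈ I
    rwa [hsymm t ht]
  have hk : ContDiffOn ℝ ∞ k J := by
    have hs : ContDiffOn ℝ ∞ (fun y : Space3 => e.symm y.1) J :=
      he'.comp contDiffOn_fst (by
        rintro ⟨_, y⟩ ⟨t, ht, rfl⟩
        exact e.map_source (hsub ht))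
    have c : ∀ {f : ℝ → ℝ}, ContDiffOn ℝ ∞ f I →
        ContDiffOn ℝ ∞ (fun z : Space3 => f (e.symm z.1)) J := fun hf => hf.comp hs hmJ
    have hx : ContDiffOn ℝ ∞ (fun z : Space3 => z.2.1) J := by fun_prop
    have hu : ContDiffOn ℝ ∞ (fun z : Space3 => z.2.2) J := by fun_prop
    have hX := (hx.sub (c hb)).div (c ha) fun y hy => ha0 _ (hmJ y hy)
    exact hs.prodMk (hX.prodMk (((hu.add ((c hg).mul hX)).sub (c hh)).div (c hw)
      fun y hy => hw0 _ (hmJ y hy)))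
  have hkf : ∀ z ∈ Ω, k (f z) = z := by
    rintro ⟨t, x, u⟩ hz
    have ht := hmI _ hz
    have h1 := ha0 _ ht
    have h2 := hw0 _ ht
    simp only at h1 h2 ht
    have hx : (a t * x + b t - b t) / a t = x := by field_simp; ring
    simp only [f, k, hsymm t ht, hx]
    refine Prod.ext rfl (Prod.ext rfl ?_)
    simp only
    field_simp
    ring
  have hfk : ∀ y ∈ J, f (k y) = y := by
    rintro ⟨_, x, u⟩ ⟨t, ht, rfl⟩
    have h1 := ha0 _ ht
    have h2 := hw0 _ ht
    simp only [f, k, hsymm t ht]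
    refine Prod.ext rfl (Prod.ext ?_ ?_)
    · simp only; field_simp; ring
    · simp only; field_simp; ring
  let φ : OpenPartialHomeomorph Space3 Space3 :=
    { toFun := f
      invFun := k
      source := Ω
      -- The explicit inverse k makes sense on the whole slab J; its preimage of Ω is exactly the
      -- image of Ω.
      target := J ∩ k ⁻¹' Ω
      map_source' := fun z hz => ⟨mem_image_of_mem _ (hmI z hz), by
        rw [mem_preimage, hkf z hz]; exact hz⟩
      map_target' := fun _ hy => hy.2
      left_inv' := hkf
      right_inv' := fun _ hy => hfk _ hy.1
      open_source := hΩ.isOpen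
      open_target := hk.continuousOn.isOpen_inter_preimage hJo hΩ.isOpen
      continuousOn_toFun := hf.continuousOn
      continuousOn_invFun := hk.continuousOn.mono inter_subset_left }
  have himg : φ.target = f '' Ω := φ.image_source_eq_target.symm
  refine ⟨φ, rfl, ⟨hf, hk.mono inter_subset_left⟩, fun _ => rfl, ?_⟩
  refine ⟨φ.open_target, himg ▸ hΩ.nonempty.image _, ?_, fun s => ?_⟩
  · have : Prod.fst '' φ.target = e '' I := by
      rw [himg, image_image, hI, image_image]
    rw [this]
    exact hΩ.connected_base.image _ (he.continuousOn.mono hsub)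
  · by_cases hs : s ∈ e '' I
    · obtain ⟨t, ht, rfl⟩ := hs
      have : {y : ℝ × ℝ | (e t, y) ∈ φ.target} =
          (fun y : ℝ × ℝ => (a t * y.1 + b t, w t * y.2 - g t * y.1 + h t)) ''
            {y : ℝ × ℝ | (t, y) ∈ Ω} := by
        rw [himg]
        ext y
        constructor
        · rintro ⟨⟨t', x, u⟩, hz, hfz⟩
          have h1 : e t' = e t := congrArg Prod.fst hfz
          have h2 : t' = t := e.injOn (hsub (hmI _ hz)) (hsub ht) h1
          subst h2
          exact ⟨(x, u), hz, congrArg Prod.snd hfz⟩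
        · rintro ⟨⟨x, u⟩, hz, rfl⟩
          exact ⟨(t, x, u), hz, rfl⟩
      rw [this]
      exact (hΩ.connected_fibre t).image _ (by fun_prop)
    · have : {y : ℝ × ℝ | (s, y) ∈ φ.target} = ∅ := by
        refine eq_empty_of_forall_notMem fun y hy => hs ?_
        have := hy
        rw [Set.mem_ofPred_eq, himg] at this
        obtain ⟨z, hz, hfz⟩ := this
        exact ⟨z.1, hmI z hz, congrArg Prod.fst hfz⟩
      rw [this]
      exact isPreconnected_empty

/-- The equality of functions `v'(T, a x + b) = w v - g x + h` relates the equations. -/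
theorem holdsAt_iff {E E' : Eqn} {T a b w g h : ℝ → ℝ} {t x T₁ a₁ b₁ α₀ α₁ α₀' α₁' : ℝ}
    (hT : HasDerivAt T T₁ t) (ha : HasDerivAt a a₁ t) (hb : HasDerivAt b b₁ t)
    (hw : HasDerivAt w (g t) t) (hg : HasDerivAt g (α₁ * g t) t)
    (hh : HasDerivAt h (-(α₀ * g t)) t) (haw : a t = T₁ * w t) (hT0 : T₁ ≠ 0) (hw0 : w t ≠ 0)
    (hA1 : E.A1 (t, x) = α₁ * x + α₀)
    (hA1' : E'.A1 (T t, a t * x + b t) = α₁' * (a t * x + b t) + α₀')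
    (hα₁ : α₁' * a t = α₁ * w t - a₁ / T₁ - g t)
    (hα₀ : α₁' * b t + α₀' = α₀ * w t - b₁ / T₁ + h t)
    (hA2 : E'.A2 (T t, a t * x + b t) = T₁ * w t ^ 2 * E.A2 (t, x)) {v v' : ℝ × ℝ → ℝ}
    (hv : ContDiffAt ℝ 2 v (t, x)) (hv' : ContDiffAt ℝ 2 v' (T t, a t * x + b t))
    (hrel : ∀ᶠ q : ℝ × ℝ in 𝓝 (t, x),
      v' (T q.1, a q.1 * q.2 + b q.1) = w q.1 * v q - g q.1 * q.2 + h q.1) :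
    E.HoldsAt v (t, x) ↔ E'.HoldsAt v' (T t, a t * x + b t) := by
  have hc : ContDiffAt ℝ 2 (fun τ : ℝ => ((t, x + τ) : ℝ × ℝ)) 0 := by fun_prop
  have hv0 : ContDiffAt ℝ 2 v ((fun τ : ℝ => ((t, x + τ) : ℝ × ℝ)) 0) := by simpa using hv
  have hv0' : ContDiffAt ℝ 2 v' ((fun τ : ℝ => ((T t, a t * (x + τ) + b t) : ℝ × ℝ)) 0) := by
    simpa using hv'
  have dc : ∀ τ, HasDerivAt (fun τ : ℝ => ((t, x + τ) : ℝ × ℝ)) (0, 1) τ := fun τ =>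
    (hasDerivAt_const τ t).prodMk ((hasDerivAt_id τ).const_add x)
  have dc' : ∀ τ, HasDerivAt (fun τ : ℝ => ((T t, a t * (x + τ) + b t) : ℝ × ℝ)) (0, a t) τ :=
    fun τ => (hasDerivAt_const τ (T t)).prodMk
      ((((hasDerivAt_id τ).const_add x).const_mul (a t)).add_const (b t) |>.congr_deriv (by simp))
  have ddc : deriv (fun τ : ℝ => ((t, x + τ) : ℝ × ℝ)) = fun _ => (0, 1) :=
    funext fun τ => (dc τ).deriv
  have ddc' : deriv (fun τ : ℝ => ((T t, a t * (x + τ) + b t) : ℝ × ℝ)) = fun _ => (0, a t) :=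
    funext fun τ => (dc' τ).deriv
  -- Along the line with fixed t, `k1` and `k2` express the derivatives of v by v_x and v_xx, while
  -- `m1` and `m2` express those of the transformed function by v'_x and v'_xx.
  obtain ⟨k1, k2⟩ := jet_chain (g := fun τ => ((t, x + τ) : ℝ × ℝ))
    (k := fun τ => v (t, x + τ)) hv0 hc (Eventually.of_forall fun _ => rfl)
  have hrel0 : ∀ᶠ τ in 𝓝 (0 : ℝ), v' (T t, a t * (x + τ) + b t) =
      w t * v (t, x + τ) - g t * (x + τ) + h t := by
    have hcont : ContinuousAt (fun τ : ℝ => ((t, x + τ) : ℝ × ℝ)) 0 := by fun_prop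
    exact hcont.eventually (by simpa using hrel)
  obtain ⟨m1, m2⟩ := jet_chain (g := fun τ => ((T t, a t * (x + τ) + b t) : ℝ × ℝ))
    (k := fun τ => w t * v (t, x + τ) - g t * (x + τ) + h t) hv0' (by fun_prop) hrel0
  rw [ddc] at k1 k2
  rw [ddc'] at m1 m2
  simp only [add_zero, deriv_const', mul_zero, zero_add, mul_one, one_pow, Prod.fst_zero,
    Prod.snd_zero, ne_eq, OfNat.ofNat_ne_zero, not_false_eq_true, zero_pow, zero_mul]
    at k1 k2 m1 m2
  have dk : ∀ᶠ τ in 𝓝 (0 : ℝ), deriv (fun τ => w t * v (t, x + τ) - g t * (x + τ) + h t) τ =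
      w t * deriv (fun τ => v (t, x + τ)) τ - g t := by
    have hvc : ContDiffAt ℝ 2 (fun τ => v (t, x + τ)) (0 : ℝ) := ContDiffAt.comp 0 hv0 hc
    filter_upwards [hvc.eventually (by simp)] with τ hτ
    have h1 := (hτ.differentiableAt (by norm_num)).hasDerivAt
    exact (((h1.const_mul (w t)).sub (((hasDerivAt_id τ).const_add x).const_mul (g t))).add_const
      (h t) |>.congr_deriv (by simp)).deriv
  have dd : DifferentiableAt ℝ (deriv fun τ => v (t, x + τ)) 0 := by
    have hvc : ContDiffAt ℝ 2 (fun τ => v (t, x + τ)) (0 : ℝ) := ContDiffAt.comp 0 hv0 hc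
    exact ((hvc.fderiv_right (m := 1) (by norm_num)).differentiableAt
      (by norm_num)).clm_apply (differentiableAt_const _)
  rw [dk.self_of_nhds, k1] at m1
  rw [EventuallyEq.deriv_eq dk, ((dd.hasDerivAt.const_mul (w t)).sub_const (g t)).deriv, k2] at m2
  -- the derivative with respect to `t`
  have hvd := hv.differentiableAt (by norm_num)
  have hvd' := hv'.differentiableAt (by norm_num)
  have n1 : HasDerivAt (fun τ => v' (T τ, a τ * x + b τ))
      (fderiv ℝ v' (T t, a t * x + b t) (T₁, a₁ * x + b₁)) t :=
    hvd'.hasFDerivAt.comp_hasDerivAt (x := t) (f := fun τ => (T τ, a τ * x + b τ))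
      (hT.prodMk ((ha.mul_const x).add hb))
  have n2 := (((hw.mul (dt_eq_deriv hvd)).sub (hg.mul_const x)).add hh)
  have hcont : ContinuousAt (fun τ : ℝ => ((τ, x) : ℝ × ℝ)) t := by fun_prop
  have n3 := n1.unique (n2.congr_of_eventuallyEq (hcont.eventually hrel))
  have n4 : fderiv ℝ v' (T t, a t * x + b t) (T₁, a₁ * x + b₁) =
      T₁ * dt v' (T t, a t * x + b t) + (a₁ * x + b₁) * dx v' (T t, a t * x + b t) := by
    have : ((T₁, a₁ * x + b₁) : ℝ × ℝ) = T₁ • ((1, 0) : ℝ × ℝ) + (a₁ * x + b₁) • ((0, 1) : ℝ × ℝ) := by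
      ext <;> simp
    rw [this, map_add, map_smul, map_smul]; rfl
  rw [n4] at n3
  simp only at n3
  have hval := hrel.self_of_nhds
  simp only at hval
  unfold Eqn.HoldsAt
  rw [hA1, hA1', hA2, hval]
  rw [haw] at *
  set D := dt v (t, x)
  set Q := dx v (t, x)
  set R := dx (dx v) (t, x)
  set D' := dt v' (T t, T₁ * w t * x + b t)
  set Q' := dx v' (T t, T₁ * w t * x + b t)
  set R' := dx (dx v') (T t, T₁ * w t * x + b t)
  have ha₁ : a₁ = T₁ * (α₁ * w t - g t - α₁' * (T₁ * w t)) := by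
    rw [hα₁]; field_simp; ring
  have hb₁ : b₁ = T₁ * (α₀ * w t + h t - (α₁' * b t + α₀')) := by
    rw [hα₀]; field_simp; ring
  have hm2 : R = T₁ ^ 2 * w t * R' := mul_left_cancel₀ hw0 (by linear_combination m2)
  -- The defects of the two equations are proportional: T_t times the target defect equals w times
  -- the source defect. Both factors are nonzero, so each equation implies the other.
  have key : T₁ * (D' + (w t * v (t, x) - g t * x + h t) * Q' -
      (T₁ * w t ^ 2 * E.A2 (t, x) * R' + (α₁' * (T₁ * w t * x + b t) + α₀') * Q')) =
      w t * (D + v (t, x) * Q - (E.A2 (t, x) * R + (α₁ * x + α₀) * Q)) := by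
    rw [ha₁, hb₁] at n3
    rw [hm2]
    linear_combination n3 - (v (t, x) - α₁ * x - α₀) * m1
  constructor
  · intro hE
    have : T₁ * (D' + (w t * v (t, x) - g t * x + h t) * Q' -
      (T₁ * w t ^ 2 * E.A2 (t, x) * R' + (α₁' * (T₁ * w t * x + b t) + α₀') * Q')) = 0 := by
      rw [key, hE]; ring
    exact sub_eq_zero.1 ((mul_eq_zero.1 this).resolve_left hT0)
  · intro hE
    rw [hE, sub_self, mul_zero] at key
    exact sub_eq_zero.1 ((mul_eq_zero.1 key.symm).resolve_left hw0)

end FibreAffine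

/-! ### The explicit transformations preserve the reparameterized class. -/

section Preservation

variable {P : Params} {θ : ExtTuple}

theorem InBarL0.smooth_Y0 (h : InBarL0 θ) : ContDiffOn ℝ ∞ θ.Y0 (Prod.fst '' θ.dom) :=
  contDiffOn_of_hasDerivAt h.domain.isOpen_base h.deriv_Y0 h.smooth_A11

theorem InBarL0.smooth_Y1 (h : InBarL0 θ) : ContDiffOn ℝ ∞ θ.Y1 (Prod.fst '' θ.dom) :=
  contDiffOn_of_hasDerivAt h.domain.isOpen_base h.deriv_Y1 h.smooth_Y0.exp

theorem InBarL0.smooth_Y2 (h : InBarL0 θ) : ContDiffOn ℝ ∞ θ.Y2 (Prod.fst '' θ.dom) :=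
  contDiffOn_of_hasDerivAt h.domain.isOpen_base h.deriv_Y2 (h.smooth_A10.mul h.smooth_Y0.exp)

theorem InBarL0.contact (h : InBarL0 θ) {t : ℝ} (ht : t ∈ Prod.fst '' θ.dom) :
    Contact (fun s => s) θ.Y0 θ.Y1 θ.Y2 1 (θ.A10 t) (θ.A11 t) t :=
  ⟨hasDerivAt_id t, by simpa using h.deriv_Y0 t ht, by simpa using h.deriv_Y1 t ht,
    by simpa using h.deriv_Y2 t ht⟩

theorem InBarL0.contact_comp (h : InBarL0 θ) {S : ℝ → ℝ} {s S₁ t : ℝ} (hS : HasDerivAt S S₁ s)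
    (hst : S s = t) (ht : t ∈ Prod.fst '' θ.dom) :
    Contact S (fun s => θ.Y0 (S s)) (fun s => θ.Y1 (S s)) (fun s => θ.Y2 (S s)) S₁ (θ.A10 t)
      (θ.A11 t) s := by
  subst hst
  exact ⟨hS, ((h.deriv_Y0 _ ht).comp s hS).congr_deriv (mul_comm _ _),
    ((h.deriv_Y1 _ ht).comp s hS).congr_deriv (mul_comm _ _),
    ((h.deriv_Y2 _ ht).comp s hS).congr_deriv (mul_comm _ _)⟩

/-- The coefficient of `x` in the `x`-component of the induced transformation. -/
noncomputable def Params.slope (P : Params) (θ : ExtTuple) (t : ℝ) : ℝ :=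
  deriv P.T t * P.w (θ.Y1 t)

/-- The free term in the `x`-component of the induced transformation. -/
noncomputable def Params.shift (P : Params) (θ : ExtTuple) (t : ℝ) : ℝ :=
  P.slope θ t * (Real.exp (-θ.Y0 t / 2) * P.X t)

/-- The image of an extended tuple over the domain `D`. -/
noncomputable def Params.image (P : Params) (θ : ExtTuple) (D : Set (ℝ × ℝ)) : ExtTuple where
  dom := D
  A10 := fun s => P.a10 (P.S s) (θ.A10 (P.S s)) (θ.A11 (P.S s)) (θ.Y0 (P.S s)) (θ.Y1 (P.S s))
    (θ.Y2 (P.S s))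
  A11 := fun s => P.a11 (P.S s) (θ.A11 (P.S s)) (θ.Y0 (P.S s)) (θ.Y1 (P.S s))
  A2 := fun q => deriv P.T (P.S q.1) * P.w (θ.Y1 (P.S q.1)) ^ 2 *
    θ.A2 (P.S q.1, (q.2 - P.shift θ (P.S q.1)) / P.slope θ (P.S q.1))
  Y0 := fun s => P.y0 (P.S s) (θ.Y0 (P.S s)) (θ.Y1 (P.S s))
  Y1 := fun s => P.y1 (θ.Y1 (P.S s))
  Y2 := fun s => P.y2 (P.S s) (θ.Y0 (P.S s)) (θ.Y1 (P.S s)) (θ.Y2 (P.S s))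

/-- The transformation with the parameters `P` is defined on the graph of `θ`. -/
def Params.Admits (P : Params) (θ : ExtTuple) : Prop :=
  ∀ t ∈ Prod.fst '' θ.dom, t ∈ P.I ∧ 0 < P.ε * P.w (θ.Y1 t)

theorem Params.Admits.subset (hA : P.Admits θ) : Prod.fst '' θ.dom ⊆ P.I := fun t ht => (hA t ht).1

theorem Params.Admits.w_ne_zero (hA : P.Admits θ) {t : ℝ} (ht : t ∈ Prod.fst '' θ.dom) :
    P.w (θ.Y1 t) ≠ 0 := right_ne_zero_of_mul (hA t ht).2.ne'

theorem Params.Admits.slope_ne_zero (hP : P.Valid) (hA : P.Admits θ) {t : ℝ}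
    (ht : t ∈ Prod.fst '' θ.dom) : P.slope θ t ≠ 0 :=
  mul_ne_zero (hP.Tt_ne_zero (hA.subset ht)) (hA.w_ne_zero ht)

theorem InBarL0.smooth_w (h : InBarL0 θ) :
    ContDiffOn ℝ ∞ (fun t => P.w (θ.Y1 t)) (Prod.fst '' θ.dom) :=
  (contDiffOn_const.mul h.smooth_Y1).add contDiffOn_const

theorem InBarL0.smooth_slope (h : InBarL0 θ) (hP : P.Valid) (hA : P.Admits θ) :
    ContDiffOn ℝ ∞ (P.slope θ) (Prod.fst '' θ.dom) :=
  (hP.smooth_deriv_T.mono hA.subset).mul h.smooth_w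

theorem InBarL0.smooth_shift (h : InBarL0 θ) (hP : P.Valid) (hA : P.Admits θ) :
    ContDiffOn ℝ ∞ (P.shift θ) (Prod.fst '' θ.dom) :=
  (h.smooth_slope hP hA).mul ((h.smooth_Y0.neg.div_const 2).exp.mul (hP.smooth_X.mono hA.subset))

theorem InBarL0.smooth_a11 (h : InBarL0 θ) (hP : P.Valid) (hA : P.Admits θ) :
    ContDiffOn ℝ ∞ (fun t => P.a11 t (θ.A11 t) (θ.Y0 t) (θ.Y1 t)) (Prod.fst '' θ.dom) := by
  have hT0 : ∀ t ∈ Prod.fst '' θ.dom, deriv P.T t ≠ 0 := fun t ht => hP.Tt_ne_zero (hA.subset ht)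
  have hT := hP.smooth_deriv_T.mono hA.subset
  exact (contDiffOn_const.div hT hT0).mul ((h.smooth_A11.sub
    ((hP.smooth_deriv_deriv_T.mono hA.subset).div hT hT0)).sub
    ((contDiffOn_const.mul h.smooth_Y0.exp).div h.smooth_w fun t ht => hA.w_ne_zero ht))

theorem InBarL0.smooth_a10 (h : InBarL0 θ) (hP : P.Valid) (hA : P.Admits θ) :
    ContDiffOn ℝ ∞ (fun t => P.a10 t (θ.A10 t) (θ.A11 t) (θ.Y0 t) (θ.Y1 t) (θ.Y2 t))
      (Prod.fst '' θ.dom) := by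
  have hX := hP.smooth_X.mono hA.subset
  have hX' := hP.smooth_deriv_X.mono hA.subset
  have hE := (h.smooth_Y0.div_const 2).exp
  have hE' := (h.smooth_Y0.neg.div_const 2).exp
  exact (((h.smooth_w.mul ((h.smooth_A10.sub (((contDiffOn_const.mul hE').mul hX).mul
    h.smooth_A11)).sub (hE'.mul hX'))).add ((contDiffOn_const.mul hE).mul hX)).add
    contDiffOn_const).sub (contDiffOn_const.mul h.smooth_Y2)

/-- The transformations preserve the reparameterized class. -/
theorem Params.Valid.image_mem_barL0 (hP : P.Valid) (h : InBarL0 θ) (hA : P.Admits θ)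
    {D : Set (ℝ × ℝ)} (hD : IsFibredDomain D)
    (hDθ : ∀ q ∈ D, ∃ p ∈ θ.dom, q = (P.T p.1, P.slope θ p.1 * p.2 + P.shift θ p.1)) :
    P.image θ D ∈ barL0 := by
  have hbase : ∀ s ∈ Prod.fst '' D, ∃ t ∈ Prod.fst '' θ.dom, s = P.T t := by
    rintro _ ⟨q, hq, rfl⟩
    obtain ⟨p, hp, rfl⟩ := hDθ q hq
    exact ⟨p.1, mem_image_of_mem _ hp, rfl⟩
  have hS_T : ∀ t ∈ Prod.fst '' θ.dom, P.S (P.T t) = t := fun t ht => hP.S_T (hA.subset ht)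
  have hSmaps : MapsTo P.S (Prod.fst '' D) (Prod.fst '' θ.dom) := by
    intro s hs
    obtain ⟨t, ht, rfl⟩ := hbase s hs
    rwa [hS_T t ht]
  have hSs : ContDiffOn ℝ ∞ P.S (Prod.fst '' D) := hP.smooth_S.mono fun s hs => by
    obtain ⟨t, ht, rfl⟩ := hbase s hs
    exact mem_image_of_mem _ (hA.subset ht)
  have hc : ∀ {f : ℝ → ℝ}, ContDiffOn ℝ ∞ f (Prod.fst '' θ.dom) →
      ContDiffOn ℝ ∞ (fun s => f (P.S s)) (Prod.fst '' D) := fun hf => hf.comp hSs hSmaps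
  have hcontact : ∀ s ∈ Prod.fst '' D, Contact (fun s => P.T (P.S s)) (P.image θ D).Y0
      (P.image θ D).Y1 (P.image θ D).Y2 1 ((P.image θ D).A10 s) ((P.image θ D).A11 s) s := by
    intro s hs
    obtain ⟨t, ht, rfl⟩ := hbase s hs
    -- The source tuple is followed along the inverse time change S, so after applying T the curve
    -- has unit speed in the new time, as `h2` records.
    have h1 := (h.contact_comp (hP.hasDerivAt_S (hA.subset ht)) (hS_T t ht) ht).map hP
      (by rw [hS_T t ht]; exact hA.subset ht) (by rw [hS_T t ht]; exact hA.w_ne_zero ht)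
    have h2 : (deriv P.T t)⁻¹ * deriv P.T (P.S (P.T t)) = 1 := by
      rw [hS_T t ht, inv_mul_cancel₀ (hP.Tt_ne_zero (hA.subset ht))]
    rw [h2] at h1
    have h3 := hS_T t ht
    have e10 : (P.image θ D).A10 (P.T t) = P.a10 (P.S (P.T t)) (θ.A10 t) (θ.A11 t)
        (θ.Y0 (P.S (P.T t))) (θ.Y1 (P.S (P.T t))) (θ.Y2 (P.S (P.T t))) := by
      simp only [Params.image, h3]
    have e11 : (P.image θ D).A11 (P.T t) = P.a11 (P.S (P.T t)) (θ.A11 t)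
        (θ.Y0 (P.S (P.T t))) (θ.Y1 (P.S (P.T t))) := by
      simp only [Params.image, h3]
    rw [e10, e11]
    exact h1
  refine ⟨hD, hc (h.smooth_a10 hP hA), hc (h.smooth_a11 hP hA), ?_, ?_, fun s hs => ?_,
    fun s hs => ?_, fun s hs => ?_⟩
  · have hT := contDiffOn_comp_fst (S := D) (hc (hP.smooth_deriv_T.mono hA.subset))
    have hw := contDiffOn_comp_fst (S := D) (hc (h.smooth_w (P := P)))
    have hb := contDiffOn_comp_fst (S := D) (hc (h.smooth_shift hP hA))
    have ha := contDiffOn_comp_fst (S := D) (hc (h.smooth_slope hP hA))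
    refine (hT.mul (hw.pow 2)).mul (h.smooth_A2.comp ((contDiffOn_comp_fst hSs).prodMk
      ((contDiffOn_snd.sub hb).div ha fun q hq =>
        hA.slope_ne_zero hP (hSmaps (mem_image_of_mem _ hq)))) fun q hq => ?_)
    obtain ⟨p, hp, rfl⟩ := hDθ q hq
    have hp' := mem_image_of_mem Prod.fst hp
    have ha := hA.slope_ne_zero hP hp'
    simp only [hS_T _ hp']
    convert hp using 1
    refine Prod.ext rfl ?_
    simp only
    field_simp; ring
  · rintro q hq
    obtain ⟨p, hp, rfl⟩ := hDθ q hq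
    have hp' := mem_image_of_mem Prod.fst hp
    have ha := hA.slope_ne_zero hP hp'
    have hx : (P.slope θ p.1 * p.2 + P.shift θ p.1 - P.shift θ p.1) / P.slope θ p.1 = p.2 := by
      field_simp; ring
    simp only [Params.image, hS_T _ hp', hx]
    have := h.A2_ne_zero p hp
    exact mul_ne_zero (mul_ne_zero (hP.Tt_ne_zero (hA.subset hp'))
      (pow_ne_zero 2 (hA.w_ne_zero hp'))) this
  · simpa using (hcontact s hs).deriv_Y0
  · simpa using (hcontact s hs).deriv_Y1
  · simpa using (hcontact s hs).deriv_Y2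

/-- Substituting a tuple makes Φ affine on the fibres t = const, with coefficients built from the
Y's. The identities w_t = g, g_t = A¹¹ g and h_t = -A¹⁰ g needed by `holdsAt_iff` are the auxiliary
system for Y⁰, Y¹, Y² with g = c₁ exp Y⁰ and h = c₂ - c₁ Y². -/
theorem preserves_of_mem_breveG {Φ : OpenPartialHomeomorph Space9 Space9} (hΦ : Φ ∈ breveG) :
    Preserves Φ := by
  obtain ⟨P, hP, -, hsrc, hmap⟩ := hΦ
  intro θ hθ Ω hΩ hΩθ hgraph
  have h : InBarL0 θ := hθ
  have hbase : Prod.fst '' θ.dom = Prod.fst '' Ω := by rw [← hΩθ, fst_image_tx]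
  have hA : P.Admits θ := by
    intro t ht
    rw [hbase] at ht
    obtain ⟨z, hz, rfl⟩ := ht
    have := hgraph z hz
    rw [hsrc] at this
    exact ⟨this.1, this.2⟩
  have hI : ∀ z ∈ Ω, z.1 ∈ Prod.fst '' θ.dom := fun z hz => hbase ▸ mem_image_of_mem _ hz
  obtain ⟨φ, hφs, hφ, hφe, hφt⟩ := exists_fibre_affine hΩ hP.timeHomeo hP.smooth_T hP.smooth_S
    (hbase ▸ hA.subset) (hbase ▸ h.smooth_slope hP hA) (hbase ▸ h.smooth_shift hP hA)
    (hbase ▸ h.smooth_w (P := P)) (g := fun t => P.c1 * Real.exp (θ.Y0 t))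
    (h := fun t => P.c2 - P.c1 * θ.Y2 t)
    (hbase ▸ contDiffOn_const.mul h.smooth_Y0.exp)
    (hbase ▸ contDiffOn_const.sub (contDiffOn_const.mul h.smooth_Y2))
    (fun t ht => hA.slope_ne_zero hP (hbase ▸ ht)) (fun t ht => hA.w_ne_zero (hbase ▸ ht))
  have hφe' : ∀ z, φ z = (P.T z.1, P.slope θ z.1 * z.2.1 + P.shift θ z.1,
    P.w (θ.Y1 z.1) * z.2.2 - P.c1 * Real.exp (θ.Y0 z.1) * z.2.1 + (P.c2 - P.c1 * θ.Y2 z.1)) := hφe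
  have htx : ∀ z, tx (φ z) = (P.T z.1, P.slope θ z.1 * z.2.1 + P.shift θ z.1) := fun z => by
    rw [hφe']; rfl
  have hbar : P.image θ (tx '' φ.target) ∈ barL0 := by
    refine hP.image_mem_barL0 h hA hφt.image_tx ?_
    rintro _ ⟨y, hy, rfl⟩
    rw [← φ.image_source_eq_target, hφs] at hy
    obtain ⟨z, hz, rfl⟩ := hy
    exact ⟨tx z, hΩθ ▸ mem_image_of_mem _ hz, htx z⟩
  refine ⟨φ, P.image θ (tx '' φ.target), hφs, ⟨hθ, hbar, hφ, ⟨hφs ▸ hΩ, hφt, hφs ▸ hΩθ, rfl, ?_⟩⟩,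
    ?_⟩
  · intro p v v' hp hv hv' hrel _
    rw [hφs] at hp
    have ht : p.1 ∈ Prod.fst '' θ.dom := hI _ hp
    have htI := hA.subset ht
    have hT0 := hP.Tt_ne_zero htI
    have hw0 := hA.w_ne_zero ht
    have hsl := hA.slope_ne_zero hP ht
    have dw : HasDerivAt (fun t => P.w (θ.Y1 t)) (P.c1 * Real.exp (θ.Y0 p.1)) p.1 :=
      ((h.deriv_Y1 _ ht).const_mul P.c1).add_const P.c0
    have dsl := (hP.hasDerivAt_deriv_T htI).mul dw
    have dE : HasDerivAt (fun t => Real.exp (-θ.Y0 t / 2))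
        (Real.exp (-θ.Y0 p.1 / 2) * (-θ.A11 p.1 / 2)) p.1 :=
      ((h.deriv_Y0 _ ht).neg.div_const 2).exp
    have dsh := dsl.mul (dE.mul (hP.hasDerivAt_X htI))
    have dg : HasDerivAt (fun t => P.c1 * Real.exp (θ.Y0 t))
        (θ.A11 p.1 * (P.c1 * Real.exp (θ.Y0 p.1))) p.1 :=
      (((h.deriv_Y0 _ ht).exp).const_mul P.c1).congr_deriv (by ring)
    have dh : HasDerivAt (fun t => P.c2 - P.c1 * θ.Y2 t)
        (-(θ.A10 p.1 * (P.c1 * Real.exp (θ.Y0 p.1)))) p.1 :=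
      (((h.deriv_Y2 _ ht).const_mul P.c1).const_sub P.c2).congr_deriv (by ring)
    simp only [hφe', tx] at hrel hv' ⊢
    have hEE : Real.exp (θ.Y0 p.1) * Real.exp (-θ.Y0 p.1 / 2) = Real.exp (θ.Y0 p.1 / 2) := by
      rw [← Real.exp_add]; congr 1; ring
    refine holdsAt_iff (a := P.slope θ) (b := P.shift θ) (w := fun t => P.w (θ.Y1 t))
      (g := fun t => P.c1 * Real.exp (θ.Y0 t)) (h := fun t => P.c2 - P.c1 * θ.Y2 t)
      (α₀ := θ.A10 p.1) (α₁ := θ.A11 p.1)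
      (α₀' := P.a10 p.1 (θ.A10 p.1) (θ.A11 p.1) (θ.Y0 p.1) (θ.Y1 p.1) (θ.Y2 p.1))
      (α₁' := P.a11 p.1 (θ.A11 p.1) (θ.Y0 p.1) (θ.Y1 p.1))
      (hP.hasDerivAt_T htI) dsl dsh dw dg dh rfl hT0 hw0 rfl ?_ ?_ ?_ ?_ hv hv' hrel
    · simp only [ExtTuple.eqn, Params.image, hP.S_T htI]
    · simp only [Params.slope, Params.a11]
      field_simp
      ring
    · simp only [Params.shift, Params.slope, Params.a11, Params.a10, Pi.mul_apply, ← hEE]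
      field_simp
      ring
    · have hx : (P.slope θ p.1 * p.2 + P.shift θ p.1 - P.shift θ p.1) / P.slope θ p.1 = p.2 := by
        field_simp; ring
      simp only [ExtTuple.eqn, Params.image, hP.S_T htI, hx]
  · intro z hz
    rw [hφs] at hz
    have ht := hI z hz
    have htI := hA.subset ht
    have hsl := hA.slope_ne_zero hP ht
    have hg := hgraph z hz
    refine ⟨hg, ?_⟩
    rw [hsrc] at hg
    rw [hmap hg, htx, hφe']
    obtain ⟨t, x, u⟩ := z
    have hx : (P.slope θ t * x + P.shift θ t - P.shift θ t) / P.slope θ t = x := by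
      field_simp; ring
    simp only [ExtTuple.val, tx, Params.map_apply, Params.image, hP.S_T htI, hx]
    refine Prod.ext (Prod.ext rfl (Prod.ext ?_ ?_)) rfl
    · simp only [Params.x, Params.slope, Params.shift]; ring
    · simp only [Params.u]; ring

theorem breveG_subset_barG : breveG ⊆ barG := fun _ hΦ =>
  ⟨let ⟨_, _, h⟩ := hΦ; h.1, preserves_of_mem_breveG hΦ, preserves_of_mem_breveG (breveG_symm hΦ)⟩

end Preservation

/-! ### The canonical form of admissible transformations. -/

section CanonicalForm

variable {E E' : Eqn} {φ : OpenPartialHomeomorph Space3 Space3} {θ θ' : ExtTuple}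

theorem fderiv_sub_affine {g : Space3 → ℝ} {α β : ℝ → ℝ} {α' β' : ℝ} {z : Space3}
    (hg : DifferentiableAt ℝ g z) (hα : HasDerivAt α α' z.1) (hβ : HasDerivAt β β' z.1)
    (e₁ e₂ e₃ : ℝ) :
    fderiv ℝ (fun z : Space3 => g z - α z.1 * z.2.2 - β z.1 * z.2.1) z (e₁, e₂, e₃) =
      fderiv ℝ g z (e₁, e₂, e₃) - (α' * e₁ * z.2.2 + α z.1 * e₃) -
        (β' * e₁ * z.2.1 + β z.1 * e₂) := by
  have f1 : HasFDerivAt (fun z : Space3 => α z.1) (α' • ContinuousLinearMap.fst ℝ ℝ (ℝ × ℝ)) z :=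
    hα.comp_hasFDerivAt z hasFDerivAt_fst
  have f2 : HasFDerivAt (fun z : Space3 => β z.1) (β' • ContinuousLinearMap.fst ℝ ℝ (ℝ × ℝ)) z :=
    hβ.comp_hasFDerivAt z hasFDerivAt_fst
  have fx : HasFDerivAt (fun z : Space3 => z.2.1)
      ((ContinuousLinearMap.fst ℝ ℝ ℝ).comp (ContinuousLinearMap.snd ℝ ℝ (ℝ × ℝ))) z :=
    ((ContinuousLinearMap.fst ℝ ℝ ℝ).comp (ContinuousLinearMap.snd ℝ ℝ (ℝ × ℝ))).hasFDerivAt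
  have fu : HasFDerivAt (fun z : Space3 => z.2.2)
      ((ContinuousLinearMap.snd ℝ ℝ ℝ).comp (ContinuousLinearMap.snd ℝ ℝ (ℝ × ℝ))) z :=
    ((ContinuousLinearMap.snd ℝ ℝ ℝ).comp (ContinuousLinearMap.snd ℝ ℝ (ℝ × ℝ))).hasFDerivAt
  have h := (hg.hasFDerivAt.sub (f1.mul fu)).sub (f2.mul fx)
  refine (congrArg (fun L : Space3 →L[ℝ] ℝ => L (e₁, e₂, e₃)) h.fderiv).trans ?_
  simp
  ring

/-- Splitting with respect to x: the fibre over t is open, so it contains two points with different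
x. -/
theorem eq_zero_of_affine_on_fibre {S : Set Space3} (hS : IsOpen S) {t : ℝ}
    (ht : t ∈ Prod.fst '' S) {α β : ℝ} (h : ∀ z ∈ S, z.1 = t → α * z.2.1 + β = 0) :
    α = 0 ∧ β = 0 := by
  obtain ⟨z, hz, rfl⟩ := ht
  obtain ⟨ε, hε, hm⟩ := eventually_line_mem hS hz (0, 1, 0)
  have h1 := h z hz rfl
  have h2 := h _ (hm (ε / 2) ⟨by linarith, by linarith⟩) (by simp)
  simp only [Prod.snd_add, Prod.fst_add, Prod.smul_snd, Prod.smul_fst, smul_eq_mul, mul_one] at h2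
  have h3 : ε * α = 0 := by linear_combination 2 * h2 - 2 * h1
  have h4 : α = 0 := (mul_eq_zero.1 h3).resolve_left hε.ne'
  exact ⟨h4, by rw [h4] at h1; linarith⟩

/-- The form of admissible transformations. -/
structure CanonicalForm (θ θ' : ExtTuple) (φ : OpenPartialHomeomorph Space3 Space3)
    (T w G h b : ℝ → ℝ) : Prop where
  smooth_T : ContDiffOn ℝ ∞ T (Prod.fst '' φ.source)
  smooth_w : ContDiffOn ℝ ∞ w (Prod.fst '' φ.source)
  smooth_b : ContDiffOn ℝ ∞ b (Prod.fst '' φ.source)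
  apply : ∀ z ∈ φ.source, φ z = (T z.1, deriv T z.1 * w z.1 * z.2.1 + b z.1,
    w z.1 * z.2.2 + G z.1 * z.2.1 + h z.1)
  A2 : ∀ z ∈ φ.source, θ'.A2 (tx (φ z)) = deriv T z.1 * w z.1 ^ 2 * θ.A2 (tx z)
  Tt_ne_zero : ∀ t ∈ Prod.fst '' φ.source, deriv T t ≠ 0
  w_ne_zero : ∀ t ∈ Prod.fst '' φ.source, w t ≠ 0
  deriv_w : ∀ t ∈ Prod.fst '' φ.source, HasDerivAt w (-G t) t
  deriv_G : ∀ t ∈ Prod.fst '' φ.source, HasDerivAt G (θ.A11 t * G t) t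
  deriv_h : ∀ t ∈ Prod.fst '' φ.source, HasDerivAt h (θ.A10 t * G t) t
  A11 : ∀ t ∈ Prod.fst '' φ.source, θ.A11 t * (deriv T t * w t) - deriv (deriv T) t * w t +
    2 * deriv T t * G t - deriv T t * (θ'.A11 (T t) * (deriv T t * w t)) = 0
  A10 : ∀ t ∈ Prod.fst '' φ.source, θ.A10 t * (deriv T t * w t) - deriv b t +
    deriv T t * (h t - θ'.A11 (T t) * b t - θ'.A10 (T t)) = 0

/-- By the determining equations T, U_u, U_x and X_x have no x- or u-derivative, and neither do the
remainders of U and X after subtracting their affine parts. All of these descend to functions of t,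
the fibres being connected. The relations for U_t and A¹ are then affine in x, as A¹ is, and their
coefficients vanish separately. -/
theorem Connects.exists_canonicalForm (hφ : IsPointTransformation φ) (hc : Connects E φ E')
    (hE : E ∈ hatL0) (hE' : E' ∈ hatL0) (hR : Represents θ E) (hR' : Represents θ' E') :
    ∃ T w G h b : ℝ → ℝ, CanonicalForm θ θ' φ T w G h b := by
  have hS := hc.source_domain
  have hSo := φ.open_source
  have hIo := hS.isOpen_base
  have hdet := fun z hz => hc.determiningEquations hφ hE hE' (z := z) hz
  obtain ⟨hTs, hXs, hUs⟩ := hφ.comp_contDiffOn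
  have sm := fun {g : Space3 → ℝ} (hg : ContDiffOn ℝ ∞ g φ.source) e => contDiffOn_pd hSo hg e
  have hd : ∀ {g : Space3 → ℝ}, ContDiffOn ℝ ∞ g φ.source → ∀ z ∈ φ.source,
      DifferentiableAt ℝ g z := fun hg z hz =>
    (hg.contDiffAt (hSo.mem_nhds hz)).differentiableAt (by simp)
  have descend : ∀ {g : Space3 → ℝ}, ContDiffOn ℝ ∞ g φ.source →
      (∀ z ∈ φ.source, px g z = 0) → (∀ z ∈ φ.source, pu g z = 0) →
      ∃ γ : ℝ → ℝ, ContDiffOn ℝ ∞ γ (Prod.fst '' φ.source) ∧ (∀ z ∈ φ.source, g z = γ z.1) ∧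
      ∀ z ∈ φ.source, HasDerivAt γ (pt g z) z.1 := by
    intro g hg h1 h2
    refine exists_eq_comp_fst hS hg fun z hz y => ?_
    obtain ⟨y1, y2⟩ := y
    rw [fderiv_eq_pd, h1 z hz, h2 z hz]; ring
  obtain ⟨T, hT, hTe, hTd⟩ := descend hTs (fun z hz => (hdet z hz).Tx) (fun z hz => (hdet z hz).Tu)
  obtain ⟨w, hw, hwe, hwd⟩ := descend (sm hUs (0, 0, 1)) (fun z hz => (hdet z hz).Uux)
    (fun z hz => (hdet z hz).Uuu)
  obtain ⟨G, hG, hGe, hGd⟩ := descend (sm hUs (0, 1, 0)) (fun z hz => (hdet z hz).Uxx)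
    (fun z hz => (pd_comm hSo hUs hz _ _).trans (hdet z hz).Uux)
  obtain ⟨a, ha, hae, had⟩ := descend (sm hXs (0, 1, 0)) (fun z hz => (hdet z hz).Xxx)
    (fun z hz => pd_pd_zero hSo hXs (fun z hz => (hdet z hz).Xu) hz _)
  replace hwe : ∀ z ∈ φ.source, pu (compU φ) z = w z.1 := hwe
  replace hGe : ∀ z ∈ φ.source, px (compU φ) z = G z.1 := hGe
  replace hae : ∀ z ∈ φ.source, px (compX φ) z = a z.1 := hae
  replace hwd : ∀ z ∈ φ.source, HasDerivAt w (pt (pu (compU φ)) z) z.1 := hwd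
  replace hGd : ∀ z ∈ φ.source, HasDerivAt G (pt (px (compU φ)) z) z.1 := hGd
  replace had : ∀ z ∈ φ.source, HasDerivAt a (pt (px (compX φ)) z) z.1 := had
  have zx : ∀ g z, px g z = fderiv ℝ g z (0, 1, 0) := fun _ _ => rfl
  have zu : ∀ g z, pu g z = fderiv ℝ g z (0, 0, 1) := fun _ _ => rfl
  have zt : ∀ g z, pt g z = fderiv ℝ g z (1, 0, 0) := fun _ _ => rfl
  have hxs : ContDiffOn ℝ ∞ (fun z : Space3 => z.2.1) φ.source := by fun_prop
  have hus : ContDiffOn ℝ ∞ (fun z : Space3 => z.2.2) φ.source := by fun_prop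
  have hHd := fun z hz => fderiv_sub_affine (hd hUs z hz) (hwd z hz) (hGd z hz)
  obtain ⟨h, hh, hhe, hhd⟩ := descend (g := fun z => compU φ z - w z.1 * z.2.2 - G z.1 * z.2.1)
    ((hUs.sub ((contDiffOn_comp_fst hw).mul hus)).sub ((contDiffOn_comp_fst hG).mul hxs))
    (fun z hz => by rw [zx, hHd z hz, ← zx, ← hGe z hz]; ring)
    (fun z hz => by rw [zu, hHd z hz, ← zu, ← hwe z hz]; ring)
  -- X has no u-term, so the lemma used for U applies with zero coefficient of u.
  have hBd := fun z hz => fderiv_sub_affine (hd hXs z hz) (hasDerivAt_const z.1 0) (had z hz)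
  obtain ⟨b, hb, hbe, hbd⟩ := descend (g := fun z => compX φ z - 0 * z.2.2 - a z.1 * z.2.1)
    ((hXs.sub (contDiffOn_const.mul hus)).sub ((contDiffOn_comp_fst ha).mul hxs))
    (fun z hz => by rw [zx, hBd z hz, ← zx, ← hae z hz]; ring)
    (fun z hz => by rw [zu, hBd z hz, ← zu, (hdet z hz).Xu]; ring)
  have hT' : ∀ z ∈ φ.source, deriv T z.1 = pt (compT φ) z := fun z hz => (hTd z hz).deriv
  have haw : ∀ z ∈ φ.source, a z.1 = deriv T z.1 * w z.1 := fun z hz => by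
    rw [← hae z hz, hT' z hz, ← hwe z hz, (hdet z hz).Uu]
  have hwG : ∀ z ∈ φ.source, pt (pu (compU φ)) z = -G z.1 := fun z hz => by
    have := (hdet z hz).Ux
    rw [← hGe z hz]
    linear_combination this
  have hw' : ∀ t ∈ Prod.fst '' φ.source, HasDerivAt w (-G t) t := by
    rintro _ ⟨z, hz, rfl⟩
    rw [← hwG z hz]; exact hwd z hz
  have hA1 : ∀ z ∈ φ.source, E.A1 (tx z) = θ.A11 z.1 * z.2.1 + θ.A10 z.1 := fun z hz =>
    (hR.2.1 (hc.source_over ▸ mem_image_of_mem _ hz)).symm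
  have hA1' : ∀ z ∈ φ.source, E'.A1 (tx (φ z)) =
      θ'.A11 (T z.1) * (a z.1 * z.2.1 + b z.1) + θ'.A10 (T z.1) := fun z hz => by
    have h1 := (hR'.2.1 (hc.target_over ▸ mem_image_of_mem _ (φ.map_source hz))).symm
    have h2 : (φ z).1 = T z.1 := hTe z hz
    have h3 : (φ z).2.1 = a z.1 * z.2.1 + b z.1 := by
      rw [← hbe z hz]; simp only [compX]; ring
    rw [h1]
    simp only [ExtTuple.eqn, tx, h2, h3]
  have hU : ∀ z ∈ φ.source, compU φ z = w z.1 * z.2.2 + G z.1 * z.2.1 + h z.1 := fun z hz => by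
    rw [← hhe z hz]; ring
  have hGh : ∀ t ∈ Prod.fst '' φ.source, HasDerivAt G (θ.A11 t * G t) t ∧
      HasDerivAt h (θ.A10 t * G t) t := by
    rintro t ht
    have dG : HasDerivAt G (deriv G t) t :=
      ((hG.contDiffAt (hIo.mem_nhds ht)).differentiableAt (by simp)).hasDerivAt
    have dh : HasDerivAt h (deriv h t) t :=
      ((hh.contDiffAt (hIo.mem_nhds ht)).differentiableAt (by simp)).hasDerivAt
    -- In U_t = (A¹ - u) U_x the terms with u cancel because w_t = -G, leaving a relation affine in
    -- x.
    obtain ⟨e1, e2⟩ := eq_zero_of_affine_on_fibre hSo ht (α := deriv G t - θ.A11 t * G t)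
      (β := deriv h t - θ.A10 t * G t) (by
        rintro z hz rfl
        have h1 := (hhd z hz).deriv
        rw [zt, hHd z hz, ← zt, hwG z hz, ← (hGd z hz).deriv] at h1
        have h2 := (hdet z hz).Ut
        rw [hA1 z hz, hGe z hz] at h2
        linear_combination h1 + h2)
    refine ⟨dG.congr_deriv (by linear_combination e1), dh.congr_deriv (by linear_combination e2)⟩
  have hAA : ∀ t ∈ Prod.fst '' φ.source, θ.A11 t * (deriv T t * w t) - deriv (deriv T) t * w t +
      2 * deriv T t * G t - deriv T t * (θ'.A11 (T t) * (deriv T t * w t)) = 0 ∧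
      θ.A10 t * (deriv T t * w t) - deriv b t +
        deriv T t * (h t - θ'.A11 (T t) * b t - θ'.A10 (T t)) = 0 := by
    intro t ht
    have dT : HasDerivAt (deriv T) (deriv (deriv T) t) t :=
      ((((contDiffOn_infty_iff_deriv_of_isOpen hIo).1 hT).2.contDiffAt
        (hIo.mem_nhds ht)).differentiableAt (by simp)).hasDerivAt
    have da := dT.mul (hw' t ht)
    refine eq_zero_of_affine_on_fibre hSo ht ?_
    rintro z hz rfl
    have ea : a =ᶠ[𝓝 z.1] fun t => deriv T t * w t := by
      filter_upwards [hIo.mem_nhds ht] with s hs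
      obtain ⟨y, hy, rfl⟩ := hs
      exact haw y hy
    have h0 := (had z hz).unique (da.congr_of_eventuallyEq ea)
    have h1 := (hbd z hz).deriv
    rw [zt, hBd z hz, ← zt, h0] at h1
    have h2 := (hdet z hz).A1
    rw [hA1 z hz, hA1' z hz, hU z hz, ← hT' z hz, hae z hz, haw z hz] at h2
    linear_combination h2 - h1
  refine ⟨T, w, G, h, b, hT, hw, hb, fun z hz => ?_, fun z hz => ?_, ?_, ?_, hw',
    fun t ht => (hGh t ht).1, fun t ht => (hGh t ht).2, fun t ht => (hAA t ht).1,
    fun t ht => (hAA t ht).2⟩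
  · refine Prod.ext (hTe z hz) (Prod.ext ?_ (hU z hz))
    simp only
    rw [← haw z hz, ← hbe z hz]
    simp only [compX]; ring
  · have h1 := (hdet z hz).A2
    rw [← hT' z hz, hae z hz, haw z hz,
      ← hR.2.2 (hc.source_over ▸ mem_image_of_mem _ hz : tx z ∈ E.dom),
      ← hR'.2.2 (hc.target_over ▸ mem_image_of_mem _ (φ.map_source hz) : tx (φ z) ∈ E'.dom)] at h1
    have h2 : deriv T z.1 ≠ 0 := by rw [hT' z hz]; exact (hdet z hz).Tt
    exact mul_right_cancel₀ h2 (by linear_combination h1)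
  · rintro _ ⟨z, hz, rfl⟩
    rw [hT' z hz]; exact (hdet z hz).Tt
  · rintro _ ⟨z, hz, rfl⟩
    rw [← hwe z hz]; exact (hdet z hz).Uu_ne

end CanonicalForm

/-! ### Integrating the canonical form and generating the groupoid. -/

section Generation

variable {φ : OpenPartialHomeomorph Space3 Space3} {θ θ' : ExtTuple} {T w G h b : ℝ → ℝ}

theorem exists_const_sign {I : Set ℝ} (hI : IsPreconnected I) {w : ℝ → ℝ}
    (hw : ContinuousOn w I) (h0 : ∀ t ∈ I, w t ≠ 0) :
    ∃ ε : ℝ, (ε = 1 ∨ ε = -1) ∧ ∀ t ∈ I, 0 < ε * w t := by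
  by_cases hpos : ∀ t ∈ I, 0 < w t
  · exact ⟨1, Or.inl rfl, fun t ht => by simpa using hpos t ht⟩
  · push Not at hpos
    obtain ⟨s, hs, hs0⟩ := hpos
    refine ⟨-1, Or.inr rfl, fun t ht => ?_⟩
    by_contra hn
    obtain ⟨r, hr, hr0⟩ := hI.intermediate_value hs ht hw ⟨hs0, by linarith⟩
    exact h0 r hr hr0

/-- G_t = A¹¹ G makes G exp(-Y⁰) constant, say -c₁. Then w and h have the derivatives of c₁ Y¹ and
-c₁ Y², and each integration adds one constant. This is where the virtual elements are
indispensable. -/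
theorem CanonicalForm.exists_constants (hF : CanonicalForm θ θ' φ T w G h b) (hθ : InBarL0 θ)
    (hI : IsOpen (Prod.fst '' φ.source)) (hc : IsPreconnected (Prod.fst '' φ.source))
    (hdom : Prod.fst '' φ.source = Prod.fst '' θ.dom) :
    ∃ c0 c1 c2 : ℝ, ∀ t ∈ Prod.fst '' φ.source, w t = c1 * θ.Y1 t + c0 ∧
      G t = -(c1 * Real.exp (θ.Y0 t)) ∧ h t = c2 - c1 * θ.Y2 t := by
  have hY0 := fun t ht => hθ.deriv_Y0 t (hdom ▸ ht)
  have hY1 := fun t ht => hθ.deriv_Y1 t (hdom ▸ ht)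
  have hY2 := fun t ht => hθ.deriv_Y2 t (hdom ▸ ht)
  obtain ⟨k, hk⟩ := exists_eq_add_const hI hc (f := fun t => G t * Real.exp (-θ.Y0 t))
    (g := fun _ => 0) (f' := fun _ => 0)
    (fun t ht => ((hF.deriv_G t ht).mul (hY0 t ht).neg.exp).congr_deriv (by ring))
    (fun t _ => hasDerivAt_const t 0)
  have hG : ∀ t ∈ Prod.fst '' φ.source, G t = k * Real.exp (θ.Y0 t) := by
    intro t ht
    have h1 : G t * Real.exp (-θ.Y0 t) = k := by simpa using hk t ht
    rw [← h1, mul_assoc, ← Real.exp_add]; simp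
  obtain ⟨c0, h0⟩ := exists_eq_add_const hI hc (f := w) (g := fun t => -k * θ.Y1 t)
    (f' := fun t => -k * Real.exp (θ.Y0 t))
    (fun t ht => (hF.deriv_w t ht).congr_deriv (by rw [hG t ht]; ring))
    (fun t ht => (hY1 t ht).const_mul _)
  obtain ⟨c2, h2⟩ := exists_eq_add_const hI hc (f := h) (g := fun t => k * θ.Y2 t)
    (f' := fun t => k * (θ.A10 t * Real.exp (θ.Y0 t)))
    (fun t ht => (hF.deriv_h t ht).congr_deriv (by rw [hG t ht]; ring))
    (fun t ht => (hY2 t ht).const_mul _)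
  exact ⟨c0, -k, c2, fun t ht => ⟨h0 t ht, by rw [hG t ht]; ring, by rw [h2 t ht]; ring⟩⟩

/-- The value of the constant `δ`. -/
theorem CanonicalForm.exists_δ (hF : CanonicalForm θ θ' φ T w G h b) (hθ : InBarL0 θ)
    (hθ' : InBarL0 θ') (hI : IsOpen (Prod.fst '' φ.source))
    (hc : IsPreconnected (Prod.fst '' φ.source)) (hdom : Prod.fst '' φ.source = Prod.fst '' θ.dom)
    (hdom' : ∀ t ∈ Prod.fst '' φ.source, T t ∈ Prod.fst '' θ'.dom) :
    ∃ δ : ℝ, ∀ t ∈ Prod.fst '' φ.source, 0 < δ * deriv T t ∧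
      Real.exp (θ'.Y0 (T t)) = Real.exp (θ.Y0 t) * (δ / (deriv T t * w t ^ 2)) := by
  have hY0 := fun t ht => hθ.deriv_Y0 t (hdom ▸ ht)
  have hT : ∀ t ∈ Prod.fst '' φ.source, HasDerivAt T (deriv T t) t := fun t ht =>
    ((hF.smooth_T.contDiffAt (hI.mem_nhds ht)).differentiableAt (by simp)).hasDerivAt
  have hTt : ∀ t ∈ Prod.fst '' φ.source, HasDerivAt (deriv T) (deriv (deriv T) t) t := fun t ht =>
    ((((contDiffOn_infty_iff_deriv_of_isOpen hI).1 hF.smooth_T).2.contDiffAt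
      (hI.mem_nhds ht)).differentiableAt (by simp)).hasDerivAt
  -- The first integral T_t w² exp(Ỹ⁰ - Y⁰) is constant by the A¹¹-relation; its value is δ.
  obtain ⟨δ, hδ⟩ := exists_eq_add_const hI hc
    (f := fun t => deriv T t * w t * w t * Real.exp (θ'.Y0 (T t) - θ.Y0 t))
    (g := fun _ => 0) (f' := fun _ => 0)
    (fun t ht => by
      have h1 := ((hθ'.deriv_Y0 _ (hdom' t ht)).comp t (hT t ht)).sub (hY0 t ht)
      refine ((((hTt t ht).mul (hF.deriv_w t ht)).mul (hF.deriv_w t ht)).mul h1.exp).congr_deriv ?_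
      have h2 := hF.A11 t ht
      simp only [Pi.mul_apply, Pi.sub_apply, Function.comp]
      linear_combination (-w t * Real.exp (θ'.Y0 (T t) - θ.Y0 t)) * h2)
    (fun t _ => hasDerivAt_const t 0)
  refine ⟨δ, fun t ht => ?_⟩
  have h1 := hF.Tt_ne_zero t ht
  have h2 := hF.w_ne_zero t ht
  have h3 : δ = deriv T t * w t * w t * Real.exp (θ'.Y0 (T t) - θ.Y0 t) := by
    simpa using (hδ t ht).symm
  constructor
  · have : δ * deriv T t = (deriv T t * w t) ^ 2 * Real.exp (θ'.Y0 (T t) - θ.Y0 t) := by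
      rw [h3]; ring
    rw [this]; positivity
  · rw [h3, Real.exp_sub]
    have := (Real.exp_pos (θ.Y0 t)).ne'
    field_simp

/-- Every transformation of the canonical form is induced by a transformation from the group. -/
theorem CanonicalForm.exists_induces (hF : CanonicalForm θ θ' φ T w G h b) (hθ : InBarL0 θ)
    (hθ' : InBarL0 θ') (hS : IsFibredDomain φ.source)
    (hdom : Prod.fst '' φ.source = Prod.fst '' θ.dom)
    (hdom' : ∀ t ∈ Prod.fst '' φ.source, T t ∈ Prod.fst '' θ'.dom) :
    ∃ Φ ∈ breveG, Induces Φ θ φ θ' := by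
  set I := Prod.fst '' φ.source with hIdef
  have hI : IsOpen I := hS.isOpen_base
  have hc : IsPreconnected I := hS.connected_base
  obtain ⟨c0, c1, c2, hcs⟩ := hF.exists_constants hθ hI hc hdom
  obtain ⟨δ, hδ⟩ := hF.exists_δ hθ hθ' hI hc hdom hdom'
  obtain ⟨ε, hε, hεw⟩ := exists_const_sign hc hF.smooth_w.continuousOn hF.w_ne_zero
  have hY0 := fun t ht => hθ.deriv_Y0 t (hdom ▸ ht)
  have hY1 := fun t ht => hθ.deriv_Y1 t (hdom ▸ ht)
  have hT : ∀ t ∈ I, HasDerivAt T (deriv T t) t := fun t ht =>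
    ((hF.smooth_T.contDiffAt (hI.mem_nhds ht)).differentiableAt (by simp)).hasDerivAt
  have hT's : ContDiffOn ℝ ∞ (deriv T) I :=
    ((contDiffOn_infty_iff_deriv_of_isOpen hI).1 hF.smooth_T).2
  have hTt : ∀ t ∈ I, HasDerivAt (deriv T) (deriv (deriv T) t) t := fun t ht =>
    ((hT's.contDiffAt (hI.mem_nhds ht)).differentiableAt (by simp)).hasDerivAt
  -- Since w = c₁ Y¹ + c₀ has no zeros, the constants cannot both vanish; the norm c₀² + c₁² serves
  -- as a denominator below.
  have hN : c0 ^ 2 + c1 ^ 2 ≠ 0 := by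
    intro hN
    have h0 : c0 = 0 := by nlinarith [sq_nonneg c0, sq_nonneg c1]
    have h1 : c1 = 0 := by nlinarith [sq_nonneg c0, sq_nonneg c1]
    obtain ⟨t, ht⟩ := hS.nonempty.image Prod.fst
    exact hF.w_ne_zero t ht (by rw [(hcs t ht).1, h0, h1]; ring)
  -- the component for `Y¹`
  obtain ⟨k, hk⟩ := exists_eq_add_const hI hc (f := fun t => θ'.Y1 (T t))
    -- A particular linear fractional function of Y¹ with denominator w and determinant δ: its
    -- numerator is orthogonal to w up to scale, which avoids distinguishing c₀ = 0 from c₁ = 0. It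
    -- has the derivative required of Ỹ¹, so the two differ by a constant k.
    (g := fun t => δ / (c0 ^ 2 + c1 ^ 2) * (c0 * θ.Y1 t + -c1) / w t)
    (f' := fun t => Real.exp (θ.Y0 t) * (δ / (w t ^ 2)))
    (fun t ht => by
      have h1 := hF.Tt_ne_zero t ht
      have h2 := hF.w_ne_zero t ht
      refine ((hθ'.deriv_Y1 _ (hdom' t ht)).comp t (hT t ht)).congr_deriv ?_
      rw [(hδ t ht).2]; field_simp)
    (fun t ht => by
      have h2 := hF.w_ne_zero t ht
      refine (((((hY1 t ht).const_mul c0).add_const (-c1)).const_mul (δ / (c0 ^ 2 + c1 ^ 2))).div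
        (hF.deriv_w t ht) h2).congr_deriv ?_
      rw [(hcs t ht).2.1]
      field_simp
      rw [(hcs t ht).1]; ring)
  -- Solves b = T_t w exp(-Y⁰/2) X.
  let X : ℝ → ℝ := fun t => Real.exp (θ.Y0 t / 2) * b t / (deriv T t * w t)
  have hXs : ContDiffOn ℝ ∞ X I :=
    (((hdom ▸ hθ.smooth_Y0 : ContDiffOn ℝ ∞ θ.Y0 I).div_const 2).exp.mul hF.smooth_b).div
      (hT's.mul hF.smooth_w) fun t ht => mul_ne_zero (hF.Tt_ne_zero t ht) (hF.w_ne_zero t ht)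
  -- Adding k times w to the numerator of the particular solution absorbs k and leaves the
  -- determinant δ unchanged. The constant c₃ stays free, since it affects only Ỹ².
  let P : ℝ → Params := fun c3 => ⟨I, T, X, c0, c1, c2, c3,
    -(δ * c1 / (c0 ^ 2 + c1 ^ 2)) + k * c0, δ * c0 / (c0 ^ 2 + c1 ^ 2) + k * c1, ε⟩
  have hPδ : ∀ c3, (P c3).δ = δ := by
    intro c3; simp only [Params.δ, P]; field_simp; ring
  have hPw : ∀ c3, ∀ t ∈ I, (P c3).w (θ.Y1 t) = w t := fun c3 t ht => ((hcs t ht).1).symm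
  have hv : ∀ c3, (P c3).Valid := fun c3 =>
    { isOpen := hI
      connected := hc
      smooth_T := hF.smooth_T
      smooth_X := hXs
      pos := fun t ht => by rw [hPδ]; exact (hδ t ht).1
      sign := hε
      nonempty := by
        obtain ⟨t, ht⟩ := hS.nonempty.image Prod.fst
        refine ⟨((t, 0, 0), (0, 0, 0, 0, θ.Y1 t, 0)), Params.mem_source.2 ⟨ht, ?_⟩⟩
        rw [hPw c3 t ht]; exact hεw t ht }
  have hy0 : ∀ c3, ∀ t ∈ I, (P c3).y0 t (θ.Y0 t) (θ.Y1 t) = θ'.Y0 (T t) := by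
    intro c3 t ht
    apply Real.exp_injective
    rw [(hv c3).exp_y0 ht (by rw [hPw c3 t ht]; exact hF.w_ne_zero t ht), hPw c3 t ht, hPδ,
      (hδ t ht).2]
  have hy1 : ∀ c3, ∀ t ∈ I, (P c3).y1 (θ.Y1 t) = θ'.Y1 (T t) := by
    intro c3 t ht
    have h2 := hF.w_ne_zero t ht
    have h3 := hk t ht
    rw [h3, Params.y1, hPw c3 t ht]
    simp only [P]
    field_simp
    rw [(hcs t ht).1]; ring
  have hXb : ∀ t ∈ I, b t = deriv T t * w t * (Real.exp (-θ.Y0 t / 2) * X t) := by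
    intro t ht
    have h1 := hF.Tt_ne_zero t ht
    have h2 := hF.w_ne_zero t ht
    have h3 : Real.exp (-(θ.Y0 t / 2)) * Real.exp (θ.Y0 t / 2) = 1 := by
      rw [← Real.exp_add, neg_add_cancel, Real.exp_zero]
    simp only [X, neg_div]
    field_simp
    linear_combination -b t * h3
  have ha11 : ∀ c3, ∀ t ∈ I, (P c3).a11 t (θ.A11 t) (θ.Y0 t) (θ.Y1 t) = θ'.A11 (T t) := by
    intro c3 t ht
    have h1 := hF.Tt_ne_zero t ht
    have h2 := hF.w_ne_zero t ht
    have h3 := hF.A11 t ht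
    rw [Params.a11, hPw c3 t ht]
    rw [(hcs t ht).2.1] at h3
    simp only [P]
    field_simp
    linear_combination h3
  have ha10 : ∀ c3, ∀ t ∈ I, (P c3).a10 t (θ.A10 t) (θ.A11 t) (θ.Y0 t) (θ.Y1 t) (θ.Y2 t) =
      θ'.A10 (T t) := by
    intro c3 t ht
    have h1 := hF.Tt_ne_zero t ht
    have h2 := hF.w_ne_zero t ht
    have h3 := hF.A11 t ht
    have h4 := hF.A10 t ht
    have dE : HasDerivAt (fun t => Real.exp (-θ.Y0 t / 2))
        (Real.exp (-θ.Y0 t / 2) * (-θ.A11 t / 2)) t := ((hY0 t ht).neg.div_const 2).exp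
    have db := ((hTt t ht).mul (hF.deriv_w t ht)).mul (dE.mul ((hv c3).hasDerivAt_X ht))
    have eb : b =ᶠ[𝓝 t] fun t => deriv T t * w t * (Real.exp (-θ.Y0 t / 2) * X t) := by
      filter_upwards [hI.mem_nhds ht] with s hs using hXb s hs
    have hb' := (db.congr_of_eventuallyEq eb).deriv
    have hEE : Real.exp (θ.Y0 t) * Real.exp (-θ.Y0 t / 2) = Real.exp (θ.Y0 t / 2) := by
      rw [← Real.exp_add]; congr 1; ring
    rw [hb', hXb t ht, (hcs t ht).2.2] at h4
    rw [(hcs t ht).2.1] at h3 h4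
    simp only [Pi.mul_apply] at h4
    rw [Params.a10, hPw c3 t ht]
    simp only [P] at h4 ⊢
    rw [← hEE]
    apply mul_left_cancel₀ h1
    linear_combination h4 - (Real.exp (-θ.Y0 t / 2) * X t) * h3
  -- the component for `Y²`
  obtain ⟨c3, hc3⟩ := exists_eq_add_const hI hc (f := fun t => θ'.Y2 (T t))
    (g := fun t => (P 0).y2 t (θ.Y0 t) (θ.Y1 t) (θ.Y2 t))
    (f' := fun t => θ'.A10 (T t) * Real.exp (θ'.Y0 (T t)) * deriv T t)
    (fun t ht => (hθ'.deriv_Y2 _ (hdom' t ht)).comp t (hT t ht))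
    (fun t ht => by
      -- `Contact.map` with c₃ = 0 shows that the predicted and the given Ỹ² have the same
      -- derivative; their difference is the sought c₃.
      have h1 := ((hθ.contact (hdom ▸ ht)).map (hv 0) ht
        (by rw [hPw 0 t ht]; exact hF.w_ne_zero t ht)).deriv_Y2
      rw [ha10 0 t ht] at h1
      refine h1.congr_deriv ?_
      rw [hy0 0 t ht]
      simp only [P]; ring)
  have hy2 : ∀ t ∈ I, (P c3).y2 t (θ.Y0 t) (θ.Y1 t) (θ.Y2 t) = θ'.Y2 (T t) := by
    intro t ht
    have h1 := hc3 t ht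
    have h2 : (P c3).δ = (P 0).δ := by rw [hPδ, hPδ]
    rw [h1, Params.y2, Params.y2, hy1 c3 t ht, hy1 0 t ht, hPw c3 t ht, hPw 0 t ht, h2]
    simp only [P]; ring
  obtain ⟨Φ, hΦ⟩ := (hv c3).exists_transformation
  refine ⟨Φ, ⟨P c3, hv c3, hΦ⟩, fun z hz => ?_⟩
  have ht : z.1 ∈ I := mem_image_of_mem _ hz
  have hA2 := hF.A2 z hz
  have hap := hF.apply z hz
  obtain ⟨t, x, u⟩ := z
  simp only at ht hA2 hap
  have hmem : (((t, x, u), θ.val (tx (t, x, u))) : Space9) ∈ (P c3).source :=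
    Params.mem_source.2 ⟨ht, by change 0 < ε * (P c3).w (θ.Y1 t); rw [hPw c3 t ht]; exact hεw t ht⟩
  refine ⟨by rw [hΦ.2.1]; exact hmem, ?_⟩
  rw [hΦ.2.2 hmem]
  have hφ1 : (φ (t, x, u)).1 = T t := by rw [hap]
  have hval : θ'.val (tx (φ (t, x, u))) = (θ'.A10 (T t), θ'.A11 (T t), θ'.A2 (tx (φ (t, x, u))),
      θ'.Y0 (T t), θ'.Y1 (T t), θ'.Y2 (T t)) := by
    simp only [ExtTuple.val]
    have : (tx (φ (t, x, u))).1 = T t := hφ1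
    rw [this]
  have hval' : θ.val (tx (t, x, u)) = (θ.A10 t, θ.A11 t, θ.A2 (tx (t, x, u)), θ.Y0 t, θ.Y1 t,
    θ.Y2 t) := rfl
  rw [hval, hval', Params.map_apply, ha10 c3 t ht, ha11 c3 t ht, hy0 c3 t ht, hy1 c3 t ht,
    hy2 t ht, hA2, hap]
  refine Prod.ext (Prod.ext rfl (Prod.ext ?_ ?_)) (Prod.ext rfl (Prod.ext rfl (Prod.ext ?_ rfl)))
  · simp only [Params.x]
    rw [hPw c3 t ht, hXb t ht]
    simp only [P]; ring
  · simp only [Params.u]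
    rw [hPw c3 t ht, (hcs t ht).2.1, (hcs t ht).2.2]
    simp only [P]; ring
  · simp only
    rw [hPw c3 t ht]

theorem generatesHatGroupoid_breveG : GeneratesHatGroupoid breveG := by
  refine ⟨breveG_subset_barG, ?_⟩
  rintro E φ E' ⟨hE, hE', hφ, hc⟩ θ hθ hR θ' hθ' hR'
  simp only at hE hE' hφ hc
  obtain ⟨T, w, G, h, b, hF⟩ := hc.exists_canonicalForm hφ hE hE' hR hR'
  refine hF.exists_induces hθ hθ' hc.source_domain ?_ ?_
  · rw [hR.1, ← hc.source_over, fst_image_tx]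
  · rintro _ ⟨z, hz, rfl⟩
    rw [hR'.1, ← hc.target_over, fst_image_tx]
    refine ⟨φ z, φ.map_source hz, ?_⟩
    rw [hF.apply z hz]

/-- The explicit family lies in the extended generalized equivalence group, so generation by it
implies generation by the whole group. -/
theorem hatL0_normalized : HatL0NormalizedInExtendedGeneralizedSense := by
  refine ⟨isCovering, Subset.rfl, fun E φ E' ha θ hθ hR θ' hθ' hR' => ?_⟩
  obtain ⟨Φ, hΦ, h⟩ := generatesHatGroupoid_breveG.2 E φ E' ha θ hθ hR θ' hθ' hR'
  exact ⟨Φ, breveG_subset_barG hΦ, h⟩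

end Generation

end BurgersClass

theorem mainTheorem6 :
    BurgersClass.HatL0NormalizedInExtendedGeneralizedSense ∧
    (∀ P : BurgersClass.Params, P.Valid →
      ∃ Φ : OpenPartialHomeomorph BurgersClass.Space9 BurgersClass.Space9,
        BurgersClass.IsTransformationWith Φ P) ∧
    BurgersClass.IsLocalGroup BurgersClass.breveG ∧
    BurgersClass.GeneratesHatGroupoid BurgersClass.breveG := by
  exact ⟨BurgersClass.hatL0_normalized, fun _ h => h.exists_transformation,
    BurgersClass.isLocalGroup_breveG, BurgersClass.generatesHatGroupoid_breveG⟩
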